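/- **Setting.** Fix a linearly ordered infinite set of non-fresh constants and the set $\{\alpha_0<\alpha_1<\dots\}$ of fresh constants, all of which follow the non-fresh ones. An EER schema $\mathcal C$ consists of finitely many entities (with is-a clauses), relationships among $n\ge 2$ entities (with is-a clauses that carry permutations of the components) and attributes of entities or relationships (possibly functional, possibly mandatory), together with participation clauses $\ge 1$ and $\le 1$ of an entity as component $c$ of a relationship whose $c$-th entity it is. Its relational schema $\mathcal R$ has a unary predicate for each entity, an $n$-ary one for each $n$-ary relationship, and for each attribute a predicate whose arity is one more than that of the predicate of its owner. Predicates are linearly ordered. The conceptual dependencies $\Sigma$ of $\mathcal C$ are: - inclusion dependencies (IDs): $a[1..n]\subseteq p[1..n]$ for an attribute $a$ with $n$-ary owner $p$, and also $p[1..n]\subseteq a[1..n]$ if it is mandatory; $r[i]\subseteq e_i[1]$ for the $i$-th entity $e_i$ of $r$; $e_1[1]\subseteq e_2[1]$ and $r_1[1..n]\subseteq r_2[j_1..j_n]$ for is-a; $e[1]\subseteq r[c]$ for participation $\ge1$; - key dependencies (KDs): $key(a)=\{1..n\}$ for a functional attribute with $n$-ary owner; $key(r)=\{c\}$ for participation $\le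 1$ as component $c$. A database is a finite set $D$ of facts over $\mathcal R$. Its join graph has the facts as nodes and joins two facts iff they share a constant; $\kappa(D)$ is the number of facts in a largest connected component. **Chase.** $chase_\Sigma(D)$ is obtained from $D$ (level $0$) by repeating the following. As long as two distinct facts of a relation agree on a key, merge such a pair: argument by argument, replace both constants everywhere by the one that comes first in the order; the chase fails (does not exist) if two distinct non-fresh constants would have to be merged; collapsing facts get the lowest of their levels. Then, if some ID $r[\bar X]\subseteq s[\bar Y]$ and some fact $r(t)$ have no $s(t')$ with $t'[\bar Y]=t[\bar X]$, add one $s(t')$ with $t'[\bar Y]=t[\bar X]$ and with new fresh constants, following all previous ones, in the other positions, at the level of $r(t)$ plus $1$. Pairs for KDs are chosen by lowest minimum level, then lexicographically; for IDs, full-width IDs come first, then facts of lowest level, then lexicographic order. $chase_\Sigma(D)$ consists of the facts that are eventually permanently present, with their final levels. **Chase with equality.** $chase_{eq}(\Sigma,D)$ is built in the same way, except that $eq(c,c)$ is added at level $0$ for each constant $c$ of $D$, and at the level of the new fact for each new fresh constant $c$; KDs and IDs are tested up to $eq$; and instead of merging two facts $r(t),r(t')$, the missing atoms $eq(t_i,t'_i)$,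 $eq(t'_i,t_i)$ and those that follow by transitivity are added, at the lower of the levels of the two facts (failure if distinct non-fresh constants become equal). A conjunctive query $q$ of arity $n$ over $\mathcal R$ has a head $q(X_1,\dots,X_n)$ with distinct variables that occur in the body, and a body that is a finite list of atoms over $\mathcal R$ with variables and non-fresh constants. Its fresh-free answers over a set $I$ of atoms are the tuples $t$ of non-fresh constants such that some homomorphism (identity on non-fresh constants) sends the body to atoms of $I$ and the head to $t$. The query $q_{eq}$ is obtained from $q$ by replacing every occurrence of a term $u$ in the body by a new variable $X$ and adding the atom $eq(X,u)$ to the body. **Statement.** For all $\mathcal C$ (with its $\mathcal R$ and $\Sigma$) and every conjunctive query $q$ over $\mathcal R$ there is a function $\delta_M:\mathbb N\to\mathbb N$ such that for every database $D$ over $\mathcal R$ for which $chase_\Sigma(D)$ exists, with $\delta=\delta_M(\kappa(D))$: 1. for every fresh-free answer $t$ to $q$ over $chase_\Sigma(D)$ there is a homomorphism $\mu$ sending the body of $q$ to facts of $chase_\Sigma(D)$ of level at most $\delta$ and the head of $q$ to $t$; 2. with the same $\delta$, for every fresh-free answer $t$ to $q$ over $chase_{eq}(\Sigma,D)$ there is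 a homomorphism $\mu$ sending the body of $q$ to atoms of $chase_{eq}(\Sigma,D)$ of level at most $\delta$ and the head of $q$ to $t$; 3. with the same $\delta$, the same holds for $q_{eq}$ over $chase_{eq}(\Sigma,D)$. -/

import Mathlib

/-! ## Relational schemata, constants, facts, dependencies -/

/-- A relational schema: predicate symbols, each with an arity. -/
structure RelSchema where
  Pred : Type
  arity : Pred → ℕ

/-- The schema extended by the binary predicate `eq` (the symbol `none`). -/
def RelSchema.withEq (S : RelSchema) : RelSchema where
  Pred := Option S.Pred
  arity
    | some p => S.arity p
    | none => 2

/-- Constants: the non-fresh constants `Dom` followed (in the order) by the fresh constants,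
which are indexed by `ℕ`. -/
abbrev Const (Dom : Type*) := Dom ⊕ₗ ℕ

namespace Const

/-- A non-fresh constant. -/
def dom {Dom : Type*} (d : Dom) : Const Dom := toLex (Sum.inl d)

/-- A fresh constant. -/
def fresh {Dom : Type*} (k : ℕ) : Const Dom := toLex (Sum.inr k)

end Const

/-- `p(x₁, …, xₙ)` with arguments in `K`: a fact when `K` is a set of constants, an atom of a query
when `K` is a set of terms. -/
@[ext]
structure RelAtom (S : RelSchema) (K : Type*) where
  pred : S.Pred
  args : Fin (S.arity pred) → K

namespace RelAtom

/-- Apply a map to all arguments. -/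
def map {S : RelSchema} {K L : Type*} (σ : K → L) (f : RelAtom S K) : RelAtom S L :=
  ⟨f.pred, fun i => σ (f.args i)⟩

/-- The same atom over the schema extended by `eq`. -/
def toEq {S : RelSchema} {K : Type*} (f : RelAtom S K) : RelAtom S.withEq K :=
  ⟨some f.pred, f.args⟩

/-- Facts are ordered lexicographically: first the predicate, then the arguments. -/
def key {S : RelSchema} {K : Type*} (f : RelAtom S K) : S.Pred ×ₗ List K :=
  toLex (f.pred, List.ofFn f.args)

end RelAtom

/-- The inclusion dependency `src[srcPos] ⊆ tgt[tgtPos]`. -/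
structure InclDep (S : RelSchema) where
  src : S.Pred
  tgt : S.Pred
  width : ℕ
  srcPos : Fin width → Fin (S.arity src)
  tgtPos : Fin width → Fin (S.arity tgt)

namespace InclDep

/-- Every attribute of the source occurs exactly once on the left, every attribute of the target
exactly once on the right. -/
def FullWidth {S : RelSchema} (σ : InclDep S) : Prop :=
  Function.Bijective σ.srcPos ∧ Function.Bijective σ.tgtPos

/-- Lexicographic encoding, used to sort inclusion dependencies. -/
def key {S : RelSchema} (σ : InclDep S) : S.Pred ×ₗ S.Pred ×ₗ List ℕ ×ₗ List ℕ :=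
  toLex (σ.src, toLex (σ.tgt, toLex
    (List.ofFn fun i => (σ.srcPos i : ℕ), List.ofFn fun i => (σ.tgtPos i : ℕ))))

end InclDep

/-- The key dependency `key(rel) = attrs`. -/
structure KeyDep (S : RelSchema) where
  rel : S.Pred
  attrs : Finset (Fin (S.arity rel))

/-- Lexicographic encoding, used to sort key dependencies. -/
def KeyDep.key {S : RelSchema} (κ : KeyDep S) : S.Pred ×ₗ List ℕ :=
  toLex (κ.rel, ((List.finRange (S.arity κ.rel)).filter (· ∈ κ.attrs)).map Fin.val)

/-! ## Extended Entity-Relationship schemata and conceptual dependencies -/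

/-- An Extended Entity-Relationship schema. -/
structure EERSchema where
  /-- entity symbols -/
  Ent : Type
  /-- relationship symbols -/
  Rel : Type
  /-- attribute symbols -/
  Att : Type
  /-- the is-a clause of an entity definition -/
  entIsa : Ent → Set Ent
  /-- the number of components of a relationship -/
  relArity : Rel → ℕ
  two_le_relArity : ∀ R, 2 ≤ relArity R
  /-- the entities among which a relationship is defined -/
  among : (R : Rel) → Fin (relArity R) → Ent
  /-- the is-a clause of a relationship definition: `⟨R', j⟩ ∈ relIsa R` says that `R` is-a `R'`,
  component `i` of `R` corresponding to component `j i` of `R'` -/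
  relIsa : (R : Rel) → Set ((R' : Rel) × (Fin (relArity R) ≃ Fin (relArity R')))
  /-- the clause `participates(≥ 1)` of an entity definition -/
  partMin : Ent → Set ((R : Rel) × Fin (relArity R))
  partMin_among : ∀ E, ∀ x ∈ partMin E, among x.1 x.2 = E
  /-- the clause `participates(≤ 1)` of an entity definition -/
  partMax : Ent → Set ((R : Rel) × Fin (relArity R))
  partMax_among : ∀ E, ∀ x ∈ partMax E, among x.1 x.2 = E
  /-- the entity or relationship with which an attribute is associated -/
  owner : Att → Ent ⊕ Rel
  /-- functional attributes -/
  functional : Set Att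
  /-- mandatory attributes -/
  mandatory : Set Att

namespace EERSchema

variable (C : EERSchema)

/-- The arity of the predicate of an entity (`1`) or a relationship. -/
def baseArity : C.Ent ⊕ C.Rel → ℕ
  | Sum.inl _ => 1
  | Sum.inr R => C.relArity R

/-- The associated relational schema: one predicate for each entity, relationship and attribute;
the predicate of an attribute has one argument more than that of its owner. -/
def schema : RelSchema where
  Pred := (C.Ent ⊕ C.Rel) ⊕ C.Att
  arity
    | Sum.inl x => C.baseArity x
    | Sum.inr A => C.baseArity (C.owner A) + 1

/-- The predicate of an entity. -/
def ent (E : C.Ent) : C.schema.Pred := Sum.inl (Sum.inl E)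

/-- The predicate of a relationship. -/
def rel (R : C.Rel) : C.schema.Pred := Sum.inl (Sum.inr R)

/-- The predicate of an attribute. -/
def att (A : C.Att) : C.schema.Pred := Sum.inr A

/-- The predicate of the entity or relationship that owns an attribute. -/
def ownerPred (A : C.Att) : C.schema.Pred := Sum.inl (C.owner A)

/-- The only attribute of the predicate of an entity. -/
def entPos (E : C.Ent) : Fin (C.schema.arity (C.ent E)) := (0 : Fin 1)

/-- Component `i` of a relationship as an attribute of its predicate. -/
def relPos (R : C.Rel) (i : Fin (C.relArity R)) : Fin (C.schema.arity (C.rel R)) := i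

/-- Attribute `i ≤ n` of the predicate of arity `n + 1` of an attribute whose owner has arity
`n`. -/
def attPos (A : C.Att) (i : Fin (C.schema.arity (C.ownerPred A))) :
    Fin (C.schema.arity (C.att A)) :=
  Fin.castSucc i

/-- The inclusion dependencies of an EER schema. -/
inductive IsInclDep : InclDep C.schema → Prop
  /-- `a[1,…,n] ⊆ p[1,…,n]` for an attribute of an entity (`n = 1`) or a relationship -/
  | attOwner (A : C.Att) :
      IsInclDep ⟨C.att A, C.ownerPred A, C.schema.arity (C.ownerPred A), C.attPos A, id⟩
  /-- `r[i] ⊆ eᵢ[1]` for the components of a relationship -/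
  | relComp (R : C.Rel) (i : Fin (C.relArity R)) :
      IsInclDep ⟨C.rel R, C.ent (C.among R i), 1, fun _ => C.relPos R i, fun _ => C.entPos _⟩
  /-- `p[1,…,n] ⊆ a[1,…,n]` for a mandatory attribute of an entity or a relationship -/
  | attMandatory (A : C.Att) (h : A ∈ C.mandatory) :
      IsInclDep ⟨C.ownerPred A, C.att A, C.schema.arity (C.ownerPred A), id, C.attPos A⟩
  /-- `e₁[1] ⊆ e₂[1]` for an is-a between entities -/
  | entIsa (E₁ E₂ : C.Ent) (h : E₂ ∈ C.entIsa E₁) :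
      IsInclDep ⟨C.ent E₁, C.ent E₂, 1, fun _ => C.entPos _, fun _ => C.entPos _⟩
  /-- `r₁[1,…,n] ⊆ r₂[j₁,…,jₙ]` for an is-a between relationships -/
  | relIsa (R₁ R₂ : C.Rel) (j : Fin (C.relArity R₁) ≃ Fin (C.relArity R₂))
      (h : ⟨R₂, j⟩ ∈ C.relIsa R₁) :
      IsInclDep ⟨C.rel R₁, C.rel R₂, C.relArity R₁, C.relPos R₁, fun i => C.relPos R₂ (j i)⟩
  /-- `e[1] ⊆ r[c]` for a mandatory participation -/
  | partMin (E : C.Ent) (R : C.Rel) (c : Fin (C.relArity R)) (h : ⟨R, c⟩ ∈ C.partMin E) :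
      IsInclDep ⟨C.ent E, C.rel R, 1, fun _ => C.entPos E, fun _ => C.relPos R c⟩

/-- The key dependencies of an EER schema. -/
inductive IsKeyDep : KeyDep C.schema → Prop
  /-- `key(a) = {1,…,n}` for a functional attribute of an entity (`n = 1`) or a relationship -/
  | attFunctional (A : C.Att) (h : A ∈ C.functional) :
      IsKeyDep ⟨C.att A, Finset.univ.image (C.attPos A)⟩
  /-- `key(r) = {c}` for a participation with maximum cardinality `1` -/
  | partMax (E : C.Ent) (R : C.Rel) (c : Fin (C.relArity R)) (h : ⟨R, c⟩ ∈ C.partMax E) :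
      IsKeyDep ⟨C.rel R, {C.relPos R c}⟩

/-- The set of conceptual dependencies of an EER schema: its inclusion dependencies. -/
def inclDeps : Set (InclDep C.schema) := {σ | C.IsInclDep σ}

/-- The set of conceptual dependencies of an EER schema: its key dependencies. -/
def keyDeps : Set (KeyDep C.schema) := {κ | C.IsKeyDep κ}

end EERSchema

/-! ## The join graph of a database -/

section JoinGraph

variable {S : RelSchema} {K : Type*}

/-- The join graph of a database: its facts, two distinct ones being adjacent iff they share a
constant. -/
def joinGraph (D : Finset (RelAtom S K)) : SimpleGraph D where
  Adj f g := f ≠ g ∧ ∃ i j, f.1.args i = g.1.args j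
  symm := ⟨fun _ _ ⟨hne, i, j, h⟩ => ⟨hne.symm, j, i, h.symm⟩⟩
  loopless := ⟨fun _ h => h.1 rfl⟩

/-- The number of facts of the largest connected part of the join graph. -/
noncomputable def connSize (D : Finset (RelAtom S K)) : ℕ :=
  ⨆ c : (joinGraph D).ConnectedComponent, c.supp.ncard

end JoinGraph

/-! ## Conjunctive queries -/

/-- Terms of a query: variables and non-fresh constants. -/
inductive QTerm (Dom V : Type*) where
  | var (x : V)
  | const (d : Dom)

namespace QTerm

/-- The value of a term under an assignment of constants to the variables. -/
def eval {Dom V : Type*} (μ : V → Const Dom) : QTerm Dom V → Const Dom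
  | var x => μ x
  | const d => Const.dom d

/-- Rename the variables. -/
def rename {Dom V W : Type*} (f : V → W) : QTerm Dom V → QTerm Dom W
  | var x => var (f x)
  | const d => const d

end QTerm

/-- A conjunctive query of arity `n`: the head is a sequence of distinct variables, each of which
occurs in the body. -/
structure ConjQuery (S : RelSchema) (Dom V : Type*) (n : ℕ) where
  head : Fin n → V
  head_injective : Function.Injective head
  body : List (RelAtom S (QTerm Dom V))
  range_restricted : ∀ i, ∃ A ∈ body, ∃ j, A.args j = QTerm.var (head i)

namespace ConjQuery

variable {S : RelSchema} {Dom V : Type*} {n : ℕ}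

/-- The homomorphism given by `μ` sends the body of `q` to facts of `I` and its head to `t`. -/
def Sends (q : ConjQuery S Dom V n) (μ : V → Const Dom) (I : Set (RelAtom S (Const Dom)))
    (t : Fin n → Const Dom) : Prop :=
  (∀ A ∈ q.body, A.map (QTerm.eval μ) ∈ I) ∧ ∀ i, μ (q.head i) = t i

/-- The answers to `q` over `I` whose tuples contain no fresh constants. -/
def freshFreeAnswers (q : ConjQuery S Dom V n) (I : Set (RelAtom S (Const Dom))) :
    Set (Fin n → Const Dom) :=
  {t | (∃ μ, q.Sends μ I t) ∧ ∀ i, ∃ d, t i = Const.dom d}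

/-- A query over `S` as a query over `S` extended by `eq`. -/
def toEq (q : ConjQuery S Dom V n) : ConjQuery S.withEq Dom V n where
  head := q.head
  head_injective := q.head_injective
  body := q.body.map RelAtom.toEq
  range_restricted i := by
    obtain ⟨A, hA, j, hj⟩ := q.range_restricted i
    exact ⟨A.toEq, List.mem_map_of_mem hA, j, hj⟩

/-- The places of a query: the argument positions of its body atoms. -/
abbrev Place (q : ConjQuery S Dom V n) : Type :=
  (k : Fin q.body.length) × Fin (S.arity (q.body.get k).pred)

/-- The `k`-th body atom, with a new variable at each place. -/
def maquillageAtom (q : ConjQuery S Dom V n) (k : Fin q.body.length) :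
    RelAtom S.withEq (QTerm Dom (V ⊕ q.Place)) :=
  ⟨some (q.body.get k).pred, fun j => QTerm.var (Sum.inr ⟨k, j⟩)⟩

/-- The atom `eq(X, u)`, where `X` is the new variable for the `j`-th argument `u` of the `k`-th
body atom. -/
def maquillageEq (q : ConjQuery S Dom V n) (k : Fin q.body.length)
    (j : Fin (S.arity (q.body.get k).pred)) : RelAtom S.withEq (QTerm Dom (V ⊕ q.Place)) :=
  ⟨none, (![QTerm.var (Sum.inr ⟨k, j⟩), ((q.body.get k).args j).rename Sum.inl] :
    Fin 2 → QTerm Dom (V ⊕ q.Place))⟩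

/-- The equality maquillage of a query: every occurrence of a term `u` in the body is replaced by a
new variable `X`, and the atom `eq(X, u)` is added to the body. -/
def maquillage (q : ConjQuery S Dom V n) : ConjQuery S.withEq Dom (V ⊕ q.Place) n where
  head i := Sum.inl (q.head i)
  head_injective := Sum.inl_injective.comp q.head_injective
  body := (List.finRange q.body.length).map q.maquillageAtom ++
    (List.finRange q.body.length).flatMap fun k =>
      (List.finRange (S.arity (q.body.get k).pred)).map (q.maquillageEq k)
  range_restricted i := by
    obtain ⟨A, hA, j, hj⟩ := q.range_restricted i
    obtain ⟨k, rfl⟩ := List.get_of_mem hA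
    refine ⟨q.maquillageEq k j, ?_, (1 : Fin 2), ?_⟩
    · simp only [List.mem_append, List.mem_flatMap, List.mem_map]
      exact Or.inr ⟨k, List.mem_finRange k, j, List.mem_finRange j, rfl⟩
    · change ((q.body.get k).args j).rename Sum.inl = _
      rw [hj]
      rfl

end ConjQuery

/-! ## The chase

All chases are sequences of states. A state assigns to every fact its level, the level of a fact
that is absent being `⊤`, and keeps the index of the next unused fresh constant. -/

section Chase

variable {S : RelSchema} {Dom : Type*}

/-- The first index after those of all fresh constants of `D`. -/
noncomputable def firstFresh (D : Finset (RelAtom S (Const Dom))) : ℕ :=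
  sInf {m | ∀ f ∈ D, ∀ i k, f.args i = Const.fresh k → k < m}

open Classical in
/-- The tuple that the inclusion dependency `σ` generates from the tuple `t`: `t[srcPos]` at the
attributes `tgtPos`, and new fresh constants elsewhere. -/
noncomputable def InclDep.newTuple (σ : InclDep S) (t : Fin (S.arity σ.src) → Const Dom)
    (next : ℕ) : Fin (S.arity σ.tgt) → Const Dom :=
  fun j => if h : ∃ i, σ.tgtPos i = j then t (σ.srcPos h.choose) else Const.fresh (next + j)

/-- A key dependency together with two tuples of its relation. -/
structure KDTrigger (S : RelSchema) (Dom : Type*) where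
  dep : KeyDep S
  fst : Fin (S.arity dep.rel) → Const Dom
  snd : Fin (S.arity dep.rel) → Const Dom

namespace KDTrigger

/-- The first fact of the pair. -/
def fact₁ (τ : KDTrigger S Dom) : RelAtom S (Const Dom) := ⟨τ.dep.rel, τ.fst⟩

/-- The second fact of the pair. -/
def fact₂ (τ : KDTrigger S Dom) : RelAtom S (Const Dom) := ⟨τ.dep.rel, τ.snd⟩

/-- The level of a pair of facts: the lower of their levels. -/
noncomputable def level (τ : KDTrigger S Dom) (lev : RelAtom S (Const Dom) → ℕ∞) : ℕ∞ :=
  min (lev τ.fact₁) (lev τ.fact₂)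

/-- Pairs of facts are considered by level, then lexicographically, then key dependencies
lexicographically. -/
noncomputable def rank (τ : KDTrigger S Dom) (lev : RelAtom S (Const Dom) → ℕ∞) :
    ℕ∞ ×ₗ (S.Pred ×ₗ List (Const Dom)) ×ₗ (S.Pred ×ₗ List (Const Dom)) ×ₗ (S.Pred ×ₗ List ℕ) :=
  toLex (τ.level lev, toLex (τ.fact₁.key, toLex (τ.fact₂.key, τ.dep.key)))

/-- `τ` comes first among the triggers that satisfy `P`. -/
def First [LinearOrder S.Pred] [LinearOrder Dom] (lev : RelAtom S (Const Dom) → ℕ∞)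
    (P : KDTrigger S Dom → Prop) (τ : KDTrigger S Dom) : Prop :=
  P τ ∧ ∀ τ', P τ' → τ.rank lev ≤ τ'.rank lev

end KDTrigger

/-- An inclusion dependency together with a tuple of its source relation. -/
structure IDTrigger (S : RelSchema) (Dom : Type*) where
  dep : InclDep S
  tup : Fin (S.arity dep.src) → Const Dom

namespace IDTrigger

/-- The fact to which the dependency is applied. -/
def fact (τ : IDTrigger S Dom) : RelAtom S (Const Dom) := ⟨τ.dep.src, τ.tup⟩

/-- The fact that is generated. -/
noncomputable def newFact (τ : IDTrigger S Dom) (next : ℕ) : RelAtom S (Const Dom) :=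
  ⟨τ.dep.tgt, τ.dep.newTuple τ.tup next⟩

open Classical in
/-- Full-width dependencies are considered first; then facts are considered by level, then
lexicographically, then inclusion dependencies lexicographically. -/
noncomputable def rank (τ : IDTrigger S Dom) (lev : RelAtom S (Const Dom) → ℕ∞) :
    ℕ ×ₗ ℕ∞ ×ₗ (S.Pred ×ₗ List (Const Dom)) ×ₗ (S.Pred ×ₗ S.Pred ×ₗ List ℕ ×ₗ List ℕ) :=
  toLex (if τ.dep.FullWidth then 0 else 1, toLex (lev τ.fact, toLex (τ.fact.key, τ.dep.key)))

/-- `τ` comes first among the triggers that satisfy `P`. -/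
def First [LinearOrder S.Pred] [LinearOrder Dom] (lev : RelAtom S (Const Dom) → ℕ∞)
    (P : IDTrigger S Dom → Prop) (τ : IDTrigger S Dom) : Prop :=
  P τ ∧ ∀ τ', P τ' → τ.rank lev ≤ τ'.rank lev

end IDTrigger

/-! ### The chase -/

/-- A state of the chase. -/
structure ChaseState (S : RelSchema) (Dom : Type*) where
  lev : RelAtom S (Const Dom) → ℕ∞
  next : ℕ

namespace ChaseState

open Classical in
/-- The initial state: the facts of `D`, at level `0`. -/
noncomputable def init (D : Finset (RelAtom S (Const Dom))) : ChaseState S Dom where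
  lev f := if f ∈ D then 0 else ⊤
  next := firstFresh D

/-- The fact `f` is present. -/
def Has (s : ChaseState S Dom) (f : RelAtom S (Const Dom)) : Prop := s.lev f ≠ ⊤

/-- The key dependency chase rule is applicable: two distinct facts agree on the key. -/
def KDApplicable [LinearOrder S.Pred] [LinearOrder Dom] (K : Set (KeyDep S))
    (s : ChaseState S Dom) (τ : KDTrigger S Dom) : Prop :=
  τ.dep ∈ K ∧ s.Has τ.fact₁ ∧ s.Has τ.fact₂ ∧ τ.fact₁.key < τ.fact₂.key ∧
    ∀ i ∈ τ.dep.attrs, τ.fst i = τ.snd i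

/-- The inclusion dependency chase rule is applicable. -/
def IDApplicable (I : Set (InclDep S)) (s : ChaseState S Dom) (τ : IDTrigger S Dom) : Prop :=
  τ.dep ∈ I ∧ s.Has τ.fact ∧
    ¬ ∃ u, s.Has ⟨τ.dep.tgt, u⟩ ∧ ∀ i, u (τ.dep.tgtPos i) = τ.tup (τ.dep.srcPos i)

end ChaseState

open Classical in
/-- Merge two constants: replace both by the first of them in the order of constants, where the
non-fresh constants precede the fresh ones; fail if they are distinct non-fresh constants. -/
noncomputable def combine [LinearOrder Dom] (a b : Const Dom) :
    Option (Const Dom → Const Dom) :=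
  if a = b then some id
  else if (∃ c d, a = Const.dom c ∧ b = Const.dom d) then none
  else some fun c => if c = a ∨ c = b then min a b else c

/-- The replacement of constants that makes two tuples equal, position by position; it fails if it
would have to identify distinct non-fresh constants. -/
noncomputable def unifier [LinearOrder Dom] {m : ℕ} (t u : Fin m → Const Dom) :
    Option (Const Dom → Const Dom) :=
  (List.finRange m).foldlM
    (fun σ i => (combine (σ (t i)) (σ (u i))).map fun ρ => ρ ∘ σ) id

namespace ChaseState

/-- Replace constants everywhere; a fact into which several facts collapse gets the lowest of their
levels. -/
noncomputable def replace (s : ChaseState S Dom) (σ : Const Dom → Const Dom) :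
    ChaseState S Dom where
  lev f := ⨅ g : {g : RelAtom S (Const Dom) // g.map σ = f}, s.lev g
  next := s.next

open Classical in
/-- Apply the inclusion dependency chase rule. -/
noncomputable def applyID (s : ChaseState S Dom) (τ : IDTrigger S Dom) : ChaseState S Dom where
  lev f := if f = τ.newFact s.next then s.lev τ.fact + 1 else s.lev f
  next := s.next + S.arity τ.dep.tgt

open Classical in
/-- One step of the chase; `none` is failure. -/
noncomputable def step [LinearOrder S.Pred] [LinearOrder Dom] (I : Set (InclDep S))
    (K : Set (KeyDep S)) (s : ChaseState S Dom) : Option (ChaseState S Dom) :=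
  if h : ∃ τ, KDTrigger.First s.lev (s.KDApplicable K) τ then
    (unifier h.choose.fst h.choose.snd).map s.replace
  else if h : ∃ τ, IDTrigger.First s.lev (s.IDApplicable I) τ then
    some (s.applyID h.choose)
  else some s

end ChaseState

/-- The states of the chase of `D` (`none` from the failure on). -/
noncomputable def chaseSeq [LinearOrder S.Pred] [LinearOrder Dom] (I : Set (InclDep S))
    (K : Set (KeyDep S)) (D : Finset (RelAtom S (Const Dom))) : ℕ → Option (ChaseState S Dom)
  | 0 => some (ChaseState.init D)
  | n + 1 => (chaseSeq I K D n).bind (ChaseState.step I K)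

/-- The chase of `D` exists: it does not fail. -/
def ChaseExists [LinearOrder S.Pred] [LinearOrder Dom] (I : Set (InclDep S))
    (K : Set (KeyDep S)) (D : Finset (RelAtom S (Const Dom))) : Prop :=
  ∀ n, chaseSeq I K D n ≠ none

/-- The part of the chase up to level `ℓ`: the facts that from some moment on are present at a fixed
level which is at most `ℓ`. -/
def chaseUpTo [LinearOrder S.Pred] [LinearOrder Dom] (I : Set (InclDep S))
    (K : Set (KeyDep S)) (D : Finset (RelAtom S (Const Dom))) (ℓ : ℕ) : Set (RelAtom S (Const Dom)) :=
  {f | ∃ k : ℕ, k ≤ ℓ ∧ ∀ᶠ n in Filter.atTop, ∃ s, chaseSeq I K D n = some s ∧ s.lev f = k}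

/-- The chase: the facts of all levels. -/
def chase [LinearOrder S.Pred] [LinearOrder Dom] (I : Set (InclDep S))
    (K : Set (KeyDep S)) (D : Finset (RelAtom S (Const Dom))) : Set (RelAtom S (Const Dom)) :=
  ⋃ ℓ, chaseUpTo I K D ℓ

/-! ### The chase with equality atoms -/

/-- A state of the chase with equality: the levels of the facts, the levels of the atoms
`eq(a, b)`, and the next unused fresh constant. -/
structure EqChaseState (S : RelSchema) (Dom : Type*) where
  lev : RelAtom S (Const Dom) → ℕ∞
  eqLev : Const Dom → Const Dom → ℕ∞
  next : ℕ

namespace EqChaseState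

/-- The level of an atom of the extended schema. -/
def atomLev (s : EqChaseState S Dom) : RelAtom S.withEq (Const Dom) → ℕ∞
  | ⟨some p, a⟩ => s.lev ⟨p, a⟩
  | ⟨none, a⟩ => s.eqLev (a (0 : Fin 2)) (a (1 : Fin 2))

open Classical in
/-- The initial state: the facts of `D` and the atoms `eq(c, c)` for the constants `c` of `D`, at
level `0`. -/
noncomputable def init (D : Finset (RelAtom S (Const Dom))) : EqChaseState S Dom where
  lev f := if f ∈ D then 0 else ⊤
  eqLev a b := if a = b ∧ ∃ f ∈ D, ∃ i, f.args i = a then 0 else ⊤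
  next := firstFresh D

/-- The fact `f` is present. -/
def Has (s : EqChaseState S Dom) (f : RelAtom S (Const Dom)) : Prop := s.lev f ≠ ⊤

/-- The atom `eq(a, b)` is present. -/
def HasEq (s : EqChaseState S Dom) (a b : Const Dom) : Prop := s.eqLev a b ≠ ⊤

/-- The key dependency rule is applicable: two facts are equal on the key with respect to `eq`, but
not yet on all positions. -/
def KDApplicable [LinearOrder S.Pred] [LinearOrder Dom] (K : Set (KeyDep S))
    (s : EqChaseState S Dom) (τ : KDTrigger S Dom) : Prop :=
  τ.dep ∈ K ∧ s.Has τ.fact₁ ∧ s.Has τ.fact₂ ∧ τ.fact₁.key < τ.fact₂.key ∧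
    (∀ i ∈ τ.dep.attrs, s.HasEq (τ.fst i) (τ.snd i)) ∧ ∃ i, ¬ s.HasEq (τ.fst i) (τ.snd i)

/-- The inclusion dependency rule is applicable. -/
def IDApplicable (I : Set (InclDep S)) (s : EqChaseState S Dom) (τ : IDTrigger S Dom) : Prop :=
  τ.dep ∈ I ∧ s.Has τ.fact ∧
    ¬ ∃ u, s.Has ⟨τ.dep.tgt, u⟩ ∧ ∀ i, s.HasEq (τ.tup (τ.dep.srcPos i)) (u (τ.dep.tgtPos i))

/-- The equalities after an application of the key dependency rule: the present ones together with
those between corresponding arguments of the two facts, closed under transitivity. -/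
def MergedEq (s : EqChaseState S Dom) (τ : KDTrigger S Dom) : Const Dom → Const Dom → Prop :=
  Relation.TransGen fun a b =>
    s.HasEq a b ∨ ∃ i, (a = τ.fst i ∧ b = τ.snd i) ∨ (a = τ.snd i ∧ b = τ.fst i)

open Classical in
/-- Apply the key dependency rule: the new `eq` atoms get the lower of the levels of the two
facts. -/
noncomputable def applyKD (s : EqChaseState S Dom) (τ : KDTrigger S Dom) :
    EqChaseState S Dom where
  lev := s.lev
  eqLev a b :=
    if s.HasEq a b then s.eqLev a b
    else if s.MergedEq τ a b then τ.level s.lev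
    else ⊤
  next := s.next

open Classical in
/-- Apply the inclusion dependency rule: the new fact and the atoms `eq(α, α)` for its new fresh
constants `α` get the level of the given fact plus `1`. -/
noncomputable def applyID (s : EqChaseState S Dom) (τ : IDTrigger S Dom) :
    EqChaseState S Dom where
  lev f := if f = τ.newFact s.next then s.lev τ.fact + 1 else s.lev f
  eqLev a b :=
    if a = b ∧ ∃ j ∉ Set.range τ.dep.tgtPos, a = Const.fresh (s.next + j) then s.lev τ.fact + 1
    else s.eqLev a b
  next := s.next + S.arity τ.dep.tgt

/-- An atom `eq(c₁, c₂)` with distinct non-fresh `c₁` and `c₂` is present. -/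
def Clash (s : EqChaseState S Dom) : Prop :=
  ∃ c₁ c₂ : Dom, c₁ ≠ c₂ ∧ s.HasEq (Const.dom c₁) (Const.dom c₂)

open Classical in
/-- One step of the chase with equality; `none` is failure. -/
noncomputable def step [LinearOrder S.Pred] [LinearOrder Dom] (I : Set (InclDep S))
    (K : Set (KeyDep S)) (s : EqChaseState S Dom) : Option (EqChaseState S Dom) :=
  if h : ∃ τ, KDTrigger.First s.lev (s.KDApplicable K) τ then
    if (s.applyKD h.choose).Clash then none else some (s.applyKD h.choose)
  else if h : ∃ τ, IDTrigger.First s.lev (s.IDApplicable I) τ then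
    some (s.applyID h.choose)
  else some s

end EqChaseState

/-- The states of the chase with equality of `D` (`none` from the failure on). -/
noncomputable def eqChaseSeq [LinearOrder S.Pred] [LinearOrder Dom] (I : Set (InclDep S))
    (K : Set (KeyDep S)) (D : Finset (RelAtom S (Const Dom))) : ℕ → Option (EqChaseState S Dom)
  | 0 => some (EqChaseState.init D)
  | n + 1 => (eqChaseSeq I K D n).bind (EqChaseState.step I K)

/-- The part of the chase with equality up to level `ℓ`: the atoms (facts and `eq` atoms) that from
some moment on are present at a fixed level which is at most `ℓ`. -/
def eqChaseUpTo [LinearOrder S.Pred] [LinearOrder Dom] (I : Set (InclDep S))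
    (K : Set (KeyDep S)) (D : Finset (RelAtom S (Const Dom))) (ℓ : ℕ) :
    Set (RelAtom S.withEq (Const Dom)) :=
  {f | ∃ k : ℕ, k ≤ ℓ ∧
    ∀ᶠ n in Filter.atTop, ∃ s, eqChaseSeq I K D n = some s ∧ s.atomLev f = k}

/-- The chase with equality: the atoms of all levels. -/
def eqChase [LinearOrder S.Pred] [LinearOrder Dom] (I : Set (InclDep S))
    (K : Set (KeyDep S)) (D : Finset (RelAtom S (Const Dom))) : Set (RelAtom S.withEq (Const Dom)) :=
  ⋃ ℓ, eqChaseUpTo I K D ℓ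

end Chase

/-!
Label every constant of a database by the component of the join graph in which it occurs. Each step
of the chase acts on constants with a single label, and new fresh constants inherit a label. So, if
the steps outside a set `T` of labels are erased, then the chase of `D` is step by step a copy of
the chase of the part of `D` with labels in `T`, up to an order-preserving renaming of constants,
and with the same levels: the order in which the chase handles violations depends on levels and on
the order of constants only.

An answer to a query with `b` body atoms involves at most `b` labels, hence a part of at most
`b * connSize D` facts. Up to order isomorphisms that respect the constants of the query, there are
finitely many such parts, and each has finitely many tuples of non-fresh constants as answers. This
gives a common bound for the levels of the answers in all states of the chase. Steps map the
present atoms without raising their levels, and the replaced constants decrease in a well-founded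
order, so that a homomorphism into a state survives to the limit.
-/

universe u

/-! ### Constants -/

namespace Const

variable {Dom : Type*}

theorem dom_injective : Function.Injective (dom : Dom → Const Dom) :=
  toLex.injective.comp Sum.inl_injective

theorem fresh_injective : Function.Injective (fresh : ℕ → Const Dom) :=
  toLex.injective.comp Sum.inr_injective

theorem dom_ne_fresh (d : Dom) (k : ℕ) : dom d ≠ fresh k :=
  fun h => Sum.inl_ne_inr (toLex.injective h)

theorem eq_dom_or_eq_fresh (c : Const Dom) : (∃ d, c = dom d) ∨ ∃ k, c = fresh k := by
  rcases h : ofLex c with d | k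
  · exact Or.inl ⟨d, ofLex.injective h⟩
  · exact Or.inr ⟨k, ofLex.injective h⟩

/-- If `c` is fresh, then its index is less than `m`. -/
def FreshBelow (m : ℕ) (c : Const Dom) : Prop := ∀ k, c = fresh k → k < m

theorem freshBelow_fresh {m k : ℕ} : (fresh k : Const Dom).FreshBelow m ↔ k < m :=
  ⟨fun h => h k rfl, fun h _ hj => fresh_injective hj ▸ h⟩

theorem FreshBelow.mono {m n : ℕ} {c : Const Dom} (h : c.FreshBelow m) (hmn : m ≤ n) :
    c.FreshBelow n :=
  fun k hk => (h k hk).trans_le hmn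

theorem FreshBelow.ne_fresh {m : ℕ} {c : Const Dom} (h : c.FreshBelow m) (j : ℕ) :
    c ≠ fresh (m + j) :=
  fun hc => absurd (h _ hc) (by omega)

variable [LinearOrder Dom]

theorem dom_lt_fresh (d : Dom) (k : ℕ) : dom d < fresh k := Sum.Lex.inl_lt_inr d k

theorem fresh_lt_fresh {j k : ℕ} : (fresh j : Const Dom) < fresh k ↔ j < k :=
  Sum.Lex.inr_lt_inr_iff

theorem FreshBelow.lt_fresh {m : ℕ} {c : Const Dom} (h : c.FreshBelow m) (j : ℕ) :
    c < fresh (m + j) := by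
  rcases c.eq_dom_or_eq_fresh with ⟨d, rfl⟩ | ⟨k, rfl⟩
  · exact dom_lt_fresh d _
  · exact fresh_lt_fresh.2 (Nat.lt_add_right j (freshBelow_fresh.1 h))

end Const

/-! ### Sets of atoms -/

namespace RelAtom

variable {S : RelSchema} {K L : Type*}

theorem map_congr {σ τ : K → L} {f : RelAtom S K} (h : ∀ i, σ (f.args i) = τ (f.args i)) :
    f.map σ = f.map τ := by
  simp only [map, h]

theorem key_injective : Function.Injective (key : RelAtom S K → S.Pred ×ₗ List K) := by
  rintro ⟨p, a⟩ ⟨p', b⟩ h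
  obtain ⟨rfl, hab⟩ := Prod.mk.inj (toLex.injective h)
  exact congrArg (mk p) (List.ofFn_injective hab)

end RelAtom

section AtomSets

variable {S : RelSchema} {K L : Type*}

/-- The atoms all of whose arguments lie in `P`. -/
def atomsOver (P : Set K) : Set (RelAtom S K) := {f | ∀ i, f.args i ∈ P}

/-- The arguments of the atoms in `F`. -/
def constsOf (F : Set (RelAtom S K)) : Set K := {c | ∃ f ∈ F, ∃ i, f.args i = c}

/-- The labelling `lam` is constant on the arguments of each atom in `F`. -/
def Labelled {Λ : Type*} (F : Set (RelAtom S K)) (lam : K → Λ) : Prop :=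
  ∀ f ∈ F, ∀ i j, lam (f.args i) = lam (f.args j)

theorem atomsOver_mono {P P' : Set K} (h : P ⊆ P') :
    (atomsOver P : Set (RelAtom S K)) ⊆ atomsOver P' :=
  fun _ hf i => h (hf i)

theorem map_mem_atomsOver {σ : K → L} {W : Set K} {P : Set L} (h : Set.MapsTo σ W P)
    {f : RelAtom S K} (hf : f ∈ atomsOver W) : f.map σ ∈ atomsOver P :=
  fun i => h (hf i)

theorem map_injOn_atomsOver {σ : K → L} {W : Set K} (h : Set.InjOn σ W) :
    Set.InjOn (RelAtom.map σ : RelAtom S K → RelAtom S L) (atomsOver W) := by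
  rintro ⟨p, a⟩ ha ⟨p', b⟩ hb hab
  obtain ⟨rfl, hab⟩ := RelAtom.mk.inj hab
  congr 1
  exact funext fun i => h (ha i) (hb i) (congrFun (eq_of_heq hab) i)

theorem exists_map_eq_of_mem_atomsOver {σ : K → L} {W : Set K} {f : RelAtom S L}
    (hf : f ∈ atomsOver (σ '' W)) : ∃ g ∈ atomsOver W, g.map σ = f := by
  choose a ha haf using hf
  exact ⟨⟨f.pred, a⟩, ha, congrArg (RelAtom.mk f.pred) (funext haf)⟩

theorem args_mem_constsOf {F : Set (RelAtom S K)} {f : RelAtom S K} (hf : f ∈ F)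
    (i : Fin (S.arity f.pred)) : f.args i ∈ constsOf F :=
  ⟨f, hf, i, rfl⟩

theorem constsOf_subset_iff {F : Set (RelAtom S K)} {P : Set K} :
    constsOf F ⊆ P ↔ F ⊆ atomsOver P :=
  ⟨fun h _ hf i => h (args_mem_constsOf hf i), fun h _ ⟨_, hf, i, hi⟩ => hi ▸ h hf i⟩

theorem constsOf_image_map (σ : K → L) (F : Set (RelAtom S K)) :
    constsOf (RelAtom.map σ '' F) = σ '' constsOf F := by
  ext c
  constructor
  · rintro ⟨_, ⟨f, hf, rfl⟩, i, rfl⟩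
    exact ⟨_, args_mem_constsOf hf i, rfl⟩
  · rintro ⟨_, ⟨f, hf, i, rfl⟩, rfl⟩
    exact args_mem_constsOf (Set.mem_image_of_mem (RelAtom.map σ) hf) i

theorem finite_constsOf {F : Set (RelAtom S K)} (hF : F.Finite) : (constsOf F).Finite := by
  have : constsOf F = ⋃ f ∈ F, Set.range f.args := by ext; simp [constsOf]
  rw [this]
  exact hF.biUnion fun f _ => Set.finite_range f.args

end AtomSets

theorem map_lt_map_iff_of_strictMonoOn {α β : Type*} [LinearOrder α] [LinearOrder β] {ρ : α → β}
    {W : Set α} (h : StrictMonoOn ρ W) :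
    ∀ l l' : List α, (∀ x ∈ l, x ∈ W) → (∀ x ∈ l', x ∈ W) → (l.map ρ < l'.map ρ ↔ l < l')
  | [], [], _, _ => by simp
  | [], _ :: _, _, _ => by simp
  | _ :: _, [], _, _ => by simp
  | a :: l, b :: l', hl, hl' => by
    rw [List.forall_mem_cons] at hl hl'
    rw [List.map_cons, List.map_cons, List.cons_lt_cons_iff, List.cons_lt_cons_iff,
      h.lt_iff_lt hl.1 hl'.1, h.injOn.eq_iff hl.1 hl'.1,
      map_lt_map_iff_of_strictMonoOn h l l' hl.2 hl'.2]

section KeyOrder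

variable {S : RelSchema} {K L : Type*} {W : Set K} {ρ : K → L} {f g : RelAtom S K}

theorem key_map_eq_iff (h : Set.InjOn ρ W) (hf : f ∈ atomsOver W) (hg : g ∈ atomsOver W) :
    (f.map ρ).key = (g.map ρ).key ↔ f.key = g.key := by
  rw [RelAtom.key_injective.eq_iff, RelAtom.key_injective.eq_iff,
    (map_injOn_atomsOver h).eq_iff hf hg]

theorem key_map_lt_iff [LinearOrder S.Pred] [LinearOrder K] [LinearOrder L]
    (h : StrictMonoOn ρ W) (hf : f ∈ atomsOver W) (hg : g ∈ atomsOver W) :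
    (f.map ρ).key < (g.map ρ).key ↔ f.key < g.key := by
  have key_map (f : RelAtom S K) : (f.map ρ).key = toLex (f.pred, (List.ofFn f.args).map ρ) := by
    rw [List.map_ofFn]; rfl
  rw [key_map, key_map, RelAtom.key, RelAtom.key, Prod.Lex.toLex_lt_toLex,
    Prod.Lex.toLex_lt_toLex, map_lt_map_iff_of_strictMonoOn h]
  · exact (List.forall_mem_ofFn_iff (P := (· ∈ W))).2 hf
  · exact (List.forall_mem_ofFn_iff (P := (· ∈ W))).2 hg

end KeyOrder

/-! ### Triggers -/

theorem KeyDep.key_injective {S : RelSchema} :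
    Function.Injective (KeyDep.key : KeyDep S → S.Pred ×ₗ List ℕ) := by
  rintro ⟨p, a⟩ ⟨p', b⟩ h
  obtain ⟨rfl, hab⟩ := Prod.mk.inj (toLex.injective h)
  congr 1
  ext i
  simpa using congrArg (i ∈ ·) (List.map_injective_iff.2 Fin.val_injective hab)

theorem InclDep.key_injective {S : RelSchema} :
    Function.Injective (InclDep.key : InclDep S → S.Pred ×ₗ S.Pred ×ₗ List ℕ ×ₗ List ℕ) := by
  rintro ⟨p, q, w, a, b⟩ ⟨p', q', w', a', b'⟩ h
  simp only [InclDep.key, EmbeddingLike.apply_eq_iff_eq, Prod.mk.injEq] at h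
  obtain ⟨rfl, rfl, ha, hb⟩ := h
  obtain rfl : w = w' := by simpa using congrArg List.length ha
  congr 1
  · exact funext fun i => Fin.ext (congrFun (List.ofFn_injective ha) i)
  · exact funext fun i => Fin.ext (congrFun (List.ofFn_injective hb) i)

instance {S : RelSchema} [Finite S.Pred] : Finite (KeyDep S) :=
  Finite.of_injective
    (fun κ : KeyDep S => (⟨κ.rel, κ.attrs⟩ : (p : S.Pred) × Finset (Fin (S.arity p))))
    fun ⟨_, _⟩ ⟨_, _⟩ h => by simpa using h

namespace KDTrigger

variable {S : RelSchema} {Dom : Type*}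

/-- Apply a map of constants to both tuples. -/
def map (ρ : Const Dom → Const Dom) (τ : KDTrigger S Dom) : KDTrigger S Dom :=
  ⟨τ.dep, ρ ∘ τ.fst, ρ ∘ τ.snd⟩

theorem ext_facts {τ τ' : KDTrigger S Dom} (h₁ : τ.fact₁ = τ'.fact₁) (h₂ : τ.fact₂ = τ'.fact₂)
    (h : τ.dep = τ'.dep) : τ = τ' := by
  obtain ⟨d, a, b⟩ := τ
  obtain ⟨d', a', b'⟩ := τ'
  obtain rfl : d = d' := h
  simp only [fact₁, fact₂, RelAtom.mk.injEq, heq_eq_eq, true_and] at h₁ h₂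
  rw [h₁, h₂]

theorem exists_map_eq {ρ : Const Dom → Const Dom} {W : Set (Const Dom)} {τ : KDTrigger S Dom}
    (h₁ : τ.fact₁ ∈ atomsOver (ρ '' W)) (h₂ : τ.fact₂ ∈ atomsOver (ρ '' W)) :
    ∃ τ' : KDTrigger S Dom, τ'.fact₁ ∈ atomsOver W ∧ τ'.fact₂ ∈ atomsOver W ∧ τ'.map ρ = τ := by
  choose a ha haτ using h₁
  choose b hb hbτ using h₂
  exact ⟨⟨τ.dep, a, b⟩, ha, hb, congrArg₂ (KDTrigger.mk τ.dep) (funext haτ) (funext hbτ)⟩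

variable [LinearOrder S.Pred] [LinearOrder Dom] {lev lev' : RelAtom S (Const Dom) → ℕ∞}
  {A A' : KDTrigger S Dom → Prop}

theorem First.unique {τ τ' : KDTrigger S Dom} (h : First lev A τ) (h' : First lev A τ') :
    τ = τ' := by
  have e := le_antisymm (h.2 τ' h'.1) (h'.2 τ h.1)
  simp only [rank, EmbeddingLike.apply_eq_iff_eq, Prod.mk.injEq] at e
  exact ext_facts (RelAtom.key_injective e.2.1) (RelAtom.key_injective e.2.2.1)
    (KeyDep.key_injective e.2.2.2)

theorem exists_first [Finite S.Pred] {F : Set (RelAtom S (Const Dom))} (hF : F.Finite)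
    (hA : ∀ τ, A τ → τ.fact₁ ∈ F ∧ τ.fact₂ ∈ F) {τ : KDTrigger S Dom} (hτ : A τ) :
    ∃ τ, First lev A τ := by
  have hfin : {τ | A τ}.Finite := by
    refine Set.Finite.of_injOn (f := fun τ : KDTrigger S Dom => (τ.fact₁, τ.fact₂, τ.dep))
      (t := F ×ˢ F ×ˢ Set.univ) (fun τ h => ⟨(hA τ h).1, (hA τ h).2, trivial⟩) ?_
      (hF.prod (hF.prod Set.finite_univ))
    intro τ _ τ' _ h
    simp only [Prod.mk.injEq] at h
    exact ext_facts h.1 h.2.1 h.2.2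
  obtain ⟨τ₀, h₀, hmin⟩ := Set.exists_min_image _ (fun τ => τ.rank lev) hfin ⟨τ, hτ⟩
  exact ⟨τ₀, h₀, hmin⟩

variable {W : Set (Const Dom)} {ρ : Const Dom → Const Dom}

theorem rank_map_le_rank_map_iff (h : StrictMonoOn ρ W)
    (hlev : ∀ f ∈ atomsOver W, lev (f.map ρ) = lev' f) {τ τ' : KDTrigger S Dom}
    (h₁ : τ.fact₁ ∈ atomsOver W) (h₂ : τ.fact₂ ∈ atomsOver W)
    (h₁' : τ'.fact₁ ∈ atomsOver W) (h₂' : τ'.fact₂ ∈ atomsOver W) :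
    (τ.map ρ).rank lev ≤ (τ'.map ρ).rank lev ↔ τ.rank lev' ≤ τ'.rank lev' := by
  have level_map {τ : KDTrigger S Dom} (h₁ : τ.fact₁ ∈ atomsOver W)
      (h₂ : τ.fact₂ ∈ atomsOver W) : (τ.map ρ).level lev = τ.level lev' := by
    rw [level, level, ← hlev _ h₁, ← hlev _ h₂]; rfl
  have fact₁_map (τ : KDTrigger S Dom) : (τ.map ρ).fact₁ = τ.fact₁.map ρ := rfl
  have fact₂_map (τ : KDTrigger S Dom) : (τ.map ρ).fact₂ = τ.fact₂.map ρ := rfl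
  have dep_map (τ : KDTrigger S Dom) : (τ.map ρ).dep = τ.dep := rfl
  simp only [rank, Prod.Lex.toLex_le_toLex]
  rw [level_map h₁ h₂, level_map h₁' h₂', fact₁_map, fact₁_map, fact₂_map, fact₂_map, dep_map,
    dep_map, key_map_lt_iff h h₁ h₁', key_map_lt_iff h h₂ h₂', key_map_eq_iff h.injOn h₁ h₁',
    key_map_eq_iff h.injOn h₂ h₂']

theorem First.of_map (h : StrictMonoOn ρ W) (hlev : ∀ f ∈ atomsOver W, lev (f.map ρ) = lev' f)
    (hA : ∀ τ : KDTrigger S Dom, τ.fact₁ ∈ atomsOver W → τ.fact₂ ∈ atomsOver W →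
      (A (τ.map ρ) ↔ A' τ))
    (hW : ∀ τ, A' τ → τ.fact₁ ∈ atomsOver W ∧ τ.fact₂ ∈ atomsOver W) {τ : KDTrigger S Dom}
    (h₁ : τ.fact₁ ∈ atomsOver W) (h₂ : τ.fact₂ ∈ atomsOver W) (hτ : First lev A (τ.map ρ)) :
    First lev' A' τ := by
  refine ⟨(hA τ h₁ h₂).1 hτ.1, fun τ' h' => ?_⟩
  obtain ⟨h₁', h₂'⟩ := hW τ' h'
  exact (rank_map_le_rank_map_iff h hlev h₁ h₂ h₁' h₂').1 (hτ.2 _ ((hA τ' h₁' h₂').2 h'))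

end KDTrigger

namespace IDTrigger

variable {S : RelSchema} {Dom : Type*}

/-- Apply a map of constants to the tuple. -/
def map (ρ : Const Dom → Const Dom) (τ : IDTrigger S Dom) : IDTrigger S Dom :=
  ⟨τ.dep, ρ ∘ τ.tup⟩

theorem exists_map_eq {ρ : Const Dom → Const Dom} {W : Set (Const Dom)} {τ : IDTrigger S Dom}
    (h : τ.fact ∈ atomsOver (ρ '' W)) :
    ∃ τ' : IDTrigger S Dom, τ'.fact ∈ atomsOver W ∧ τ'.map ρ = τ := by
  choose a ha haτ using h
  exact ⟨⟨τ.dep, a⟩, ha, congrArg (IDTrigger.mk τ.dep) (funext haτ)⟩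

variable [LinearOrder S.Pred] [LinearOrder Dom] {lev lev' : RelAtom S (Const Dom) → ℕ∞}
  {A A' : IDTrigger S Dom → Prop}

theorem First.unique {τ τ' : IDTrigger S Dom} (h : First lev A τ) (h' : First lev A τ') :
    τ = τ' := by
  have e := le_antisymm (h.2 τ' h'.1) (h'.2 τ h.1)
  simp only [rank, EmbeddingLike.apply_eq_iff_eq, Prod.mk.injEq] at e
  obtain ⟨d, a⟩ := τ
  obtain ⟨d', a'⟩ := τ'
  obtain rfl : d = d' := InclDep.key_injective e.2.2.2
  have e' := RelAtom.key_injective e.2.2.1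
  simp only [fact, RelAtom.mk.injEq, heq_eq_eq, true_and] at e'
  rw [e']

variable {W : Set (Const Dom)} {ρ : Const Dom → Const Dom}

theorem rank_map_le_rank_map_iff (h : StrictMonoOn ρ W)
    (hlev : ∀ f ∈ atomsOver W, lev (f.map ρ) = lev' f) {τ τ' : IDTrigger S Dom}
    (hτ : τ.fact ∈ atomsOver W) (hτ' : τ'.fact ∈ atomsOver W) :
    (τ.map ρ).rank lev ≤ (τ'.map ρ).rank lev ↔ τ.rank lev' ≤ τ'.rank lev' := by
  have fact_map (τ : IDTrigger S Dom) : (τ.map ρ).fact = τ.fact.map ρ := rfl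
  have dep_map (τ : IDTrigger S Dom) : (τ.map ρ).dep = τ.dep := rfl
  simp only [rank, Prod.Lex.toLex_le_toLex]
  rw [fact_map, fact_map, dep_map, dep_map, hlev _ hτ, hlev _ hτ', key_map_lt_iff h hτ hτ',
    key_map_eq_iff h.injOn hτ hτ']

theorem First.of_map (h : StrictMonoOn ρ W) (hlev : ∀ f ∈ atomsOver W, lev (f.map ρ) = lev' f)
    (hA : ∀ τ : IDTrigger S Dom, τ.fact ∈ atomsOver W → (A (τ.map ρ) ↔ A' τ))
    (hW : ∀ τ, A' τ → τ.fact ∈ atomsOver W) {τ : IDTrigger S Dom} (hτW : τ.fact ∈ atomsOver W)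
    (hτ : First lev A (τ.map ρ)) : First lev' A' τ :=
  ⟨(hA τ hτW).1 hτ.1, fun τ' h' => (rank_map_le_rank_map_iff h hlev hτW (hW τ' h')).1
    (hτ.2 _ ((hA τ' (hW τ' h')).2 h'))⟩

end IDTrigger

/-! ### Merging constants -/

section Merging

variable {Dom : Type*} [LinearOrder Dom]

/-- `ρ` embeds the constants in `W`: it preserves their order and the distinction between fresh and
non-fresh constants, and neither moves the constants in `Q` nor takes them as new values. -/
structure ConstEmb (Q : Set Dom) (W : Set (Const Dom)) (ρ : Const Dom → Const Dom) : Prop where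
  strictMonoOn : StrictMonoOn ρ W
  isDom_iff : ∀ c ∈ W, (∃ d, ρ c = Const.dom d) ↔ ∃ d, c = Const.dom d
  eq_dom_iff : ∀ d ∈ Q, ∀ c ∈ W, ρ c = Const.dom d ↔ c = Const.dom d

/-- A replacement of constants that respects the order of merging: constants decrease, and non-fresh
constants are fixed. -/
structure IsMerge (σ : Const Dom → Const Dom) : Prop where
  map_dom : ∀ d, σ (Const.dom d) = Const.dom d
  map_le : ∀ c, σ c ≤ c

theorem IsMerge.id : IsMerge (id : Const Dom → Const Dom) := ⟨fun _ => rfl, fun _ => le_rfl⟩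

theorem IsMerge.comp {σ τ : Const Dom → Const Dom} (hτ : IsMerge τ) (hσ : IsMerge σ) :
    IsMerge (τ ∘ σ) where
  map_dom d := (congrArg τ (hσ.map_dom d)).trans (hτ.map_dom d)
  map_le c := (hτ.map_le _).trans (hσ.map_le c)

theorem foldlM_option_rel {α β γ : Type*} {R : β → γ → Prop} {f : β → α → Option β}
    {g : γ → α → Option γ}
    (h : ∀ b c a b', R b c → f b a = some b' → ∃ c', g c a = some c' ∧ R b' c') :
    ∀ (l : List α) {b : β} {c : γ} {b' : β}, R b c → l.foldlM f b = some b' →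
      ∃ c', l.foldlM g c = some c' ∧ R b' c'
  | [], b, c, b', hbc, hb => by
    obtain rfl : b = b' := by simpa using hb
    exact ⟨c, rfl, hbc⟩
  | a :: l, b, c, b', hbc, hb => by
    rw [List.foldlM_cons, Option.bind_eq_bind, Option.bind_eq_some_iff] at hb
    obtain ⟨b₁, hb₁, hb⟩ := hb
    obtain ⟨c₁, hc₁, h₁⟩ := h b c a b₁ hbc hb₁
    obtain ⟨c', hc', h'⟩ := foldlM_option_rel h l h₁ hb
    exact ⟨c', by rw [List.foldlM_cons, hc₁, Option.bind_eq_bind, Option.bind_some, hc'], h'⟩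

theorem combine_eq_some {a b : Const Dom} {σ : Const Dom → Const Dom}
    (h : combine a b = some σ) :
    (a = b ∧ σ = id) ∨ (a ≠ b ∧ (¬ ∃ c d, a = Const.dom c ∧ b = Const.dom d) ∧
      ∀ c, (c = a ∨ c = b) ∧ σ c = a ⊓ b ∨ (c ≠ a ∧ c ≠ b) ∧ σ c = c) := by
  unfold combine at h
  split_ifs at h with hab hdom
  · exact Or.inl ⟨hab, (Option.some.inj h).symm⟩
  · refine Or.inr ⟨hab, hdom, fun c => ?_⟩
    rw [← Option.some.inj h]
    by_cases hc : c = a ∨ c = b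
    · exact Or.inl ⟨hc, if_pos hc⟩
    · exact Or.inr ⟨not_or.1 hc, if_neg hc⟩

theorem isMerge_of_combine {a b : Const Dom} {σ : Const Dom → Const Dom}
    (h : combine a b = some σ) : IsMerge σ := by
  rcases combine_eq_some h with ⟨-, rfl⟩ | ⟨-, hdom, hσ⟩
  · exact IsMerge.id
  refine ⟨fun d => ?_, fun c => ?_⟩
  · rcases hσ (Const.dom d) with ⟨rfl | rfl, h₂⟩ | ⟨-, h₂⟩
    · rcases b.eq_dom_or_eq_fresh with ⟨e, rfl⟩ | ⟨k, rfl⟩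
      · exact absurd ⟨d, e, rfl, rfl⟩ hdom
      · exact h₂.trans (inf_of_le_left (Const.dom_lt_fresh d k).le)
    · rcases a.eq_dom_or_eq_fresh with ⟨e, rfl⟩ | ⟨k, rfl⟩
      · exact absurd ⟨e, d, rfl, rfl⟩ hdom
      · exact h₂.trans (inf_of_le_right (Const.dom_lt_fresh d k).le)
    · exact h₂
  · rcases hσ c with ⟨rfl | rfl, h₂⟩ | ⟨-, h₂⟩
    · exact h₂.trans_le inf_le_left
    · exact h₂.trans_le inf_le_right
    · exact h₂.le

theorem combine_eq_or_mem {a b : Const Dom} {σ : Const Dom → Const Dom}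
    (h : combine a b = some σ) {A : Set (Const Dom)} (ha : a ∈ A) (hb : b ∈ A) (c : Const Dom) :
    σ c = c ∨ c ∈ A ∧ σ c ∈ A := by
  rcases combine_eq_some h with ⟨-, rfl⟩ | ⟨-, -, hσ⟩
  · exact Or.inl rfl
  rcases hσ c with ⟨hc, h₂⟩ | ⟨-, h₂⟩
  · refine Or.inr ⟨by rcases hc with rfl | rfl <;> assumption, ?_⟩
    rcases le_total a b with hle | hle
    · rwa [h₂, inf_of_le_left hle]
    · rwa [h₂, inf_of_le_right hle]
  · exact Or.inl h₂

theorem combine_of_map {Q : Set Dom} {W : Set (Const Dom)} {ρ : Const Dom → Const Dom}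
    (h : ConstEmb Q W ρ) {a b : Const Dom} (ha : a ∈ W) (hb : b ∈ W) {σ : Const Dom → Const Dom}
    (hσ : combine (ρ a) (ρ b) = some σ) :
    ∃ σ', combine a b = some σ' ∧ ∀ c ∈ W, σ' c ∈ W ∧ σ (ρ c) = ρ (σ' c) := by
  have inj := h.strictMonoOn.injOn
  rcases combine_eq_some hσ with ⟨hab, rfl⟩ | ⟨hab, hdom, hc⟩
  · exact ⟨id, by rw [combine, if_pos (inj ha hb hab)], fun c hc => ⟨hc, rfl⟩⟩
  have hdom' : ¬ ∃ c d, a = Const.dom c ∧ b = Const.dom d := by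
    rintro ⟨c, d, hac, hbd⟩
    obtain ⟨c', hc'⟩ := (h.isDom_iff a ha).2 ⟨c, hac⟩
    obtain ⟨d', hd'⟩ := (h.isDom_iff b hb).2 ⟨d, hbd⟩
    exact hdom ⟨c', d', hc', hd'⟩
  have hmin : a ⊓ b ∈ W ∧ ρ a ⊓ ρ b = ρ (a ⊓ b) := by
    rcases le_total a b with hle | hle
    · rw [inf_of_le_left hle, inf_of_le_left ((h.strictMonoOn.le_iff_le ha hb).2 hle)]
      exact ⟨ha, rfl⟩
    · rw [inf_of_le_right hle, inf_of_le_right ((h.strictMonoOn.le_iff_le hb ha).2 hle)]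
      exact ⟨hb, rfl⟩
  have hne : a ≠ b := fun e => hab (congrArg ρ e)
  refine ⟨_, by rw [combine, if_neg hne, if_neg hdom'], fun c hcW => ?_⟩
  rcases hc (ρ c) with ⟨hcab, hσc⟩ | ⟨hcab, hσc⟩
  · rw [inj.eq_iff hcW ha, inj.eq_iff hcW hb] at hcab
    rw [if_pos hcab, hσc]
    exact hmin
  · rw [Ne, inj.eq_iff hcW ha, Ne, inj.eq_iff hcW hb, ← not_or] at hcab
    rw [if_neg hcab, hσc]
    exact ⟨hcW, rfl⟩

variable {m : ℕ} {t u : Fin m → Const Dom} {σ : Const Dom → Const Dom}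

theorem unifier_induction {M : (Const Dom → Const Dom) → Prop} (hid : M id)
    (hstep : ∀ σ i τ, M σ → combine (σ (t i)) (σ (u i)) = some τ → M (τ ∘ σ))
    (h : unifier t u = some σ) : M σ := by
  obtain ⟨-, -, hσ⟩ := foldlM_option_rel (R := fun σ (_ : Unit) => M σ) (g := fun _ _ => some ())
    (fun σ _ i σ' hσ hσ' => by
      obtain ⟨τ, hτ, rfl⟩ := Option.map_eq_some_iff.1 hσ'
      exact ⟨(), rfl, hstep σ i τ hσ hτ⟩) _ hid (c := ()) h
  exact hσ

theorem isMerge_of_unifier (h : unifier t u = some σ) : IsMerge σ :=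
  unifier_induction IsMerge.id (fun _ _ _ hσ hτ => (isMerge_of_combine hτ).comp hσ) h

theorem unifier_eq_or_mem (h : unifier t u = some σ) {A : Set (Const Dom)} (ht : ∀ i, t i ∈ A)
    (hu : ∀ i, u i ∈ A) (c : Const Dom) : σ c = c ∨ c ∈ A ∧ σ c ∈ A := by
  refine unifier_induction (M := fun σ => ∀ c, σ c = c ∨ c ∈ A ∧ σ c ∈ A) (fun _ => Or.inl rfl)
    (fun σ i τ hσ hτ c => ?_) h c
  have hA {c} (hc : c ∈ A) : σ c ∈ A := (hσ c).elim (fun h => h.symm ▸ hc) And.right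
  rcases combine_eq_or_mem hτ (hA (ht i)) (hA (hu i)) (σ c) with h₁ | h₁
  · exact (hσ c).imp h₁.trans fun h₂ => ⟨h₂.1, Set.mem_of_eq_of_mem h₁ h₂.2⟩
  · exact Or.inr ⟨(hσ c).elim (fun h => h ▸ h₁.1) And.left, h₁.2⟩

theorem unifier_comp_label {Λ : Type*} {lam : Const Dom → Λ} {ℓ : Λ} (h : unifier t u = some σ)
    (ht : ∀ i, lam (t i) = ℓ) (hu : ∀ i, lam (u i) = ℓ) (c : Const Dom) : lam (σ c) = lam c := by
  rcases unifier_eq_or_mem h (A := lam ⁻¹' {ℓ}) ht hu c with hc | ⟨hc, hσc⟩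
  · rw [hc]
  · exact (show lam (σ c) = ℓ from hσc).trans (show lam c = ℓ from hc).symm

theorem unifier_of_map {Q : Set Dom} {W : Set (Const Dom)} {ρ : Const Dom → Const Dom}
    (h : ConstEmb Q W ρ) (ht : ∀ i, t i ∈ W) (hu : ∀ i, u i ∈ W)
    (hσ : unifier (ρ ∘ t) (ρ ∘ u) = some σ) :
    ∃ σ', unifier t u = some σ' ∧ ∀ c ∈ W, σ' c ∈ W ∧ σ (ρ c) = ρ (σ' c) := by
  refine foldlM_option_rel
    (R := fun σ σ' : Const Dom → Const Dom => ∀ c ∈ W, σ' c ∈ W ∧ σ (ρ c) = ρ (σ' c))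
    (fun σ σ' i _ hR hσ₁ => ?_) _ (fun c hc => ⟨hc, rfl⟩) hσ
  obtain ⟨τ, hτ, rfl⟩ := Option.map_eq_some_iff.1 hσ₁
  simp only [Function.comp_apply, (hR _ (ht i)).2, (hR _ (hu i)).2] at hτ
  obtain ⟨τ', hτ', hττ'⟩ := combine_of_map h (hR _ (ht i)).1 (hR _ (hu i)).1 hτ
  refine ⟨τ' ∘ σ', by rw [hτ', Option.map_some], fun c hc => ?_⟩
  obtain ⟨hcW, hc⟩ := hR c hc
  refine ⟨(hττ' _ hcW).1, ?_⟩
  rw [Function.comp_apply, Function.comp_apply, hc, (hττ' _ hcW).2]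

end Merging

/-! ### New fresh constants -/

section FreshConstants

variable {Dom : Type*}

/-- The `a` fresh constants from index `m` on. -/
def freshFrom (m a : ℕ) : Set (Const Dom) := {c | ∃ j < a, c = Const.fresh (m + j)}

/-- Extend a map of constants to the fresh constants from index `m'` on, which are sent to those
from index `m` on. -/
def extendFresh (ρ : Const Dom → Const Dom) (m' m : ℕ) (c : Const Dom) : Const Dom :=
  Sum.elim (fun d => ρ (Const.dom d))
    (fun k => if k < m' then ρ (Const.fresh k) else Const.fresh (m + (k - m'))) (ofLex c)

open Classical in
/-- Give the label `ℓ` to the fresh constants from index `m` on. -/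
noncomputable def withLabel {Λ : Type*} (lam : Const Dom → Λ) (m : ℕ) (ℓ : Λ) (c : Const Dom) : Λ :=
  if c.FreshBelow m then lam c else ℓ

theorem freshBelow_of_mem_freshFrom {m a : ℕ} {c : Const Dom} (h : c ∈ freshFrom m a) :
    c.FreshBelow (m + a) := by
  obtain ⟨j, hj, rfl⟩ := h
  exact Const.freshBelow_fresh.2 (Nat.add_lt_add_left hj m)

theorem not_freshBelow_of_mem_freshFrom {m a : ℕ} {c : Const Dom} (h : c ∈ freshFrom m a) :
    ¬ c.FreshBelow m := by
  obtain ⟨j, -, rfl⟩ := h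
  exact fun hc => hc.ne_fresh j rfl

theorem extendFresh_add (ρ : Const Dom → Const Dom) (m' m j : ℕ) :
    extendFresh ρ m' m (Const.fresh (m' + j)) = Const.fresh (m + j) := by
  simp [extendFresh, Const.fresh]

theorem extendFresh_of_freshBelow {ρ : Const Dom → Const Dom} {m' m : ℕ} {c : Const Dom}
    (h : c.FreshBelow m') : extendFresh ρ m' m c = ρ c := by
  rcases c.eq_dom_or_eq_fresh with ⟨d, rfl⟩ | ⟨k, rfl⟩
  · rfl
  · exact if_pos (Const.freshBelow_fresh.1 h)

theorem withLabel_of_freshBelow {Λ : Type*} {lam : Const Dom → Λ} {m : ℕ} {ℓ : Λ} {c : Const Dom}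
    (h : c.FreshBelow m) : withLabel lam m ℓ c = lam c := if_pos h

theorem withLabel_of_mem_freshFrom {Λ : Type*} {lam : Const Dom → Λ} {m a : ℕ} {ℓ : Λ}
    {c : Const Dom} (h : c ∈ freshFrom m a) : withLabel lam m ℓ c = ℓ :=
  if_neg (not_freshBelow_of_mem_freshFrom h)

theorem InclDep.newTuple_comp_extendFresh {S : RelSchema} (σ : InclDep S)
    {ρ : Const Dom → Const Dom} {t : Fin (S.arity σ.src) → Const Dom} {m m' : ℕ}
    (h : ∀ i, (t i).FreshBelow m') :
    extendFresh ρ m' m ∘ σ.newTuple t m' = σ.newTuple (ρ ∘ t) m := by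
  funext j
  simp only [newTuple, Function.comp]
  split_ifs with hj
  · exact extendFresh_of_freshBelow (h _)
  · exact extendFresh_add ρ m' m j

theorem InclDep.newTuple_tgtPos {S : RelSchema} (σ : InclDep S) (hσ : Function.Injective σ.tgtPos)
    (t : Fin (S.arity σ.src) → Const Dom) (m : ℕ) (i : Fin σ.width) :
    σ.newTuple t m (σ.tgtPos i) = t (σ.srcPos i) := by
  have h : ∃ i', σ.tgtPos i' = σ.tgtPos i := ⟨i, rfl⟩
  rw [newTuple, dif_pos h, hσ h.choose_spec]

theorem InclDep.newTuple_cases {S : RelSchema} (σ : InclDep S)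
    (t : Fin (S.arity σ.src) → Const Dom) (m : ℕ) (j : Fin (S.arity σ.tgt)) :
    (∃ i, σ.newTuple t m j = t i) ∨
      (j ∉ Set.range σ.tgtPos ∧ σ.newTuple t m j = Const.fresh (m + j)) := by
  by_cases h : ∃ i, σ.tgtPos i = j
  · exact Or.inl ⟨σ.srcPos h.choose, dif_pos h⟩
  · exact Or.inr ⟨h, dif_neg h⟩

variable {S : RelSchema} {τ : IDTrigger S Dom} {m : ℕ}

theorem IDTrigger.newFact_mem_atomsOver {W : Set (Const Dom)} (h : τ.fact ∈ atomsOver W) :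
    τ.newFact m ∈ atomsOver (W ∪ freshFrom m (S.arity τ.dep.tgt)) := by
  intro j
  rcases τ.dep.newTuple_cases τ.tup m j with ⟨i, hi⟩ | ⟨-, hj⟩
  · exact Or.inl (Set.mem_of_eq_of_mem hi (h i))
  · exact Or.inr ⟨j, j.isLt, hj⟩

theorem IDTrigger.newFact_map {ρ : Const Dom → Const Dom} {m' : ℕ}
    (h : ∀ i, (τ.tup i).FreshBelow m') :
    (τ.newFact m').map (extendFresh ρ m' m) = (τ.map ρ).newFact m :=
  congrArg (RelAtom.mk τ.dep.tgt) (τ.dep.newTuple_comp_extendFresh h)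

end FreshConstants

/-! ### Simulation -/

section Simulation

variable {S : RelSchema} {Dom : Type*}

namespace ChaseState

/-- The atoms that are present in a state. -/
def atoms (s : ChaseState S Dom) : Set (RelAtom S (Const Dom)) := {f | s.Has f}

open Classical in
/-- Add the atoms in `N` at level `ℓ`, and count `a` fresh constants as used. -/
noncomputable def addAtoms (s : ChaseState S Dom) (N : Set (RelAtom S (Const Dom))) (ℓ : ℕ∞)
    (a : ℕ) : ChaseState S Dom :=
  ⟨fun f => if f ∈ N then ℓ else s.lev f, s.next + a⟩

/-- The finiteness of a state that is reached from atoms whose constants form the set `A`. -/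
structure Inv (A : Set (Const Dom)) (s : ChaseState S Dom) : Prop where
  finite : s.atoms.Finite
  freshBelow : ∀ c ∈ constsOf s.atoms, c.FreshBelow s.next
  dom_mem : ∀ d, Const.dom d ∈ constsOf s.atoms → Const.dom d ∈ A

theorem lev_eq_top_iff {s : ChaseState S Dom} {f : RelAtom S (Const Dom)} :
    s.lev f = ⊤ ↔ f ∉ s.atoms :=
  not_not.symm

theorem atoms_addAtoms_subset (s : ChaseState S Dom) (N : Set (RelAtom S (Const Dom))) (ℓ : ℕ∞)
    (a : ℕ) : (s.addAtoms N ℓ a).atoms ⊆ s.atoms ∪ N := by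
  intro f hf
  by_cases hN : f ∈ N
  · exact Or.inr hN
  · refine Or.inl fun h => hf ?_
    exact (if_neg hN).trans h

theorem atoms_addAtoms (s : ChaseState S Dom) (N : Set (RelAtom S (Const Dom))) {ℓ : ℕ∞}
    (hℓ : ℓ ≠ ⊤) (a : ℕ) : (s.addAtoms N ℓ a).atoms = s.atoms ∪ N := by
  refine (s.atoms_addAtoms_subset N ℓ a).antisymm fun f hf => ?_
  by_cases hN : f ∈ N
  · exact fun h => hℓ ((if_pos hN).symm.trans h)
  · exact fun h => (hf.resolve_right hN) ((if_neg hN).symm.trans h)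

theorem Inv.addAtoms {A : Set (Const Dom)} {s : ChaseState S Dom} (h : Inv A s)
    {N : Set (RelAtom S (Const Dom))} {a : ℕ} (hfin : N.Finite)
    (hN : N ⊆ atomsOver (constsOf s.atoms ∪ freshFrom s.next a)) (ℓ : ℕ∞) :
    Inv A (s.addAtoms N ℓ a) := by
  have hconsts : constsOf (s.addAtoms N ℓ a).atoms ⊆ constsOf s.atoms ∪ freshFrom s.next a :=
    constsOf_subset_iff.2 <| (s.atoms_addAtoms_subset N ℓ a).trans <|
      Set.union_subset (fun _ hf i => Or.inl (args_mem_constsOf hf i)) hN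
  refine ⟨(h.finite.union hfin).subset (s.atoms_addAtoms_subset N ℓ a), fun c hc => ?_,
    fun d hd => ?_⟩
  · rcases hconsts hc with hc | hc
    · exact (h.freshBelow c hc).mono (Nat.le_add_right _ _)
    · exact freshBelow_of_mem_freshFrom hc
  · rcases hconsts hd with hd | ⟨j, -, hj⟩
    · exact h.dom_mem d hd
    · exact absurd hj (Const.dom_ne_fresh _ _)

theorem atoms_replace (s : ChaseState S Dom) (σ : Const Dom → Const Dom) :
    (s.replace σ).atoms = RelAtom.map σ '' s.atoms := by
  ext f
  simp only [atoms, Has, replace, ne_eq, Set.mem_ofPred_eq, iInf_eq_top, not_forall, Subtype.exists,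
    Set.mem_image]
  exact exists_congr fun g => ⟨fun ⟨hg, h⟩ => ⟨h, hg⟩, fun ⟨h, hg⟩ => ⟨hg, h⟩⟩

theorem lev_replace_map_le (s : ChaseState S Dom) (σ : Const Dom → Const Dom)
    (f : RelAtom S (Const Dom)) : (s.replace σ).lev (f.map σ) ≤ s.lev f :=
  iInf_le (fun g : {g : RelAtom S (Const Dom) // g.map σ = f.map σ} => s.lev g) ⟨f, rfl⟩

theorem replace_id (s : ChaseState S Dom) : s.replace id = s := by
  have hlev : (s.replace id).lev = s.lev := by
    funext f
    refine le_antisymm (s.lev_replace_map_le id f) (le_iInf ?_)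
    rintro ⟨g, rfl⟩
    exact le_rfl
  exact congrArg (ChaseState.mk · s.next) hlev

theorem Inv.replace {A : Set (Const Dom)} {s : ChaseState S Dom} (h : Inv A s)
    {σ : Const Dom → Const Dom} (hσ : Set.MapsTo σ (constsOf s.atoms) (constsOf s.atoms)) :
    Inv A (s.replace σ) := by
  have hconsts : constsOf (s.replace σ).atoms ⊆ constsOf s.atoms := by
    rw [atoms_replace, constsOf_image_map]
    exact hσ.image_subset
  refine ⟨?_, fun c hc => h.freshBelow c (hconsts hc), fun d hd => h.dom_mem d (hconsts hd)⟩
  rw [atoms_replace]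
  exact h.finite.image _

end ChaseState

theorem Labelled.replace {Λ : Type*} {lam : Const Dom → Λ} {s : ChaseState S Dom}
    (h : Labelled s.atoms lam) {σ : Const Dom → Const Dom} (hσ : ∀ c, lam (σ c) = lam c) :
    Labelled (s.replace σ).atoms lam := by
  rw [s.atoms_replace σ]
  rintro _ ⟨f, hf, rfl⟩ i j
  exact (hσ _).trans ((h f hf i j).trans (hσ _).symm)

theorem Labelled.addAtoms {Λ : Type*} {lam lam' : Const Dom → Λ} {s : ChaseState S Dom}
    (h : Labelled s.atoms lam) (hlam : ∀ c ∈ constsOf s.atoms, lam' c = lam c)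
    {N : Set (RelAtom S (Const Dom))} (hN : Labelled N lam') (ℓ : ℕ∞) (a : ℕ) :
    Labelled (s.addAtoms N ℓ a).atoms lam' := by
  intro f hf i j
  rcases s.atoms_addAtoms_subset N ℓ a hf with hf | hf
  · rw [hlam _ (args_mem_constsOf hf i), hlam _ (args_mem_constsOf hf j), h f hf i j]
  · exact hN f hf i j

variable [LinearOrder Dom]

theorem ConstEmb.extendFresh {Q : Set Dom} {W : Set (Const Dom)} {ρ : Const Dom → Const Dom}
    {m m' : ℕ} (h : ConstEmb Q W ρ) (hρ : ∀ c ∈ W, (ρ c).FreshBelow m)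
    (hW : ∀ c ∈ W, c.FreshBelow m') (a : ℕ) :
    ConstEmb Q (W ∪ freshFrom m' a) (extendFresh ρ m' m) where
  strictMonoOn := by
    rintro c (hc | ⟨j, -, rfl⟩) c' (hc' | ⟨k, -, rfl⟩) hlt
    · rw [extendFresh_of_freshBelow (hW c hc), extendFresh_of_freshBelow (hW c' hc')]
      exact h.strictMonoOn hc hc' hlt
    · rw [extendFresh_of_freshBelow (hW c hc), extendFresh_add]
      exact (hρ c hc).lt_fresh k
    · exact absurd hlt ((hW c' hc').lt_fresh j).not_gt
    · rw [extendFresh_add, extendFresh_add, Const.fresh_lt_fresh, Nat.add_lt_add_iff_left]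
      exact Nat.lt_of_add_lt_add_left (Const.fresh_lt_fresh.1 hlt)
  isDom_iff := by
    rintro c (hc | ⟨j, -, rfl⟩)
    · rw [extendFresh_of_freshBelow (hW c hc)]
      exact h.isDom_iff c hc
    · rw [extendFresh_add]
      exact iff_of_false (fun ⟨d, hd⟩ => Const.dom_ne_fresh d _ hd.symm)
        fun ⟨d, hd⟩ => Const.dom_ne_fresh d _ hd.symm
  eq_dom_iff := by
    rintro d hd c (hc | ⟨j, -, rfl⟩)
    · rw [extendFresh_of_freshBelow (hW c hc)]
      exact h.eq_dom_iff d hd c hc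
    · rw [extendFresh_add]
      exact iff_of_false (Const.dom_ne_fresh d _).symm (Const.dom_ne_fresh d _).symm

/-- The part of the state `s` over the constants in `P` is a copy of the state `s'`: the map `ρ`
embeds the constants in `W`, which are all those of `s'`, and preserves levels. -/
structure Sim (Q : Set Dom) (P W : Set (Const Dom)) (ρ : Const Dom → Const Dom)
    (s s' : ChaseState S Dom) : Prop extends ConstEmb Q W ρ where
  mapsTo : Set.MapsTo ρ W P
  consts_subset : constsOf s'.atoms ⊆ W
  cover : constsOf s.atoms ∩ P ⊆ ρ '' W
  lev_map : ∀ f ∈ atomsOver W, s.lev (f.map ρ) = s'.lev f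
  freshBelow_map : ∀ c ∈ W, (ρ c).FreshBelow s.next
  freshBelow : ∀ c ∈ W, c.FreshBelow s'.next

/-- Some map of constants identifies the state `s'` with the part of the state `s` over the
constants in `P`. -/
def ChaseState.Contains (Q : Set Dom) (P : Set (Const Dom)) (s s' : ChaseState S Dom) : Prop :=
  ∃ W ρ, Sim Q P W ρ s s'

namespace Sim

variable {Q : Set Dom} {P W : Set (Const Dom)} {ρ : Const Dom → Const Dom}
  {s s' : ChaseState S Dom}

theorem atoms_subset (h : Sim Q P W ρ s s') : s'.atoms ⊆ atomsOver W :=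
  constsOf_subset_iff.1 h.consts_subset

theorem map_mem_atoms_iff (h : Sim Q P W ρ s s') {f : RelAtom S (Const Dom)}
    (hf : f ∈ atomsOver W) : f.map ρ ∈ s.atoms ↔ f ∈ s'.atoms :=
  not_congr (h.lev_map f hf ▸ Iff.rfl)

theorem mem_atomsOver_image (h : Sim Q P W ρ s s') {f : RelAtom S (Const Dom)}
    (hf : f ∈ s.atoms) (hfP : f ∈ atomsOver P) : f ∈ atomsOver (ρ '' W) :=
  fun i => h.cover ⟨args_mem_constsOf hf i, hfP i⟩

theorem replace (h : Sim Q P W ρ s s') {σ σ' : Const Dom → Const Dom}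
    (hσ : ∀ c ∈ W, σ' c ∈ W ∧ σ (ρ c) = ρ (σ' c)) (hP : ∀ c, σ c ∈ P → c ∈ P) :
    Sim Q P W ρ (s.replace σ) (s'.replace σ') where
  toConstEmb := h.toConstEmb
  mapsTo := h.mapsTo
  freshBelow_map := h.freshBelow_map
  freshBelow := h.freshBelow
  consts_subset := by
    rw [s'.atoms_replace, constsOf_image_map]
    exact Set.image_subset_iff.2 fun c hc => (hσ c (h.consts_subset hc)).1
  cover := by
    rw [s.atoms_replace, constsOf_image_map]
    rintro _ ⟨⟨c, hc, rfl⟩, hcP⟩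
    obtain ⟨w, hw, rfl⟩ := h.cover ⟨hc, hP c hcP⟩
    exact ⟨σ' w, (hσ w hw).1, (hσ w hw).2.symm⟩
  lev_map f hf := by
    have hcomm : ∀ g : RelAtom S (Const Dom), g ∈ atomsOver W →
        (g.map ρ).map σ = (g.map σ').map ρ := fun g hg =>
      RelAtom.map_congr (f := g) (σ := σ ∘ ρ) (τ := ρ ∘ σ') fun i => (hσ _ (hg i)).2
    refine le_antisymm (le_iInf ?_) (le_iInf ?_)
    · rintro ⟨g, rfl⟩
      by_cases hg : g ∈ s'.atoms
      · have hgW := h.atoms_subset hg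
        exact iInf_le_of_le ⟨g.map ρ, hcomm g hgW⟩ (h.lev_map g hgW).le
      · exact le_top.trans (ChaseState.lev_eq_top_iff.2 hg).ge
    · rintro ⟨g, hgf⟩
      by_cases hg : g ∈ s.atoms
      · have hgP : g ∈ atomsOver P := by
          have : g.map σ ∈ atomsOver P := hgf ▸ map_mem_atomsOver h.mapsTo hf
          exact fun i => hP _ (this i)
        obtain ⟨g, hgW, rfl⟩ := exists_map_eq_of_mem_atomsOver (h.mem_atomsOver_image hg hgP)
        rw [hcomm g hgW] at hgf
        have hgσ : g.map σ' ∈ atomsOver W := fun i => (hσ _ (hgW i)).1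
        exact iInf_le_of_le ⟨g, map_injOn_atomsOver h.strictMonoOn.injOn hgσ hf hgf⟩
          (h.lev_map g hgW).ge
      · exact le_top.trans (ChaseState.lev_eq_top_iff.2 hg).ge

theorem replace_outside (h : Sim Q P W ρ s s') {σ : Const Dom → Const Dom}
    (hσ : ∀ c ∈ P, σ c = c) (hP : ∀ c, σ c ∈ P → c ∈ P) : Sim Q P W ρ (s.replace σ) s' := by
  have := h.replace (σ' := id) (fun c hc => ⟨hc, hσ _ (h.mapsTo hc)⟩) hP
  rwa [s'.replace_id] at this

theorem lev_map_extendFresh (h : Sim Q P W ρ s s')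
    (hs : ∀ c ∈ constsOf s.atoms, c.FreshBelow s.next) {a : ℕ} {f : RelAtom S (Const Dom)}
    (hf : f ∈ atomsOver (W ∪ freshFrom s'.next a)) :
    s.lev (f.map (extendFresh ρ s'.next s.next)) = s'.lev f := by
  by_cases hfW : f ∈ atomsOver W
  · rw [RelAtom.map_congr fun i => extendFresh_of_freshBelow (h.freshBelow _ (hfW i)),
      h.lev_map f hfW]
  · obtain ⟨i, hi⟩ := not_forall.1 hfW
    obtain ⟨j, -, hj⟩ := (hf i).resolve_left hi
    rw [ChaseState.lev_eq_top_iff.2 fun hmem => hi (h.atoms_subset hmem i),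
      ChaseState.lev_eq_top_iff.2 fun hmem => ?_]
    refine (hs _ (args_mem_constsOf hmem i)).ne_fresh j ?_
    exact (congrArg _ hj).trans (extendFresh_add ρ _ _ j)

theorem addAtoms (h : Sim Q P W ρ s s') (hs : ∀ c ∈ constsOf s.atoms, c.FreshBelow s.next)
    {P' : Set (Const Dom)} {a : ℕ} (hP : ∀ c, c.FreshBelow s.next → (c ∈ P' ↔ c ∈ P))
    (hPnew : freshFrom s.next a ⊆ P') {N : Set (RelAtom S (Const Dom))}
    (hN : N ⊆ atomsOver (W ∪ freshFrom s'.next a)) (ℓ : ℕ∞) :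
    Sim Q P' (W ∪ freshFrom s'.next a) (extendFresh ρ s'.next s.next)
      (s.addAtoms (RelAtom.map (extendFresh ρ s'.next s.next) '' N) ℓ a) (s'.addAtoms N ℓ a) := by
  have hρ : ∀ c ∈ W, extendFresh ρ s'.next s.next c = ρ c := fun c hc =>
    extendFresh_of_freshBelow (h.freshBelow c hc)
  have emb := h.extendFresh h.freshBelow_map h.freshBelow a
  have mapsTo_new : Set.MapsTo (extendFresh ρ s'.next s.next) (freshFrom s'.next a)
      (freshFrom s.next a) := by
    rintro _ ⟨j, hj, rfl⟩
    exact ⟨j, hj, extendFresh_add ρ _ _ j⟩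
  refine ⟨emb, ?_, ?_, ?_, fun f hf => ?_, ?_, ?_⟩
  · rintro c (hc | hc)
    · rw [hρ c hc]
      exact (hP _ (h.freshBelow_map c hc)).2 (h.mapsTo hc)
    · exact hPnew (mapsTo_new hc)
  · exact constsOf_subset_iff.2 <| (s'.atoms_addAtoms_subset N ℓ a).trans <|
      Set.union_subset (fun f hf i => Or.inl (h.atoms_subset hf i)) hN
  · rintro c ⟨⟨f, hf, i, rfl⟩, hcP⟩
    rcases s.atoms_addAtoms_subset _ ℓ a hf with hf | ⟨g, hg, rfl⟩
    · have hc := args_mem_constsOf hf i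
      obtain ⟨w, hw, hwc⟩ := h.cover ⟨hc, (hP _ (hs _ hc)).1 hcP⟩
      exact ⟨w, Or.inl hw, (hρ w hw).trans hwc⟩
    · exact ⟨g.args i, hN hg i, rfl⟩
  · have hmem : f.map (extendFresh ρ s'.next s.next) ∈
        RelAtom.map (extendFresh ρ s'.next s.next) '' N ↔ f ∈ N :=
      (map_injOn_atomsOver emb.strictMonoOn.injOn).mem_image_iff hN hf
    by_cases hfN : f ∈ N
    · exact (if_pos (hmem.2 hfN)).trans (if_pos hfN).symm
    · exact (if_neg (mt hmem.1 hfN)).trans <|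
        (h.lev_map_extendFresh hs hf).trans (if_neg hfN).symm
  · rintro c (hc | hc)
    · rw [hρ c hc]
      exact (h.freshBelow_map c hc).mono (Nat.le_add_right _ _)
    · exact freshBelow_of_mem_freshFrom (mapsTo_new hc)
  · rintro c (hc | hc)
    · exact (h.freshBelow c hc).mono (Nat.le_add_right _ _)
    · exact freshBelow_of_mem_freshFrom hc

theorem addAtoms_zero (h : Sim Q P W ρ s s')
    (hs : ∀ c ∈ constsOf s.atoms, c.FreshBelow s.next) {N : Set (RelAtom S (Const Dom))}
    (hN : N ⊆ atomsOver W) (ℓ : ℕ∞) :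
    (s.addAtoms (RelAtom.map ρ '' N) ℓ 0).Contains Q P (s'.addAtoms N ℓ 0) := by
  have himage : RelAtom.map (extendFresh ρ s'.next s.next) '' N = RelAtom.map ρ '' N :=
    Set.image_congr fun f hf => RelAtom.map_congr fun i =>
      extendFresh_of_freshBelow (h.freshBelow _ (hN hf i))
  have hnew : freshFrom s.next 0 ⊆ P := fun _ ⟨j, hj, _⟩ => absurd hj j.not_lt_zero
  exact ⟨_, _, himage ▸ h.addAtoms hs (fun _ _ => Iff.rfl) hnew
    (hN.trans (atomsOver_mono Set.subset_union_left)) ℓ⟩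

theorem addAtoms_outside (h : Sim Q P W ρ s s') (arity_pos : ∀ p, 0 < S.arity p)
    (hs : ∀ c ∈ constsOf s.atoms, c.FreshBelow s.next) {P' : Set (Const Dom)}
    (hP : ∀ c, c.FreshBelow s.next → (c ∈ P' ↔ c ∈ P)) {N : Set (RelAtom S (Const Dom))}
    (hN : ∀ f ∈ N, ∀ i, f.args i ∉ P') (ℓ : ℕ∞) (a : ℕ) :
    Sim Q P' W ρ (s.addAtoms N ℓ a) s' where
  toConstEmb := h.toConstEmb
  mapsTo c hc := (hP _ (h.freshBelow_map c hc)).2 (h.mapsTo hc)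
  consts_subset := h.consts_subset
  cover := by
    rintro c ⟨⟨f, hf, i, rfl⟩, hcP⟩
    rcases s.atoms_addAtoms_subset N ℓ a hf with hf | hf
    · have hc := args_mem_constsOf hf i
      exact h.cover ⟨hc, (hP _ (hs _ hc)).1 hcP⟩
    · exact absurd hcP (hN f hf i)
  lev_map f hf := by
    have hfN : f.map ρ ∉ N := fun hmem => by
      have hc := hf ⟨0, arity_pos f.pred⟩
      exact hN _ hmem ⟨0, arity_pos f.pred⟩ ((hP _ (h.freshBelow_map _ hc)).2 (h.mapsTo hc))
    exact (if_neg hfN).trans (h.lev_map f hf)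
  freshBelow_map c hc := (h.freshBelow_map c hc).mono (Nat.le_add_right _ _)
  freshBelow := h.freshBelow

end Sim

end Simulation

/-! ### Rule selection -/

section RuleSelection

variable {S : RelSchema} {Dom St : Type*} [LinearOrder S.Pred] [LinearOrder Dom]
  {lev : RelAtom S (Const Dom) → ℕ∞} {A : KDTrigger S Dom → Prop} {B : IDTrigger S Dom → Prop}
  {F : KDTrigger S Dom → Option St} {G : IDTrigger S Dom → St} {s s₁ : St}

open Classical in
/-- The strategy shared by both chases: apply `F` to the first trigger in `A`, or else `G` to the
first trigger in `B`, or else leave the state `s` as it is. -/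
noncomputable def stepFirst (lev : RelAtom S (Const Dom) → ℕ∞) (A : KDTrigger S Dom → Prop)
    (B : IDTrigger S Dom → Prop) (F : KDTrigger S Dom → Option St) (G : IDTrigger S Dom → St)
    (s : St) : Option St :=
  if h : ∃ τ, KDTrigger.First lev A τ then F h.choose
  else if h : ∃ τ, IDTrigger.First lev B τ then some (G h.choose)
  else some s

theorem stepFirst_cases (h : stepFirst lev A B F G s = some s₁) :
    (∃ τ, KDTrigger.First lev A τ ∧ F τ = some s₁) ∨
    (¬ ∃ τ, KDTrigger.First lev A τ) ∧ (∃ τ, IDTrigger.First lev B τ ∧ G τ = s₁) ∨ s = s₁ := by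
  unfold stepFirst at h
  split_ifs at h with hA hB
  · exact Or.inl ⟨_, hA.choose_spec, h⟩
  · exact Or.inr (Or.inl ⟨hA, _, hB.choose_spec, Option.some.inj h⟩)
  · exact Or.inr (Or.inr (Option.some.inj h))

theorem stepFirst_of_firstKD {τ : KDTrigger S Dom} (h : KDTrigger.First lev A τ) :
    stepFirst lev A B F G s = F τ := by
  have hex : ∃ τ, KDTrigger.First lev A τ := ⟨τ, h⟩
  rw [stepFirst, dif_pos hex, hex.choose_spec.unique h]

theorem stepFirst_of_firstID (hA : ¬ ∃ τ, KDTrigger.First lev A τ) {τ : IDTrigger S Dom}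
    (h : IDTrigger.First lev B τ) : stepFirst lev A B F G s = some (G τ) := by
  have hex : ∃ τ, IDTrigger.First lev B τ := ⟨τ, h⟩
  rw [stepFirst, dif_neg hA, dif_pos hex, hex.choose_spec.unique h]

end RuleSelection

/-- The properties of conceptual dependencies that make each chase step act on facts with a common
label. -/
structure TameDeps {S : RelSchema} (I : Set (InclDep S)) (K : Set (KeyDep S)) : Prop where
  arity_pos : ∀ p, 0 < S.arity p
  width_pos : ∀ σ ∈ I, 0 < σ.width
  tgtPos_injective : ∀ σ ∈ I, Function.Injective σ.tgtPos
  attrs_nonempty : ∀ κ ∈ K, κ.attrs.Nonempty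

/-- The inclusion dependency chase rule is applicable, where constants are compared by `E`. -/
def ChaseState.IDApplicableWith {S : RelSchema} {Dom : Type*} (E : Const Dom → Const Dom → Prop)
    (I : Set (InclDep S)) (s : ChaseState S Dom) (τ : IDTrigger S Dom) : Prop :=
  τ.dep ∈ I ∧ τ.fact ∈ s.atoms ∧
    ¬ ∃ u, (⟨τ.dep.tgt, u⟩ : RelAtom S (Const Dom)) ∈ s.atoms ∧
      ∀ i, E (τ.tup (τ.dep.srcPos i)) (u (τ.dep.tgtPos i))

namespace Sim

variable {S : RelSchema} {Dom : Type*} [LinearOrder Dom] {Q : Set Dom}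
  {P W : Set (Const Dom)} {ρ : Const Dom → Const Dom} {s s' : ChaseState S Dom}

theorem idApplicableWith_map {Λ : Type*} {lam : Const Dom → Λ} {T : Set Λ}
    (h : Sim Q (lam ⁻¹' T) W ρ s s') (hlam : Labelled s.atoms lam) {I : Set (InclDep S)}
    (width_pos : ∀ σ ∈ I, 0 < σ.width) {E E' : Const Dom → Const Dom → Prop}
    (hE : ∀ a ∈ W, ∀ b ∈ W, E (ρ a) (ρ b) ↔ E' a b) (hElam : ∀ a b, E a b → lam a = lam b)
    {τ : IDTrigger S Dom} (hτ : τ.fact ∈ atomsOver W) :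
    s.IDApplicableWith E I (τ.map ρ) ↔ s'.IDApplicableWith E' I τ := by
  refine and_congr_right fun hI => and_congr (h.map_mem_atoms_iff hτ) (not_congr ⟨?_, ?_⟩)
  · rintro ⟨u, hu, huE⟩
    have hu_label : lam (u (τ.dep.tgtPos ⟨0, width_pos _ hI⟩)) ∈ T :=
      hElam _ _ (huE ⟨0, width_pos _ hI⟩) ▸ h.mapsTo (hτ _)
    obtain ⟨g, hg, hgu⟩ := exists_map_eq_of_mem_atomsOver <|
      h.mem_atomsOver_image hu fun j =>
        Set.mem_preimage.2 (Set.mem_of_eq_of_mem (hlam _ hu j _) hu_label)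
    obtain ⟨p, v⟩ := g
    obtain ⟨rfl, hvu⟩ := RelAtom.mk.inj hgu
    obtain rfl := eq_of_heq hvu
    exact ⟨v, (h.map_mem_atoms_iff hg).1 hu, fun i => (hE _ (hτ _) _ (hg _)).1 (huE i)⟩
  · rintro ⟨v, hv, hvE⟩
    have hvW := h.atoms_subset hv
    exact ⟨ρ ∘ v, (h.map_mem_atoms_iff hvW).2 hv, fun i => (hE _ (hτ _) _ (hvW _)).2 (hvE i)⟩

variable [LinearOrder S.Pred]

theorem exists_firstKD (h : Sim Q P W ρ s s') {A A' : KDTrigger S Dom → Prop}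
    (hA : ∀ τ : KDTrigger S Dom, τ.fact₁ ∈ atomsOver W → τ.fact₂ ∈ atomsOver W →
      (A (τ.map ρ) ↔ A' τ))
    (hA' : ∀ τ, A' τ → τ.fact₁ ∈ s'.atoms ∧ τ.fact₂ ∈ s'.atoms) {τ : KDTrigger S Dom}
    (hτ : KDTrigger.First s.lev A τ) (hs₁ : τ.fact₁ ∈ s.atoms) (hs₂ : τ.fact₂ ∈ s.atoms)
    (hP₁ : τ.fact₁ ∈ atomsOver P) (hP₂ : τ.fact₂ ∈ atomsOver P) :
    ∃ τ' : KDTrigger S Dom, τ'.map ρ = τ ∧ KDTrigger.First s'.lev A' τ' := by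
  obtain ⟨τ', h₁, h₂, rfl⟩ :=
    KDTrigger.exists_map_eq (h.mem_atomsOver_image hs₁ hP₁) (h.mem_atomsOver_image hs₂ hP₂)
  exact ⟨τ', rfl, KDTrigger.First.of_map h.strictMonoOn h.lev_map hA
    (fun τ hτ => ⟨h.atoms_subset (hA' τ hτ).1, h.atoms_subset (hA' τ hτ).2⟩) h₁ h₂ hτ⟩

theorem not_exists_firstKD [Finite S.Pred] (h : Sim Q P W ρ s s') (hfin : s.atoms.Finite)
    {A A' : KDTrigger S Dom → Prop}
    (hA : ∀ τ : KDTrigger S Dom, τ.fact₁ ∈ atomsOver W → τ.fact₂ ∈ atomsOver W →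
      (A (τ.map ρ) ↔ A' τ))
    (hAs : ∀ τ, A τ → τ.fact₁ ∈ s.atoms ∧ τ.fact₂ ∈ s.atoms)
    (hA' : ∀ τ, A' τ → τ.fact₁ ∈ s'.atoms ∧ τ.fact₂ ∈ s'.atoms)
    (hno : ¬ ∃ τ, KDTrigger.First s.lev A τ) : ¬ ∃ τ, KDTrigger.First s'.lev A' τ := by
  rintro ⟨τ, hτ, -⟩
  have h₁ := h.atoms_subset (hA' τ hτ).1
  have h₂ := h.atoms_subset (hA' τ hτ).2
  exact hno (KDTrigger.exists_first hfin hAs ((hA τ h₁ h₂).2 hτ))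

theorem exists_firstID (h : Sim Q P W ρ s s') {B B' : IDTrigger S Dom → Prop}
    (hB : ∀ τ : IDTrigger S Dom, τ.fact ∈ atomsOver W → (B (τ.map ρ) ↔ B' τ))
    (hB' : ∀ τ, B' τ → τ.fact ∈ s'.atoms) {τ : IDTrigger S Dom}
    (hτ : IDTrigger.First s.lev B τ) (hs : τ.fact ∈ s.atoms) (hP : τ.fact ∈ atomsOver P) :
    ∃ τ' : IDTrigger S Dom, τ'.map ρ = τ ∧ IDTrigger.First s'.lev B' τ' := by
  obtain ⟨τ', hW, rfl⟩ := IDTrigger.exists_map_eq (h.mem_atomsOver_image hs hP)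
  exact ⟨τ', rfl, IDTrigger.First.of_map h.strictMonoOn h.lev_map hB
    (fun τ hτ => h.atoms_subset (hB' τ hτ)) hW hτ⟩

end Sim

/-! ### Initial states -/

section InitialStates

variable {S S' : RelSchema} {Dom : Type*}

theorem freshBelow_firstFresh {D : Finset (RelAtom S (Const Dom))} {c : Const Dom}
    (h : c ∈ constsOf (D : Set (RelAtom S (Const Dom)))) : c.FreshBelow (firstFresh D) := by
  have hfin : {k : ℕ | Const.fresh k ∈ constsOf (D : Set (RelAtom S (Const Dom)))}.Finite :=
    (finite_constsOf D.finite_toSet).preimage Const.fresh_injective.injOn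
  obtain ⟨b, hb⟩ := hfin.bddAbove
  have hne : {m | ∀ f ∈ D, ∀ i k, f.args i = Const.fresh k → k < m}.Nonempty :=
    ⟨b + 1, fun f hf i k hk => Nat.lt_succ_of_le (hb ⟨f, hf, i, hk⟩)⟩
  obtain ⟨f, hf, i, rfl⟩ := h
  exact fun k hk => Nat.sInf_mem hne f hf i k hk

/-- `ρ` embeds the database `D'` onto the set of facts `F`. -/
structure DbEmb [LinearOrder Dom] (Q : Set Dom) (ρ : Const Dom → Const Dom)
    (D' : Finset (RelAtom S (Const Dom))) (F : Set (RelAtom S (Const Dom))) : Prop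
    extends ConstEmb Q (constsOf (D' : Set (RelAtom S (Const Dom)))) ρ where
  image_map : RelAtom.map ρ '' (D' : Set (RelAtom S (Const Dom))) = F

namespace DbEmb

variable [LinearOrder Dom] {Q : Set Dom} {P : Set (Const Dom)} {ρ : Const Dom → Const Dom}
  {D D' : Finset (RelAtom S (Const Dom))}

theorem image_constsOf {F : Set (RelAtom S (Const Dom))} (h : DbEmb Q ρ D' F) :
    ρ '' constsOf (D' : Set (RelAtom S (Const Dom))) = constsOf F := by
  rw [← h.image_map, constsOf_image_map]

theorem mapsTo (h : DbEmb Q ρ D' (↑D ∩ atomsOver P)) :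
    Set.MapsTo ρ (constsOf (D' : Set (RelAtom S (Const Dom))))
      (constsOf (D : Set (RelAtom S (Const Dom))) ∩ P) := by
  intro c hc
  obtain ⟨f, hf, i, hi⟩ := h.image_constsOf ▸ Set.mem_image_of_mem ρ hc
  exact ⟨⟨f, hf.1, i, hi⟩, hi ▸ hf.2 i⟩

theorem map_mem_iff (h : DbEmb Q ρ D' (↑D ∩ atomsOver P)) {f : RelAtom S (Const Dom)}
    (hf : f ∈ atomsOver (constsOf (D' : Set (RelAtom S (Const Dom))))) :
    f.map ρ ∈ D ↔ f ∈ D' := by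
  have hinj := map_injOn_atomsOver (S := S) h.strictMonoOn.injOn
  rw [← Finset.mem_coe, ← Finset.mem_coe,
    ← hinj.mem_image_iff (constsOf_subset_iff.1 subset_rfl) hf, h.image_map]
  exact (and_iff_left fun i => (h.mapsTo (hf i)).2).symm

theorem sim {Λ : Type*} {lam : Const Dom → Λ} {T : Set Λ}
    (h : DbEmb Q ρ D' (↑D ∩ atomsOver (lam ⁻¹' T)))
    (hlam : Labelled (D : Set (RelAtom S (Const Dom))) lam) {s s' : ChaseState S' Dom}
    (hs : constsOf s.atoms ⊆ constsOf (D : Set (RelAtom S (Const Dom))))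
    (hs' : constsOf s'.atoms ⊆ constsOf (D' : Set (RelAtom S (Const Dom))))
    (hnext : s.next = firstFresh D) (hnext' : s'.next = firstFresh D')
    (hlev : ∀ f ∈ atomsOver (constsOf (D' : Set (RelAtom S (Const Dom)))),
      s.lev (f.map ρ) = s'.lev f) :
    Sim Q (lam ⁻¹' T) (constsOf (D' : Set (RelAtom S (Const Dom)))) ρ s s' where
  toConstEmb := h.toConstEmb
  mapsTo c hc := (h.mapsTo hc).2
  consts_subset := hs'
  cover := by
    rintro c ⟨hc, hcT⟩
    obtain ⟨f, hf, i, rfl⟩ := hs hc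
    rw [h.image_constsOf]
    exact ⟨f, ⟨hf, fun j =>
      Set.mem_preimage.2 (Set.mem_of_eq_of_mem (hlam f hf j i) hcT)⟩, i, rfl⟩
  lev_map := hlev
  freshBelow_map c hc := hnext ▸ freshBelow_firstFresh (h.mapsTo hc).1
  freshBelow c hc := hnext' ▸ freshBelow_firstFresh hc

end DbEmb

end InitialStates

/-! ### Steps of the chase -/

theorem KDTrigger.exists_label {S : RelSchema} {Dom Λ : Type*} {lam : Const Dom → Λ}
    {F : Set (RelAtom S (Const Dom))} (hlam : Labelled F lam) {τ : KDTrigger S Dom}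
    (h₁ : τ.fact₁ ∈ F) (h₂ : τ.fact₂ ∈ F) (hne : τ.dep.attrs.Nonempty)
    (hkey : ∀ i ∈ τ.dep.attrs, lam (τ.fst i) = lam (τ.snd i)) :
    ∃ ℓ, (∀ i, lam (τ.fst i) = ℓ) ∧ ∀ i, lam (τ.snd i) = ℓ := by
  obtain ⟨i₀, hi₀⟩ := hne
  exact ⟨lam (τ.fst i₀), fun i => hlam _ h₁ i i₀,
    fun i => (hlam _ h₂ i i₀).trans (hkey i₀ hi₀).symm⟩

theorem IDTrigger.withLabel_newFact {S : RelSchema} {Dom Λ : Type*} {lam : Const Dom → Λ} {ℓ : Λ}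
    {τ : IDTrigger S Dom} {m : ℕ} (hm : ∀ i, (τ.tup i).FreshBelow m)
    (hℓ : ∀ i, lam (τ.tup i) = ℓ) (j : Fin (S.arity (τ.newFact m).pred)) :
    withLabel lam m ℓ ((τ.newFact m).args j) = ℓ := by
  rcases τ.dep.newTuple_cases τ.tup m j with ⟨i, hi⟩ | ⟨-, hj⟩
  · exact (congrArg _ hi).trans ((withLabel_of_freshBelow (hm i)).trans (hℓ i))
  · exact (congrArg _ hj).trans (withLabel_of_mem_freshFrom ⟨j, j.isLt, rfl⟩)

namespace ChaseState

variable {S : RelSchema} {Dom : Type*} {s s₁ : ChaseState S Dom} {I : Set (InclDep S)}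

theorem IDApplicableWith.newFact_notMem {E : Const Dom → Const Dom → Prop} {τ : IDTrigger S Dom}
    (h : s.IDApplicableWith E I τ) (hE : ∀ i, E (τ.tup i) (τ.tup i))
    (hinj : Function.Injective τ.dep.tgtPos) (m : ℕ) : τ.newFact m ∉ s.atoms := fun hmem =>
  h.2.2 ⟨_, hmem, fun i => (τ.dep.newTuple_tgtPos hinj τ.tup m i).symm ▸ hE _⟩

theorem addAtoms_lev_le {N : Set (RelAtom S (Const Dom))} (hN : Disjoint N s.atoms) (ℓ : ℕ∞)
    (a : ℕ) (f : RelAtom S (Const Dom)) : (s.addAtoms N ℓ a).lev f ≤ s.lev f := by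
  by_cases hf : f ∈ N
  · exact le_top.trans (lev_eq_top_iff.2 (hN.notMem_of_mem_left hf)).ge
  · exact (if_neg hf).le

theorem atoms_init (D : Finset (RelAtom S (Const Dom))) : (init D).atoms = D := by
  ext f
  simp [atoms, Has, init]

theorem inv_init (D : Finset (RelAtom S (Const Dom))) :
    Inv (constsOf (D : Set (RelAtom S (Const Dom)))) (init D) := by
  refine ⟨?_, ?_, ?_⟩ <;> rw [atoms_init]
  · exact D.finite_toSet
  · exact fun _ => freshBelow_firstFresh
  · exact fun _ => id

theorem IDApplicable.fact_mem {τ : IDTrigger S Dom} (h : s.IDApplicable I τ) :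
    τ.fact ∈ s.atoms :=
  h.2.1

variable [LinearOrder S.Pred] [LinearOrder Dom] {K : Set (KeyDep S)}

theorem KDApplicable.facts_mem {τ : KDTrigger S Dom} (h : s.KDApplicable K τ) :
    τ.fact₁ ∈ s.atoms ∧ τ.fact₂ ∈ s.atoms :=
  ⟨h.2.1, h.2.2.1⟩

theorem step_eq_stepFirst (I : Set (InclDep S)) (K : Set (KeyDep S)) (s : ChaseState S Dom) :
    step I K s = stepFirst s.lev (s.KDApplicable K) (s.IDApplicable I)
      (fun τ => (unifier τ.fst τ.snd).map s.replace) s.applyID s :=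
  rfl

theorem step_cases (h : step I K s = some s₁) :
    (∃ τ σ, KDTrigger.First s.lev (s.KDApplicable K) τ ∧ unifier τ.fst τ.snd = some σ ∧
      s.replace σ = s₁) ∨
    (¬ ∃ τ, KDTrigger.First s.lev (s.KDApplicable K) τ) ∧
      (∃ τ, IDTrigger.First s.lev (s.IDApplicable I) τ ∧ s.applyID τ = s₁) ∨ s = s₁ := by
  rw [step_eq_stepFirst] at h
  refine (stepFirst_cases h).imp_left fun ⟨τ, hτ, h⟩ => ?_
  obtain ⟨σ, hσ, rfl⟩ := Option.map_eq_some_iff.1 h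
  exact ⟨τ, σ, hτ, hσ, rfl⟩

theorem step_push (tame : TameDeps I K) (h : step I K s = some s₁) :
    ∃ σ, IsMerge σ ∧ ∀ f, s₁.lev (f.map σ) ≤ s.lev f := by
  rcases step_cases h with ⟨τ, σ, -, hσ, rfl⟩ | ⟨-, τ, hτ, rfl⟩ | rfl
  · exact ⟨σ, isMerge_of_unifier hσ, s.lev_replace_map_le σ⟩
  · have hnew : τ.newFact s.next ∉ s.atoms :=
      IDApplicableWith.newFact_notMem (E := fun a b => b = a) hτ.1 (fun _ => rfl)
        (tame.tgtPos_injective _ hτ.1.1) _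
    exact ⟨id, IsMerge.id, s.addAtoms_lev_le (Set.disjoint_singleton_left.2 hnew) _ _⟩
  · exact ⟨id, IsMerge.id, fun _ => le_rfl⟩

theorem Inv.step {A : Set (Const Dom)} (hs : Inv A s) (h : step I K s = some s₁) : Inv A s₁ := by
  rcases step_cases h with ⟨τ, σ, hτ, hσ, rfl⟩ | ⟨-, τ, hτ, rfl⟩ | rfl
  · refine hs.replace fun c hc => ?_
    rcases unifier_eq_or_mem hσ (args_mem_constsOf hτ.1.facts_mem.1)
      (args_mem_constsOf hτ.1.facts_mem.2) c with hσc | ⟨-, hσc⟩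
    · rwa [hσc]
    · exact hσc
  · exact hs.addAtoms (Set.finite_singleton _) (Set.singleton_subset_iff.2 <|
      IDTrigger.newFact_mem_atomsOver (args_mem_constsOf hτ.1.fact_mem)) _
  · exact hs

end ChaseState

/-- In every state that is contained in `s` through a set of labels, the transition from `s` to `s₁`
can be imitated by at most one step, where `lam` and `lam'` are the labellings before and after. -/
def Imitable {S : RelSchema} {Dom St Λ : Type*} [LinearOrder Dom] (Q : Set Dom)
    (view : St → ChaseState S Dom) (step : St → Option St) (lam lam' : Const Dom → Λ)
    (s s₁ : St) : Prop :=
  ∀ (T : Set Λ) (s' : St), (view s).Contains Q (lam ⁻¹' T) (view s') →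
    ∃ s₁', (s₁' = s' ∨ step s' = some s₁') ∧ (view s₁).Contains Q (lam' ⁻¹' T) (view s₁')

namespace ChaseState

variable {S : RelSchema} {Dom Λ : Type*} [LinearOrder S.Pred] [LinearOrder Dom] {Q : Set Dom}
  {s s₁ : ChaseState S Dom} {I : Set (InclDep S)} {K : Set (KeyDep S)} {lam : Const Dom → Λ}

theorem kdApplicable_map {P W : Set (Const Dom)} {ρ : Const Dom → Const Dom}
    {s' : ChaseState S Dom} (h : Sim Q P W ρ s s') {τ : KDTrigger S Dom}
    (h₁ : τ.fact₁ ∈ atomsOver W) (h₂ : τ.fact₂ ∈ atomsOver W) :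
    s.KDApplicable K (τ.map ρ) ↔ s'.KDApplicable K τ :=
  and_congr Iff.rfl <| and_congr (h.map_mem_atoms_iff h₁) <| and_congr (h.map_mem_atoms_iff h₂) <|
    and_congr (key_map_lt_iff h.strictMonoOn h₁ h₂) <|
    forall₂_congr fun i _ => h.strictMonoOn.injOn.eq_iff (h₁ i) (h₂ i)

theorem imitable_replace {τ : KDTrigger S Dom} {ℓ : Λ} {σ : Const Dom → Const Dom}
    (hτ : KDTrigger.First s.lev (s.KDApplicable K) τ) (h₁ : ∀ i, lam (τ.fst i) = ℓ)
    (h₂ : ∀ i, lam (τ.snd i) = ℓ) (hσ : unifier τ.fst τ.snd = some σ) :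
    Imitable Q id (step I K) lam lam s (s.replace σ) := by
  have hσlam := unifier_comp_label hσ h₁ h₂
  rintro T s' ⟨W, ρ, (h : Sim Q _ W ρ s s')⟩
  have hP : ∀ c, σ c ∈ lam ⁻¹' T → c ∈ lam ⁻¹' T := fun c hc => by
    rwa [Set.mem_preimage, hσlam] at hc
  by_cases hT : ℓ ∈ T
  · obtain ⟨τ', rfl, hfirst⟩ := h.exists_firstKD (A' := s'.KDApplicable K)
      (fun _ => kdApplicable_map h) (fun _ => KDApplicable.facts_mem) hτ
      hτ.1.facts_mem.1 hτ.1.facts_mem.2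
      (fun i => Set.mem_preimage.2 ((h₁ i).symm ▸ hT))
      (fun i => Set.mem_preimage.2 ((h₂ i).symm ▸ hT))
    obtain ⟨σ', hσ', hcomm⟩ := unifier_of_map (t := τ'.fst) (u := τ'.snd) h.toConstEmb
      (h.atoms_subset hfirst.1.facts_mem.1) (h.atoms_subset hfirst.1.facts_mem.2) hσ
    refine ⟨s'.replace σ', Or.inr ?_, W, ρ, h.replace hcomm hP⟩
    rw [step_eq_stepFirst, stepFirst_of_firstKD hfirst, hσ', Option.map_some]
  · refine ⟨s', Or.inl rfl, W, ρ, h.replace_outside (fun c hc => ?_) hP⟩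
    refine (unifier_eq_or_mem hσ (A := lam ⁻¹' {ℓ}) h₁ h₂ c).resolve_right fun hcℓ => hT ?_
    exact Set.mem_singleton_iff.1 hcℓ.1 ▸ hc

theorem imitable_applyID [Finite S.Pred] (tame : TameDeps I K) (hfin : s.atoms.Finite)
    (hfresh : ∀ c ∈ constsOf s.atoms, c.FreshBelow s.next) (hlam : Labelled s.atoms lam)
    {τ : IDTrigger S Dom} {ℓ : Λ} (hK : ¬ ∃ τ, KDTrigger.First s.lev (s.KDApplicable K) τ)
    (hτ : IDTrigger.First s.lev (s.IDApplicable I) τ) (hℓ : ∀ i, lam (τ.tup i) = ℓ) :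
    Imitable Q id (step I K) lam (withLabel lam s.next ℓ) s (s.applyID τ) := by
  rintro T s' ⟨W, ρ, (h : Sim Q _ W ρ s s')⟩
  have hP : ∀ c : Const Dom, c.FreshBelow s.next →
      (c ∈ withLabel lam s.next ℓ ⁻¹' T ↔ c ∈ lam ⁻¹' T) := fun c hc => by
    rw [Set.mem_preimage, withLabel_of_freshBelow hc, Set.mem_preimage]
  by_cases hT : ℓ ∈ T
  · obtain ⟨τ', rfl, hfirst⟩ := h.exists_firstID (B' := s'.IDApplicable I)
      (fun _ => h.idApplicableWith_map (E := fun a b => b = a)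
        (E' := fun a b => b = a) hlam tame.width_pos
        (fun a ha b hb => h.strictMonoOn.injOn.eq_iff hb ha) fun a b hab =>
          congrArg lam (Eq.symm hab))
      (fun _ => IDApplicable.fact_mem) hτ hτ.1.fact_mem
      (fun i => Set.mem_preimage.2 ((hℓ i).symm ▸ hT))
    have hK' := h.not_exists_firstKD hfin (fun _ => kdApplicable_map h)
      (fun _ => KDApplicable.facts_mem) (fun _ => KDApplicable.facts_mem) hK
    have hτW := h.atoms_subset hfirst.1.fact_mem
    have hstep : step I K s' = some (s'.applyID τ') := by
      rw [step_eq_stepFirst, stepFirst_of_firstID hK' hfirst]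
    have hsim := h.addAtoms hfresh hP
      (fun c hc => Set.mem_preimage.2 ((withLabel_of_mem_freshFrom hc).symm ▸ hT))
      (Set.singleton_subset_iff.2 (IDTrigger.newFact_mem_atomsOver hτW)) (s'.lev τ'.fact + 1)
    rw [Set.image_singleton, IDTrigger.newFact_map fun i => h.freshBelow _ (hτW i)] at hsim
    have hsource : (s.applyID (τ'.map ρ)) = s.addAtoms {(τ'.map ρ).newFact s.next}
        (s'.lev τ'.fact + 1) (S.arity τ'.dep.tgt) := h.lev_map _ hτW ▸ rfl
    exact ⟨s'.applyID τ', Or.inr hstep, _, _, hsource ▸ hsim⟩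
  · refine ⟨s', Or.inl rfl, W, ρ, h.addAtoms_outside tame.arity_pos hfresh hP ?_ _ _⟩
    rintro _ rfl j hj
    rw [Set.mem_preimage, IDTrigger.withLabel_newFact
      (fun i => hfresh _ (args_mem_constsOf hτ.1.fact_mem i)) hℓ] at hj
    exact hT hj

theorem exists_imitable_step [Finite S.Pred] (tame : TameDeps I K) {A : Set (Const Dom)}
    (hs : Inv A s) (hlam : Labelled s.atoms lam) (h : step I K s = some s₁) :
    ∃ lam' : Const Dom → Λ, Labelled s₁.atoms lam' ∧ Imitable Q id (step I K) lam lam' s s₁ := by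
  rcases step_cases h with ⟨τ, σ, hτ, hσ, rfl⟩ | ⟨hK, τ, hτ, rfl⟩ | rfl
  · obtain ⟨ℓ, h₁, h₂⟩ := KDTrigger.exists_label hlam hτ.1.facts_mem.1 hτ.1.facts_mem.2
      (tame.attrs_nonempty _ hτ.1.1) fun i hi => congrArg lam (hτ.1.2.2.2.2 i hi)
    exact ⟨lam, hlam.replace (unifier_comp_label hσ h₁ h₂), imitable_replace hτ h₁ h₂ hσ⟩
  · have hℓ : ∀ i, lam (τ.tup i) = lam (τ.tup ⟨0, tame.arity_pos _⟩) :=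
      fun i => hlam _ hτ.1.2.1 i _
    have hτnext : ∀ i, (τ.tup i).FreshBelow s.next :=
      fun i => hs.freshBelow _ (args_mem_constsOf hτ.1.fact_mem i)
    refine ⟨_, hlam.addAtoms (fun c hc => withLabel_of_freshBelow (hs.freshBelow c hc)) ?_ _ _,
      imitable_applyID tame hs.finite hs.freshBelow hlam hK hτ hℓ⟩
    rintro _ rfl i j
    exact (IDTrigger.withLabel_newFact hτnext hℓ i).trans
      (IDTrigger.withLabel_newFact hτnext hℓ j).symm
  · exact ⟨lam, hlam, fun T s' h' => ⟨s', Or.inl rfl, h'⟩⟩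

theorem contains_init {S : RelSchema} {D D' : Finset (RelAtom S (Const Dom))}
    (hlam : Labelled (D : Set (RelAtom S (Const Dom))) lam) {T : Set Λ}
    {ρ : Const Dom → Const Dom} (h : DbEmb Q ρ D' (↑D ∩ atomsOver (lam ⁻¹' T))) :
    (init D).Contains Q (lam ⁻¹' T) (init D') := by
  refine ⟨_, ρ, h.sim hlam ?_ ?_ rfl rfl fun f hf => ?_⟩
  · rw [atoms_init]
  · rw [atoms_init]
  · by_cases hfD : f ∈ D'
    · exact (if_pos ((h.map_mem_iff hf).2 hfD)).trans (if_pos hfD).symm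
    · exact (if_neg (mt (h.map_mem_iff hf).1 hfD)).trans (if_neg hfD).symm

end ChaseState

/-! ### Equality atoms -/

section EqAtoms

variable {S : RelSchema} {K L : Type*}

/-- The atom `eq(a, b)`. -/
def eqAtom (a b : K) : RelAtom S.withEq K :=
  ⟨none, (![a, b] : Fin 2 → K)⟩

theorem RelAtom.withEq_cases (g : RelAtom S.withEq K) :
    (∃ f : RelAtom S K, g = f.toEq) ∨ ∃ a b, g = eqAtom a b := by
  obtain ⟨p | p, a⟩ := g
  · exact Or.inr ⟨a (0 : Fin 2), a (1 : Fin 2),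
      congrArg (RelAtom.mk (S := S.withEq) none) (funext (Fin.forall_fin_two.2 ⟨rfl, rfl⟩))⟩
  · exact Or.inl ⟨⟨p, a⟩, rfl⟩

theorem eqAtom_map (σ : K → L) (a b : K) :
    (eqAtom a b : RelAtom S.withEq K).map σ = eqAtom (σ a) (σ b) :=
  congrArg (RelAtom.mk (S := S.withEq) none) (funext (Fin.forall_fin_two.2 ⟨rfl, rfl⟩))

theorem eqAtom_mem_atomsOver {a b : K} {P : Set K} :
    (eqAtom a b : RelAtom S.withEq K) ∈ atomsOver P ↔ a ∈ P ∧ b ∈ P :=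
  Fin.forall_fin_two

theorem eqAtom_inj {a b a' b' : K} :
    (eqAtom a b : RelAtom S.withEq K) = eqAtom a' b' ↔ a = a' ∧ b = b' := by
  refine ⟨fun h => ?_, fun ⟨h, h'⟩ => h ▸ h' ▸ rfl⟩
  have hargs := eq_of_heq (RelAtom.mk.inj h).2
  exact ⟨congrFun hargs (0 : Fin 2), congrFun hargs (1 : Fin 2)⟩

theorem toEq_ne_eqAtom (f : RelAtom S K) (a b : K) : f.toEq ≠ eqAtom a b :=
  fun h => Option.some_ne_none _ (RelAtom.mk.inj h).1

theorem RelAtom.toEq_injective : Function.Injective (RelAtom.toEq : RelAtom S K → _) := by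
  rintro ⟨p, a⟩ ⟨p', b⟩ h
  obtain ⟨hpred, hargs⟩ := RelAtom.mk.inj h
  obtain rfl := Option.some.inj hpred
  exact congrArg _ (eq_of_heq hargs)

theorem withEq_arity_pos (h : ∀ p, 0 < S.arity p) : ∀ p, 0 < S.withEq.arity p
  | some p => h p
  | none => Nat.two_pos

theorem labelled_of_subset_atomsOver {Λ : Type*} {N : Set (RelAtom S K)} {lam : K → Λ} {ℓ : Λ}
    (h : N ⊆ atomsOver (lam ⁻¹' {ℓ})) : Labelled N lam :=
  fun _ hf i j => (h hf i : lam _ = ℓ).trans (h hf j : lam _ = ℓ).symm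

theorem exists_transGen_of_map {r : L → L → Prop} {r' : K → K → Prop} {ρ : K → L} {W : Set K}
    (h : ∀ a ∈ W, ∀ y, r (ρ a) y → ∃ b ∈ W, ρ b = y ∧ r' a b) {a : K} (ha : a ∈ W) {y : L}
    (hy : Relation.TransGen r (ρ a) y) : ∃ b ∈ W, ρ b = y ∧ Relation.TransGen r' a b := by
  induction hy with
  | single hy =>
    obtain ⟨b, hb, rfl, hab⟩ := h a ha _ hy
    exact ⟨b, hb, rfl, .single hab⟩
  | tail _ hyz ih =>
    obtain ⟨b, hb, rfl, hab⟩ := ih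
    obtain ⟨c, hc, rfl, hbc⟩ := h b hb _ hyz
    exact ⟨c, hc, rfl, hab.tail hbc⟩

end EqAtoms

/-! ### States of the chase with equality -/

namespace EqChaseState

variable {S : RelSchema} {Dom Λ : Type*} {s s₁ : EqChaseState S Dom} {I : Set (InclDep S)}

/-- The facts of a state of the chase with equality, as a state of the chase. -/
def facts (s : EqChaseState S Dom) : ChaseState S Dom := ⟨s.lev, s.next⟩

/-- The facts and `eq` atoms of a state of the chase with equality, as a state over the schema
extended by `eq`. -/
def toChaseState (s : EqChaseState S Dom) : ChaseState S.withEq Dom := ⟨s.atomLev, s.next⟩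

theorem constsOf_facts_subset (s : EqChaseState S Dom) :
    constsOf s.facts.atoms ⊆ constsOf s.toChaseState.atoms :=
  fun _ ⟨f, hf, i, hi⟩ => ⟨f.toEq, hf, i, hi⟩

theorem finite_facts (h : s.toChaseState.atoms.Finite) : s.facts.atoms.Finite :=
  h.preimage RelAtom.toEq_injective.injOn

theorem HasEq.mem_constsOf {a b : Const Dom} (h : s.HasEq a b) :
    a ∈ constsOf s.toChaseState.atoms ∧ b ∈ constsOf s.toChaseState.atoms :=
  eqAtom_mem_atomsOver.1 (args_mem_constsOf (f := eqAtom a b) h)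

theorem HasEq.label_eq {lam : Const Dom → Λ} (hlam : Labelled s.toChaseState.atoms lam)
    {a b : Const Dom} (h : s.HasEq a b) : lam a = lam b :=
  hlam (eqAtom a b) h (0 : Fin 2) (1 : Fin 2)

theorem labelled_facts {lam : Const Dom → Λ} (hlam : Labelled s.toChaseState.atoms lam) :
    Labelled s.facts.atoms lam :=
  fun f hf => hlam f.toEq hf

/-- The invariant of a run that starts from atoms whose constants form the set `A`: equality is
reflexive and transitive at each moment. -/
structure Inv (A : Set (Const Dom)) (s : EqChaseState S Dom) : Prop
    extends ChaseState.Inv A s.toChaseState where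
  refl : ∀ c ∈ constsOf s.toChaseState.atoms, s.HasEq c c
  trans : ∀ a b c, s.HasEq a b → s.HasEq b c → s.HasEq a c

/-- The constants `a` and `b` are equal, or occur at the same position of the two facts of `τ`. -/
def EqLink (s : EqChaseState S Dom) (τ : KDTrigger S Dom) (a b : Const Dom) : Prop :=
  s.HasEq a b ∨ ∃ i, (a = τ.fst i ∧ b = τ.snd i) ∨ (a = τ.snd i ∧ b = τ.fst i)

theorem MergedEq.mem_constsOf {τ : KDTrigger S Dom} (h₁ : s.Has τ.fact₁) (h₂ : s.Has τ.fact₂)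
    {a b : Const Dom} (h : s.MergedEq τ a b) :
    a ∈ constsOf s.toChaseState.atoms ∧ b ∈ constsOf s.toChaseState.atoms := by
  have m₁ : ∀ i, τ.fst i ∈ constsOf s.toChaseState.atoms := args_mem_constsOf (f := τ.fact₁.toEq) h₁
  have m₂ : ∀ i, τ.snd i ∈ constsOf s.toChaseState.atoms := args_mem_constsOf (f := τ.fact₂.toEq) h₂
  have hlink : ∀ a b, s.EqLink τ a b →
      a ∈ constsOf s.toChaseState.atoms ∧ b ∈ constsOf s.toChaseState.atoms := by
    rintro a b (hab | ⟨i, ⟨rfl, rfl⟩ | ⟨rfl, rfl⟩⟩)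
    · exact hab.mem_constsOf
    · exact ⟨m₁ i, m₂ i⟩
    · exact ⟨m₂ i, m₁ i⟩
  induction h with
  | single hab => exact hlink _ _ hab
  | tail _ hbc ih => exact ⟨ih.1, (hlink _ _ hbc).2⟩

theorem MergedEq.hasEq_or_label {A : Set (Const Dom)} (hs : Inv A s) {lam : Const Dom → Λ}
    (hlam : Labelled s.toChaseState.atoms lam) {τ : KDTrigger S Dom} {ℓ : Λ}
    (h₁ : ∀ i, lam (τ.fst i) = ℓ) (h₂ : ∀ i, lam (τ.snd i) = ℓ) {a b : Const Dom}
    (h : s.MergedEq τ a b) : s.HasEq a b ∨ lam a = ℓ ∧ lam b = ℓ := by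
  have hlink : ∀ a b, s.EqLink τ a b → s.HasEq a b ∨ lam a = ℓ ∧ lam b = ℓ := by
    rintro a b (hab | ⟨i, ⟨rfl, rfl⟩ | ⟨rfl, rfl⟩⟩)
    · exact Or.inl hab
    · exact Or.inr ⟨h₁ i, h₂ i⟩
    · exact Or.inr ⟨h₂ i, h₁ i⟩
  induction h with
  | single hab => exact hlink _ _ hab
  | tail _ hbc ih =>
    rcases ih, hlink _ _ hbc with ⟨hab | hab, hbc | hbc⟩
    · exact Or.inl (hs.trans _ _ _ hab hbc)
    · exact Or.inr ⟨(hab.label_eq hlam).trans hbc.1, hbc.2⟩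
    · exact Or.inr ⟨hab.1, (hbc.label_eq hlam).symm.trans hab.2⟩
    · exact Or.inr ⟨hab.1, hbc.2⟩

/-- The atoms that are added by the key dependency rule. -/
def kdNew (s : EqChaseState S Dom) (τ : KDTrigger S Dom) : Set (RelAtom S.withEq (Const Dom)) :=
  {g | ∃ a b, g = eqAtom a b ∧ ¬ s.HasEq a b ∧ s.MergedEq τ a b}

/-- The atoms that are added by the inclusion dependency rule, where `fresh m` is the first unused
fresh constant. -/
def idNew (m : ℕ) (τ : IDTrigger S Dom) : Set (RelAtom S.withEq (Const Dom)) :=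
  insert (τ.newFact m).toEq
    ((fun j : Fin _ => eqAtom (Const.fresh (m + j)) (Const.fresh (m + j))) ''
      (Set.range τ.dep.tgtPos)ᶜ)

theorem eqAtom_mem_kdNew {τ : KDTrigger S Dom} {a b : Const Dom} :
    eqAtom a b ∈ s.kdNew τ ↔ ¬ s.HasEq a b ∧ s.MergedEq τ a b := by
  refine ⟨?_, fun h => ⟨a, b, rfl, h⟩⟩
  rintro ⟨a', b', h, hnew⟩
  obtain ⟨rfl, rfl⟩ := eqAtom_inj.1 h
  exact hnew

theorem toEq_mem_idNew {m : ℕ} {τ : IDTrigger S Dom} {f : RelAtom S (Const Dom)} :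
    f.toEq ∈ idNew m τ ↔ f = τ.newFact m := by
  refine ⟨?_, fun h => Or.inl (congrArg _ h)⟩
  rintro (h | ⟨j, -, h⟩)
  · exact RelAtom.toEq_injective h
  · exact absurd h.symm (toEq_ne_eqAtom _ _ _)

theorem eqAtom_mem_idNew {m : ℕ} {τ : IDTrigger S Dom} {a b : Const Dom} :
    eqAtom a b ∈ idNew m τ ↔
      a = b ∧ ∃ j ∉ Set.range τ.dep.tgtPos, a = Const.fresh (m + j) := by
  constructor
  · rintro (h | ⟨j, hj, h⟩)
    · exact absurd h.symm (toEq_ne_eqAtom _ _ _)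
    · obtain ⟨rfl, rfl⟩ := eqAtom_inj.1 h
      exact ⟨rfl, j, hj, rfl⟩
  · rintro ⟨rfl, j, hj, rfl⟩
    exact Or.inr ⟨j, hj, rfl⟩

theorem toChaseState_applyKD (s : EqChaseState S Dom) (τ : KDTrigger S Dom) :
    (s.applyKD τ).toChaseState = s.toChaseState.addAtoms (s.kdNew τ) (τ.level s.lev) 0 := by
  classical
  refine congrArg (ChaseState.mk · s.next) (funext fun g => ?_)
  rcases g.withEq_cases with ⟨f, rfl⟩ | ⟨a, b, rfl⟩
  · exact (if_neg fun ⟨a, b, h, _⟩ => toEq_ne_eqAtom _ _ _ h).symm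
  · change (if s.HasEq a b then s.eqLev a b else if s.MergedEq τ a b then τ.level s.lev else ⊤) =
      if eqAtom a b ∈ s.kdNew τ then τ.level s.lev else s.eqLev a b
    rw [eqAtom_mem_kdNew]
    by_cases hab : s.HasEq a b
    · rw [if_pos hab, if_neg fun h => h.1 hab]
    · rw [if_neg hab, (not_not.1 hab : s.eqLev a b = ⊤), and_iff_right hab]

theorem toChaseState_applyID (s : EqChaseState S Dom) (τ : IDTrigger S Dom) :
    (s.applyID τ).toChaseState =
      s.toChaseState.addAtoms (idNew s.next τ) (s.lev τ.fact + 1) (S.arity τ.dep.tgt) := by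
  classical
  refine congrArg (ChaseState.mk · (s.next + S.arity τ.dep.tgt)) (funext fun g => ?_)
  rcases g.withEq_cases with ⟨f, rfl⟩ | ⟨a, b, rfl⟩
  · exact (if_congr toEq_mem_idNew rfl rfl).symm
  · exact (if_congr eqAtom_mem_idNew rfl rfl).symm

theorem kdNew_subset_atomsOver {τ : KDTrigger S Dom} (h₁ : s.Has τ.fact₁) (h₂ : s.Has τ.fact₂) :
    s.kdNew τ ⊆ atomsOver (constsOf s.toChaseState.atoms) := by
  rintro _ ⟨a, b, rfl, -, hab⟩
  exact eqAtom_mem_atomsOver.2 (hab.mem_constsOf h₁ h₂)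

theorem finite_kdNew {τ : KDTrigger S Dom} (h : s.toChaseState.atoms.Finite)
    (h₁ : s.Has τ.fact₁) (h₂ : s.Has τ.fact₂) : (s.kdNew τ).Finite := by
  have hfin := finite_constsOf h
  refine (hfin.image2 eqAtom hfin).subset ?_
  rintro _ ⟨a, b, rfl, -, hab⟩
  exact Set.mem_image2_of_mem (hab.mem_constsOf h₁ h₂).1 (hab.mem_constsOf h₁ h₂).2

theorem kdNew_subset_label {A : Set (Const Dom)} (hs : Inv A s) {lam : Const Dom → Λ}
    (hlam : Labelled s.toChaseState.atoms lam) {τ : KDTrigger S Dom} {ℓ : Λ}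
    (h₁ : ∀ i, lam (τ.fst i) = ℓ) (h₂ : ∀ i, lam (τ.snd i) = ℓ) :
    s.kdNew τ ⊆ atomsOver (lam ⁻¹' {ℓ}) := by
  rintro _ ⟨a, b, rfl, hne, hab⟩
  exact eqAtom_mem_atomsOver.2 ((hab.hasEq_or_label hs hlam h₁ h₂).resolve_left hne)

theorem idNew_subset_atomsOver {m : ℕ} {τ : IDTrigger S Dom} {P : Set (Const Dom)}
    (h : τ.newFact m ∈ atomsOver P) (hfresh : freshFrom m (S.arity τ.dep.tgt) ⊆ P) :
    idNew m τ ⊆ atomsOver P := by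
  rintro _ (rfl | ⟨j, -, rfl⟩)
  · exact h
  · have hj : Const.fresh (m + j) ∈ P := hfresh ⟨j, j.isLt, rfl⟩
    exact eqAtom_mem_atomsOver.2 ⟨hj, hj⟩

theorem finite_idNew (m : ℕ) (τ : IDTrigger S Dom) : (idNew m τ).Finite :=
  ((Set.toFinite _).image _).insert _

theorem idNew_subset_label {m : ℕ} {τ : IDTrigger S Dom} {lam : Const Dom → Λ} {ℓ : Λ}
    (hm : ∀ i, (τ.tup i).FreshBelow m) (hℓ : ∀ i, lam (τ.tup i) = ℓ) :
    idNew m τ ⊆ atomsOver (withLabel lam m ℓ ⁻¹' {ℓ}) :=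
  idNew_subset_atomsOver (IDTrigger.withLabel_newFact hm hℓ)
    fun _ hc => withLabel_of_mem_freshFrom hc

theorem idNew_map {ρ : Const Dom → Const Dom} {m m' : ℕ} {τ : IDTrigger S Dom}
    (h : ∀ i, (τ.tup i).FreshBelow m') :
    RelAtom.map (extendFresh ρ m' m) '' idNew m' τ = idNew m (τ.map ρ) := by
  rw [idNew, Set.image_insert_eq, Set.image_image]
  refine congrArg₂ insert (congrArg RelAtom.toEq (IDTrigger.newFact_map h)) ?_
  refine Set.image_congr fun j _ => ?_
  rw [eqAtom_map, extendFresh_add]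

theorem hasEq_applyKD {τ : KDTrigger S Dom} (h₁ : s.Has τ.fact₁) {a b : Const Dom} :
    (s.applyKD τ).HasEq a b ↔ s.MergedEq τ a b := by
  have hlevel : τ.level s.lev ≠ ⊤ := (min_lt_of_left_lt (Ne.lt_top h₁)).ne
  change eqAtom a b ∈ (s.applyKD τ).toChaseState.atoms ↔ _
  rw [toChaseState_applyKD, ChaseState.atoms_addAtoms _ _ hlevel, Set.mem_union, eqAtom_mem_kdNew]
  exact ⟨fun h => h.elim (fun h => .single (Or.inl h)) And.right,
    fun h => or_iff_not_imp_left.2 fun hne => ⟨hne, h⟩⟩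

theorem atoms_applyID {τ : IDTrigger S Dom} (h : s.Has τ.fact) :
    (s.applyID τ).toChaseState.atoms = s.toChaseState.atoms ∪ idNew s.next τ := by
  have hlevel : s.lev τ.fact + 1 ≠ ⊤ := WithTop.add_ne_top.2 ⟨h, ENat.one_ne_top⟩
  rw [toChaseState_applyID, ChaseState.atoms_addAtoms _ _ hlevel]

theorem hasEq_applyID {τ : IDTrigger S Dom} (h : s.Has τ.fact) {a b : Const Dom} :
    (s.applyID τ).HasEq a b ↔ s.HasEq a b ∨
      a = b ∧ ∃ j ∉ Set.range τ.dep.tgtPos, a = Const.fresh (s.next + j) := by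
  rw [← eqAtom_mem_idNew]
  exact Set.ext_iff.1 (atoms_applyID h) (eqAtom a b)

theorem Inv.applyKD {A : Set (Const Dom)} (hs : Inv A s) {τ : KDTrigger S Dom}
    (h₁ : s.Has τ.fact₁) (h₂ : s.Has τ.fact₂) : Inv A (s.applyKD τ) where
  toInv := toChaseState_applyKD s τ ▸ hs.toInv.addAtoms (finite_kdNew hs.finite h₁ h₂)
    ((kdNew_subset_atomsOver h₁ h₂).trans (atomsOver_mono Set.subset_union_left)) _
  refl c hc := by
    rw [toChaseState_applyKD] at hc
    refine (hasEq_applyKD h₁).2 (.single (Or.inl (hs.refl c ?_)))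
    exact constsOf_subset_iff.2 ((s.toChaseState.atoms_addAtoms_subset _ _ _).trans
      (Set.union_subset (constsOf_subset_iff.1 subset_rfl) (kdNew_subset_atomsOver h₁ h₂))) hc
  trans a b c := by
    rw [hasEq_applyKD h₁, hasEq_applyKD h₁, hasEq_applyKD h₁]
    exact Relation.TransGen.trans

theorem Inv.applyID {A : Set (Const Dom)} (hs : Inv A s) {τ : IDTrigger S Dom}
    (h : s.Has τ.fact) : Inv A (s.applyID τ) where
  toInv := toChaseState_applyID s τ ▸ hs.toInv.addAtoms (finite_idNew _ τ)
    (idNew_subset_atomsOver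
      (IDTrigger.newFact_mem_atomsOver (args_mem_constsOf (f := τ.fact.toEq) h))
      Set.subset_union_right) _
  refl := by
    have hold : ∀ c ∈ constsOf s.toChaseState.atoms, (s.applyID τ).HasEq c c :=
      fun c hc => (hasEq_applyID h).2 (Or.inl (hs.refl c hc))
    refine constsOf_subset_iff.2 ?_
    rw [atoms_applyID h]
    rintro f (hf | rfl | ⟨j, hj, rfl⟩)
    · exact fun i => hold _ (args_mem_constsOf hf i)
    · intro i
      rcases τ.dep.newTuple_cases τ.tup s.next i with ⟨k, hk⟩ | ⟨hi, hk⟩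
      · exact (congrArg (fun c => (s.applyID τ).HasEq c c) hk).mpr
          (hold _ (args_mem_constsOf (f := τ.fact.toEq) h k))
      · exact (congrArg (fun c => (s.applyID τ).HasEq c c) hk).mpr
          ((hasEq_applyID h).2 (Or.inr ⟨rfl, i, hi, rfl⟩))
    · have hnew : (s.applyID τ).HasEq (Const.fresh (s.next + j)) (Const.fresh (s.next + j)) :=
        (hasEq_applyID h).2 (Or.inr ⟨rfl, j, hj, rfl⟩)
      exact eqAtom_mem_atomsOver (P := {c | (s.applyID τ).HasEq c c}).2 ⟨hnew, hnew⟩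
  trans a b c := by
    rw [hasEq_applyID h, hasEq_applyID h]
    rintro (hab | ⟨rfl, hab⟩) (hbc | ⟨rfl, -⟩)
    · exact (hasEq_applyID h).2 (Or.inl (hs.trans a b c hab hbc))
    · exact (hasEq_applyID h).2 (Or.inl hab)
    · exact (hasEq_applyID h).2 (Or.inl hbc)
    · exact (hasEq_applyID h).2 (Or.inr ⟨rfl, hab⟩)

theorem hasEq_init {D : Finset (RelAtom S (Const Dom))} {a b : Const Dom} :
    (init D).HasEq a b ↔ a = b ∧ a ∈ constsOf (D : Set (RelAtom S (Const Dom))) := by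
  simp [HasEq, init, constsOf]

theorem constsOf_init (D : Finset (RelAtom S (Const Dom))) :
    constsOf (init D).toChaseState.atoms = constsOf (D : Set (RelAtom S (Const Dom))) := by
  refine (constsOf_subset_iff.2 fun g hg => ?_).antisymm
    fun c hc => (HasEq.mem_constsOf (hasEq_init.2 ⟨rfl, hc⟩)).1
  rcases g.withEq_cases with ⟨f, rfl⟩ | ⟨a, b, rfl⟩
  · have hf : f ∈ (ChaseState.init D).atoms := hg
    rw [ChaseState.atoms_init] at hf
    exact args_mem_constsOf hf
  · obtain ⟨rfl, ha⟩ := (hasEq_init (a := a) (b := b)).1 hg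
    exact eqAtom_mem_atomsOver.2 ⟨ha, ha⟩

theorem inv_init (D : Finset (RelAtom S (Const Dom))) :
    Inv (constsOf (D : Set (RelAtom S (Const Dom)))) (init D) where
  finite := by
    have hfin := finite_constsOf D.finite_toSet
    refine ((D.finite_toSet.image RelAtom.toEq).union (hfin.image fun c => eqAtom c c)).subset
      fun g hg => ?_
    rcases g.withEq_cases with ⟨f, rfl⟩ | ⟨a, b, rfl⟩
    · have hf : f ∈ (ChaseState.init D).atoms := hg
      rw [ChaseState.atoms_init] at hf
      exact Or.inl ⟨f, hf, rfl⟩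
    · obtain ⟨rfl, ha⟩ := (hasEq_init (a := a) (b := b)).1 hg
      exact Or.inr ⟨a, ha, rfl⟩
  freshBelow c hc := freshBelow_firstFresh (constsOf_init D ▸ hc)
  dom_mem d hd := constsOf_init D ▸ hd
  refl c hc := hasEq_init.2 ⟨rfl, constsOf_init D ▸ hc⟩
  trans a b c hab hbc := by
    obtain ⟨rfl, -⟩ := hasEq_init.1 hab
    exact hbc

end EqChaseState

/-! ### Steps of the chase with equality -/

namespace EqChaseState

variable {S : RelSchema} {Dom Λ : Type*} {s s₁ s' : EqChaseState S Dom} {I : Set (InclDep S)}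

section Contains

variable [LinearOrder Dom] {Q : Set Dom} {P W : Set (Const Dom)} {ρ : Const Dom → Const Dom}

theorem sim_facts (h : Sim Q P W ρ s.toChaseState s'.toChaseState) :
    Sim Q P W ρ s.facts s'.facts where
  toConstEmb := h.toConstEmb
  mapsTo := h.mapsTo
  consts_subset := s'.constsOf_facts_subset.trans h.consts_subset
  cover := (Set.inter_subset_inter_left P s.constsOf_facts_subset).trans h.cover
  lev_map f hf := h.lev_map f.toEq hf
  freshBelow_map := h.freshBelow_map
  freshBelow := h.freshBelow

theorem hasEq_map (h : Sim Q P W ρ s.toChaseState s'.toChaseState) {a b : Const Dom} (ha : a ∈ W)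
    (hb : b ∈ W) : s.HasEq (ρ a) (ρ b) ↔ s'.HasEq a b := by
  have hab := h.map_mem_atoms_iff (eqAtom_mem_atomsOver.2 ⟨ha, hb⟩)
  rwa [eqAtom_map] at hab

theorem Clash.of_contains (h : s.toChaseState.Contains Q P s'.toChaseState) (hc : s'.Clash) :
    s.Clash := by
  obtain ⟨W, ρ, h⟩ := h
  obtain ⟨c₁, c₂, hne, h₁₂⟩ := hc
  have h₁ := h.consts_subset h₁₂.mem_constsOf.1
  have h₂ := h.consts_subset h₁₂.mem_constsOf.2
  obtain ⟨d₁, hd₁⟩ := (h.isDom_iff _ h₁).2 ⟨c₁, rfl⟩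
  obtain ⟨d₂, hd₂⟩ := (h.isDom_iff _ h₂).2 ⟨c₂, rfl⟩
  refine ⟨d₁, d₂, ?_, ?_⟩
  · rintro rfl
    exact hne (Const.dom_injective (h.strictMonoOn.injOn h₁ h₂ (hd₁.trans hd₂.symm)))
  · rw [← hd₁, ← hd₂]
    exact (hasEq_map h h₁ h₂).2 h₁₂

theorem mergedEq_map (h : Sim Q P W ρ s.toChaseState s'.toChaseState) {τ : KDTrigger S Dom}
    {a b : Const Dom} (hab : s'.MergedEq τ a b) : s.MergedEq (τ.map ρ) (ρ a) (ρ b) := by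
  refine Relation.TransGen.lift ρ ?_ _ _ hab
  rintro a b (hab | ⟨i, ⟨rfl, rfl⟩ | ⟨rfl, rfl⟩⟩)
  · exact Or.inl ((hasEq_map h (h.consts_subset hab.mem_constsOf.1)
      (h.consts_subset hab.mem_constsOf.2)).2 hab)
  · exact Or.inr ⟨i, Or.inl ⟨rfl, rfl⟩⟩
  · exact Or.inr ⟨i, Or.inr ⟨rfl, rfl⟩⟩

theorem exists_mergedEq_of_map {lam : Const Dom → Λ} {T : Set Λ}
    (hlam : Labelled s.toChaseState.atoms lam)
    (h : Sim Q (lam ⁻¹' T) W ρ s.toChaseState s'.toChaseState) {τ : KDTrigger S Dom}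
    (h₁ : τ.fact₁ ∈ atomsOver W) (h₂ : τ.fact₂ ∈ atomsOver W) {a y : Const Dom} (ha : a ∈ W)
    (hay : s.MergedEq (τ.map ρ) (ρ a) y) : ∃ b ∈ W, ρ b = y ∧ s'.MergedEq τ a b := by
  refine exists_transGen_of_map ?_ ha hay
  rintro a ha y (hy | ⟨i, ⟨hx, rfl⟩ | ⟨hx, rfl⟩⟩)
  · obtain ⟨b, hb, rfl⟩ := h.cover ⟨hy.mem_constsOf.2,
      Set.mem_preimage.2 (hy.label_eq hlam ▸ h.mapsTo ha)⟩
    exact ⟨b, hb, rfl, Or.inl ((hasEq_map h ha hb).1 hy)⟩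
  · exact ⟨_, h₂ i, rfl, Or.inr ⟨i, Or.inl ⟨h.strictMonoOn.injOn ha (h₁ i) hx, rfl⟩⟩⟩
  · exact ⟨_, h₁ i, rfl, Or.inr ⟨i, Or.inr ⟨h.strictMonoOn.injOn ha (h₂ i) hx, rfl⟩⟩⟩

theorem kdNew_map {A : Set (Const Dom)} (hs : Inv A s) {lam : Const Dom → Λ} {T : Set Λ} {ℓ : Λ}
    (hT : ℓ ∈ T) (hlam : Labelled s.toChaseState.atoms lam)
    (h : Sim Q (lam ⁻¹' T) W ρ s.toChaseState s'.toChaseState) {τ : KDTrigger S Dom}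
    (h₁ : s'.Has τ.fact₁) (h₂ : s'.Has τ.fact₂) (hℓ₁ : ∀ i, lam (ρ (τ.fst i)) = ℓ)
    (hℓ₂ : ∀ i, lam (ρ (τ.snd i)) = ℓ) :
    RelAtom.map ρ '' s'.kdNew τ = s.kdNew (τ.map ρ) := by
  have hW₁ : τ.fact₁ ∈ atomsOver W := (sim_facts h).atoms_subset h₁
  have hW₂ : τ.fact₂ ∈ atomsOver W := (sim_facts h).atoms_subset h₂
  ext g
  constructor
  · rintro ⟨_, ⟨a, b, rfl, hne, hab⟩, rfl⟩
    obtain ⟨ha, hb⟩ := hab.mem_constsOf h₁ h₂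
    rw [eqAtom_map, eqAtom_mem_kdNew, hasEq_map h (h.consts_subset ha) (h.consts_subset hb)]
    exact ⟨hne, mergedEq_map h hab⟩
  · rintro ⟨x, y, rfl, hne, hxy⟩
    have hx : lam x = ℓ :=
      ((hxy.hasEq_or_label hs hlam (τ := τ.map ρ) hℓ₁ hℓ₂).resolve_left hne).1
    have hxs : x ∈ constsOf s.toChaseState.atoms :=
      (MergedEq.mem_constsOf (s := s) (τ := τ.map ρ) (((sim_facts h).map_mem_atoms_iff hW₁).2 h₁)
        (((sim_facts h).map_mem_atoms_iff hW₂).2 h₂) hxy).1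
    obtain ⟨a, ha, rfl⟩ := h.cover ⟨hxs, Set.mem_preimage.2 (hx ▸ hT)⟩
    obtain ⟨b, hb, rfl, hab⟩ := exists_mergedEq_of_map hlam h hW₁ hW₂ ha hxy
    exact ⟨eqAtom a b, ⟨a, b, rfl, mt (hasEq_map h ha hb).2 hne, hab⟩, eqAtom_map ρ a b⟩

end Contains

theorem IDApplicable.has_fact {τ : IDTrigger S Dom} (h : s.IDApplicable I τ) : s.Has τ.fact :=
  h.2.1

theorem disjoint_idNew {K : Set (KeyDep S)} (tame : TameDeps I K) {A : Set (Const Dom)}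
    (hs : Inv A s) {τ : IDTrigger S Dom} (hτ : s.IDApplicable I τ) :
    Disjoint (idNew s.next τ) s.toChaseState.atoms := by
  have hmem : ∀ i, τ.tup i ∈ constsOf s.toChaseState.atoms :=
    args_mem_constsOf (f := τ.fact.toEq) hτ.has_fact
  refine Set.disjoint_left.2 ?_
  rintro _ (rfl | ⟨j, -, rfl⟩) hf
  · exact ChaseState.IDApplicableWith.newFact_notMem (s := s.facts) (E := s.HasEq) hτ
      (fun i => hs.refl _ (hmem i)) (tame.tgtPos_injective _ hτ.1) _ hf
  · exact (hs.freshBelow _ (HasEq.mem_constsOf hf).1).ne_fresh j rfl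

variable [LinearOrder S.Pred] [LinearOrder Dom] {K : Set (KeyDep S)} {Q : Set Dom}
  {A : Set (Const Dom)} {lam : Const Dom → Λ}

theorem KDApplicable.has_facts {τ : KDTrigger S Dom} (h : s.KDApplicable K τ) :
    s.Has τ.fact₁ ∧ s.Has τ.fact₂ :=
  ⟨h.2.1, h.2.2.1⟩

open Classical in
theorem step_eq_stepFirst (I : Set (InclDep S)) (K : Set (KeyDep S)) (s : EqChaseState S Dom) :
    step I K s = stepFirst s.lev (s.KDApplicable K) (s.IDApplicable I)
      (fun τ => if (s.applyKD τ).Clash then none else some (s.applyKD τ)) s.applyID s :=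
  rfl

theorem step_cases (h : step I K s = some s₁) :
    (∃ τ, KDTrigger.First s.lev (s.KDApplicable K) τ ∧ ¬ (s.applyKD τ).Clash ∧
      s.applyKD τ = s₁) ∨
    (¬ ∃ τ, KDTrigger.First s.lev (s.KDApplicable K) τ) ∧
      (∃ τ, IDTrigger.First s.lev (s.IDApplicable I) τ ∧ s.applyID τ = s₁) ∨ s = s₁ := by
  rw [step_eq_stepFirst] at h
  refine (stepFirst_cases h).imp_left fun ⟨τ, hτ, h⟩ => ⟨τ, hτ, ?_⟩
  split_ifs at h with hclash
  exact ⟨hclash, Option.some.inj h⟩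

theorem Inv.step (hs : Inv A s) (h : step I K s = some s₁) : Inv A s₁ := by
  rcases step_cases h with ⟨τ, hτ, -, rfl⟩ | ⟨-, τ, hτ, rfl⟩ | rfl
  · exact hs.applyKD hτ.1.has_facts.1 hτ.1.has_facts.2
  · exact hs.applyID hτ.1.has_fact
  · exact hs

theorem step_lev_le (tame : TameDeps I K) (hs : Inv A s) (h : step I K s = some s₁)
    (f : RelAtom S.withEq (Const Dom)) : s₁.atomLev f ≤ s.atomLev f := by
  change s₁.toChaseState.lev f ≤ s.toChaseState.lev f
  rcases step_cases h with ⟨τ, -, -, rfl⟩ | ⟨-, τ, hτ, rfl⟩ | rfl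
  · rw [toChaseState_applyKD]
    refine s.toChaseState.addAtoms_lev_le (Set.disjoint_left.2 ?_) _ _ f
    rintro _ ⟨a, b, rfl, hne, -⟩
    exact hne
  · rw [toChaseState_applyID]
    exact s.toChaseState.addAtoms_lev_le (disjoint_idNew tame hs hτ.1) _ _ f
  · exact le_rfl

theorem kdApplicable_map {P W : Set (Const Dom)} {ρ : Const Dom → Const Dom}
    (h : Sim Q P W ρ s.toChaseState s'.toChaseState) {τ : KDTrigger S Dom}
    (h₁ : τ.fact₁ ∈ atomsOver W) (h₂ : τ.fact₂ ∈ atomsOver W) :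
    s.KDApplicable K (τ.map ρ) ↔ s'.KDApplicable K τ :=
  and_congr Iff.rfl <| and_congr ((sim_facts h).map_mem_atoms_iff h₁) <|
    and_congr ((sim_facts h).map_mem_atoms_iff h₂) <|
    and_congr (key_map_lt_iff h.strictMonoOn h₁ h₂) <|
    and_congr (forall₂_congr fun i _ => hasEq_map h (h₁ i) (h₂ i)) <|
    exists_congr fun i => not_congr (hasEq_map h (h₁ i) (h₂ i))

theorem imitable_applyKD (arity_pos : ∀ p, 0 < S.arity p) (hs : Inv A s)
    (hlam : Labelled s.toChaseState.atoms lam) {τ : KDTrigger S Dom} {ℓ : Λ}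
    (hτ : KDTrigger.First s.lev (s.KDApplicable K) τ) (hclash : ¬ (s.applyKD τ).Clash)
    (hℓ₁ : ∀ i, lam (τ.fst i) = ℓ) (hℓ₂ : ∀ i, lam (τ.snd i) = ℓ) :
    Imitable Q toChaseState (step I K) lam lam s (s.applyKD τ) := by
  classical
  rintro T s' ⟨W, ρ, h⟩
  rw [toChaseState_applyKD]
  by_cases hT : ℓ ∈ T
  · obtain ⟨τ', rfl, hfirst : KDTrigger.First s'.lev _ τ'⟩ :=
      (sim_facts h).exists_firstKD (A' := s'.KDApplicable K)
      (fun _ => kdApplicable_map h) (fun _ => KDApplicable.has_facts) hτ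
      hτ.1.has_facts.1 hτ.1.has_facts.2
      (fun i => Set.mem_preimage.2 ((hℓ₁ i).symm ▸ hT))
      (fun i => Set.mem_preimage.2 ((hℓ₂ i).symm ▸ hT))
    obtain ⟨h₁, h₂⟩ := hfirst.1.has_facts
    have hW₁ := (sim_facts h).atoms_subset h₁
    have hW₂ := (sim_facts h).atoms_subset h₂
    have hlevel : (τ'.map ρ).level s.lev = τ'.level s'.lev :=
      congrArg₂ min ((sim_facts h).lev_map _ hW₁) ((sim_facts h).lev_map _ hW₂)
    have hcontains := h.addAtoms_zero hs.freshBelow ((kdNew_subset_atomsOver h₁ h₂).trans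
      (atomsOver_mono h.consts_subset)) (τ'.level s'.lev)
    rw [kdNew_map hs hT hlam h h₁ h₂ hℓ₁ hℓ₂, ← toChaseState_applyKD, ← hlevel] at hcontains
    refine ⟨s'.applyKD τ', Or.inr ?_, hcontains⟩
    rw [← toChaseState_applyKD] at hcontains
    rw [step_eq_stepFirst, stepFirst_of_firstKD hfirst,
      if_neg fun hc => hclash (hc.of_contains hcontains)]
  · refine ⟨s', Or.inl rfl, W, ρ, h.addAtoms_outside (withEq_arity_pos arity_pos) hs.freshBelow
      (fun _ _ => Iff.rfl) (fun f hf i hi => hT ?_) _ _⟩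
    exact Set.mem_of_eq_of_mem (kdNew_subset_label hs hlam hℓ₁ hℓ₂ hf i : lam _ = ℓ).symm hi

theorem imitable_applyID [Finite S.Pred] (tame : TameDeps I K) (hs : Inv A s)
    (hlam : Labelled s.toChaseState.atoms lam) {τ : IDTrigger S Dom} {ℓ : Λ}
    (hK : ¬ ∃ τ, KDTrigger.First s.lev (s.KDApplicable K) τ)
    (hτ : IDTrigger.First s.lev (s.IDApplicable I) τ) (hℓ : ∀ i, lam (τ.tup i) = ℓ) :
    Imitable Q toChaseState (step I K) lam (withLabel lam s.next ℓ) s (s.applyID τ) := by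
  rintro T s' ⟨W, ρ, h⟩
  rw [toChaseState_applyID]
  have hP : ∀ c : Const Dom, c.FreshBelow s.next →
      (c ∈ withLabel lam s.next ℓ ⁻¹' T ↔ c ∈ lam ⁻¹' T) := fun c hc => by
    rw [Set.mem_preimage, withLabel_of_freshBelow hc, Set.mem_preimage]
  by_cases hT : ℓ ∈ T
  · obtain ⟨τ', rfl, hfirst : IDTrigger.First s'.lev _ τ'⟩ :=
      (sim_facts h).exists_firstID (B' := s'.IDApplicable I)
      (fun _ => (sim_facts h).idApplicableWith_map (labelled_facts hlam) tame.width_pos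
        (fun a ha b hb => hasEq_map h ha hb) fun a b hab => hab.label_eq hlam)
      (fun _ => IDApplicable.has_fact) hτ hτ.1.has_fact
      (fun i => Set.mem_preimage.2 ((hℓ i).symm ▸ hT))
    have hK' : ¬ ∃ τ, KDTrigger.First s'.lev _ τ :=
      (sim_facts h).not_exists_firstKD (finite_facts hs.finite) (fun _ => kdApplicable_map h)
        (fun _ => KDApplicable.has_facts) (fun _ => KDApplicable.has_facts) hK
    have hτW : τ'.fact ∈ atomsOver W := (sim_facts h).atoms_subset hfirst.1.has_fact
    have hlevel : s.lev (τ'.map ρ).fact = s'.lev τ'.fact := (sim_facts h).lev_map _ hτW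
    have hstep : step I K s' = some (s'.applyID τ') := by
      rw [step_eq_stepFirst, stepFirst_of_firstID hK' hfirst]
    have hsim := h.addAtoms hs.freshBelow hP
      (fun c hc => Set.mem_preimage.2 ((withLabel_of_mem_freshFrom hc).symm ▸ hT))
      (idNew_subset_atomsOver (IDTrigger.newFact_mem_atomsOver (m := s'.next) hτW)
        Set.subset_union_right) (s'.lev τ'.fact + 1)
    have himage : RelAtom.map (extendFresh ρ s'.toChaseState.next s.toChaseState.next) ''
        idNew s'.next τ' = idNew s.next (τ'.map ρ) := idNew_map fun i => h.freshBelow _ (hτW i)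
    rw [himage, ← toChaseState_applyID, ← hlevel] at hsim
    exact ⟨s'.applyID τ', Or.inr hstep, _, _, hsim⟩
  · refine ⟨s', Or.inl rfl, W, ρ, h.addAtoms_outside (withEq_arity_pos tame.arity_pos)
      hs.freshBelow hP (fun f hf i hi => hT ?_) _ _⟩
    exact Set.mem_of_eq_of_mem (idNew_subset_label (fun i => hs.freshBelow _
      (args_mem_constsOf (f := τ.fact.toEq) hτ.1.has_fact i)) hℓ hf i :
        withLabel _ _ _ _ = ℓ).symm hi

theorem exists_imitable_step [Finite S.Pred] (tame : TameDeps I K) (hs : Inv A s)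
    (hlam : Labelled s.toChaseState.atoms lam) (h : step I K s = some s₁) :
    ∃ lam' : Const Dom → Λ, Labelled s₁.toChaseState.atoms lam' ∧
      Imitable Q toChaseState (step I K) lam lam' s s₁ := by
  rcases step_cases h with ⟨τ, hτ, hclash, rfl⟩ | ⟨hK, τ, hτ, rfl⟩ | rfl
  · obtain ⟨ℓ, hℓ₁, hℓ₂⟩ := KDTrigger.exists_label (labelled_facts hlam) hτ.1.has_facts.1
      hτ.1.has_facts.2 (tame.attrs_nonempty _ hτ.1.1)
      fun i hi => HasEq.label_eq hlam (hτ.1.2.2.2.2.1 i hi)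
    refine ⟨lam, ?_, imitable_applyKD tame.arity_pos hs hlam hτ hclash hℓ₁ hℓ₂⟩
    rw [toChaseState_applyKD]
    exact hlam.addAtoms (fun _ _ => rfl)
      (labelled_of_subset_atomsOver (kdNew_subset_label hs hlam hℓ₁ hℓ₂)) _ _
  · have hℓ : ∀ i, lam (τ.tup i) = lam (τ.tup ⟨0, tame.arity_pos _⟩) :=
      fun i => hlam τ.fact.toEq hτ.1.has_fact i _
    refine ⟨_, ?_, imitable_applyID tame hs hlam hK hτ hℓ⟩
    rw [toChaseState_applyID]
    exact hlam.addAtoms (fun c hc => withLabel_of_freshBelow (hs.freshBelow c hc))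
      (labelled_of_subset_atomsOver (idNew_subset_label (fun i => hs.freshBelow _
        (args_mem_constsOf (f := τ.fact.toEq) hτ.1.has_fact i)) hℓ)) _ _
  · exact ⟨lam, hlam, fun T s' h' => ⟨s', Or.inl rfl, h'⟩⟩

theorem labelled_init {S : RelSchema} {Dom : Type*} {lam : Const Dom → Λ}
    {D : Finset (RelAtom S (Const Dom))} (hlam : Labelled (D : Set (RelAtom S (Const Dom))) lam) :
    Labelled (init D).toChaseState.atoms lam := by
  intro g hg
  rcases g.withEq_cases with ⟨f, rfl⟩ | ⟨a, b, rfl⟩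
  · have hf : f ∈ (ChaseState.init D).atoms := hg
    rw [ChaseState.atoms_init] at hf
    exact hlam f hf
  · obtain ⟨rfl, -⟩ := (hasEq_init (a := a) (b := b)).1 hg
    exact labelled_of_subset_atomsOver (ℓ := lam a)
      (Set.singleton_subset_iff.2 (eqAtom_mem_atomsOver.2 ⟨rfl, rfl⟩)) _ rfl

theorem contains_init {S : RelSchema} {D D' : Finset (RelAtom S (Const Dom))}
    (hlam : Labelled (D : Set (RelAtom S (Const Dom))) lam) {T : Set Λ}
    {ρ : Const Dom → Const Dom} (h : DbEmb Q ρ D' (↑D ∩ atomsOver (lam ⁻¹' T))) :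
    (init D).toChaseState.Contains Q (lam ⁻¹' T) (init D').toChaseState := by
  refine ⟨_, ρ, h.sim hlam (constsOf_init D).subset (constsOf_init D').subset rfl rfl
    fun g hg => ?_⟩
  rcases g.withEq_cases with ⟨f, rfl⟩ | ⟨a, b, rfl⟩
  · change (init D).lev (f.map ρ) = (init D').lev f
    by_cases hfD : f ∈ D'
    · exact (if_pos ((h.map_mem_iff hg).2 hfD)).trans (if_pos hfD).symm
    · exact (if_neg (mt (h.map_mem_iff hg).1 hfD)).trans (if_neg hfD).symm
  · obtain ⟨ha, hb⟩ := eqAtom_mem_atomsOver.1 hg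
    rw [eqAtom_map]
    change (init D).eqLev (ρ a) (ρ b) = (init D').eqLev a b
    by_cases hab : a = b
    · subst hab
      exact (if_pos ⟨rfl, (h.mapsTo ha).1⟩).trans (if_pos ⟨rfl, ha⟩).symm
    · exact (if_neg fun hρ => hab (h.strictMonoOn.injOn ha hb hρ.1)).trans
        (if_neg fun h => hab h.1).symm

end EqChaseState

/-! ### Runs of a chase -/

/-- A chase that manipulates states of type `St`: its initial state, its partial step function, and
the levelled atoms that are present in a state. -/
structure ChaseProcess (S S' : RelSchema) (Dom St : Type*) where
  init : Finset (RelAtom S (Const Dom)) → St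
  step : St → Option St
  view : St → ChaseState S' Dom

namespace ChaseProcess

variable {S S' : RelSchema} {Dom : Type u} {St : Type*}

/-- The successive states of the chase of `D`, which are `none` from the moment of a failure. -/
def seq (P : ChaseProcess S S' Dom St) (D : Finset (RelAtom S (Const Dom))) : ℕ → Option St
  | 0 => some (P.init D)
  | n + 1 => (P.seq D n).bind P.step

/-- The atoms that from some moment on are present at a fixed level which is at most `ℓ`. -/
def upTo (P : ChaseProcess S S' Dom St) (D : Finset (RelAtom S (Const Dom))) (ℓ : ℕ) :
    Set (RelAtom S' (Const Dom)) :=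
  {f | ∃ k : ℕ, k ≤ ℓ ∧ ∀ᶠ n in Filter.atTop, ∃ s, P.seq D n = some s ∧ (P.view s).lev f = k}

/-- The properties of a chase that bound the levels of answers. The states that are reached from
`D` satisfy the invariant `J` with parameter `constsOf D`, steps do not raise levels, and labels are
propagated in such a way that the chase of the part of `D` that has certain labels imitates the
chase of `D`. -/
structure Regular [LinearOrder Dom] (P : ChaseProcess S S' Dom St)
    (J : Set (Const Dom) → St → Prop) : Prop where
  inv_init : ∀ D : Finset (RelAtom S (Const Dom)),
    J (constsOf (D : Set (RelAtom S (Const Dom)))) (P.init D)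
  inv_step : ∀ {A s s₁}, J A s → P.step s = some s₁ → J A s₁
  inv_view : ∀ {A s}, J A s → (P.view s).Inv A
  push : ∀ {A s s₁}, J A s → P.step s = some s₁ →
    ∃ σ, IsMerge σ ∧ ∀ f, (P.view s₁).lev (f.map σ) ≤ (P.view s).lev f
  labelled_init : ∀ {Λ : Type u} {lam : Const Dom → Λ} {D : Finset (RelAtom S (Const Dom))},
    Labelled (D : Set (RelAtom S (Const Dom))) lam → Labelled (P.view (P.init D)).atoms lam
  contains_init : ∀ {Λ : Type u} {lam : Const Dom → Λ} {D D' : Finset (RelAtom S (Const Dom))}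
    {Q : Set Dom} {T : Set Λ} {ρ : Const Dom → Const Dom},
    Labelled (D : Set (RelAtom S (Const Dom))) lam → DbEmb Q ρ D' (↑D ∩ atomsOver (lam ⁻¹' T)) →
    (P.view (P.init D)).Contains Q (lam ⁻¹' T) (P.view (P.init D'))
  imitable_step : ∀ {Λ : Type u} {lam : Const Dom → Λ} {A s s₁} (Q : Set Dom), J A s →
    Labelled (P.view s).atoms lam → P.step s = some s₁ →
    ∃ lam' : Const Dom → Λ, Labelled (P.view s₁).atoms lam' ∧
      Imitable Q P.view P.step lam lam' s s₁

namespace Regular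

variable [LinearOrder Dom] {P : ChaseProcess S S' Dom St} {J : Set (Const Dom) → St → Prop}
  {D : Finset (RelAtom S (Const Dom))}

theorem inv_seq (hP : P.Regular J) :
    ∀ {n : ℕ} {s : St}, P.seq D n = some s → J (constsOf (D : Set (RelAtom S (Const Dom)))) s
  | 0, s, h => by
    obtain rfl := Option.some.inj h
    exact hP.inv_init D
  | n + 1, s, h => by
    obtain ⟨s₀, h₀, h₁⟩ := Option.bind_eq_some_iff.1 h
    exact hP.inv_step (hP.inv_seq h₀) h₁

theorem exists_label_contains (hP : P.Regular J) (Q : Set Dom) {Λ : Type u}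
    {lam₀ : Const Dom → Λ} (hlam₀ : Labelled (D : Set (RelAtom S (Const Dom))) lam₀) :
    ∀ {n : ℕ} {s : St}, P.seq D n = some s → ∃ lam : Const Dom → Λ,
      Labelled (P.view s).atoms lam ∧
      ∀ (T : Set Λ) (D' : Finset (RelAtom S (Const Dom))) (ρ : Const Dom → Const Dom),
        DbEmb Q ρ D' (↑D ∩ atomsOver (lam₀ ⁻¹' T)) →
        ∃ n' s', P.seq D' n' = some s' ∧ (P.view s).Contains Q (lam ⁻¹' T) (P.view s')
  | 0, s, h => by
    obtain rfl := Option.some.inj h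
    exact ⟨lam₀, hP.labelled_init hlam₀, fun T D' ρ hρ =>
      ⟨0, _, rfl, hP.contains_init hlam₀ hρ⟩⟩
  | n + 1, s, h => by
    obtain ⟨s₀, h₀, h₁⟩ := Option.bind_eq_some_iff.1 h
    obtain ⟨lam, hlam, hcontains⟩ := hP.exists_label_contains Q hlam₀ h₀
    obtain ⟨lam', hlam', himitable⟩ := hP.imitable_step Q (hP.inv_seq h₀) hlam h₁
    refine ⟨lam', hlam', fun T D' ρ hρ => ?_⟩
    obtain ⟨n', s', hs', hc⟩ := hcontains T D' ρ hρ
    obtain ⟨s₁', rfl | hs₁', hc'⟩ := himitable T s' hc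
    · exact ⟨n', _, hs', hc'⟩
    · exact ⟨n' + 1, s₁', Option.bind_eq_some_iff.2 ⟨s', hs', hs₁'⟩, hc'⟩

end Regular

end ChaseProcess

section Processes

variable {S : RelSchema} {Dom : Type u} [LinearOrder S.Pred] [LinearOrder Dom]
  {I : Set (InclDep S)} {K : Set (KeyDep S)}

/-- The chase for the dependencies `I` and `K`. -/
noncomputable def chaseProcess (I : Set (InclDep S)) (K : Set (KeyDep S)) :
    ChaseProcess S S Dom (ChaseState S Dom) :=
  ⟨ChaseState.init, ChaseState.step I K, id⟩

/-- The chase with equality for the dependencies `I` and `K`. -/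
noncomputable def eqChaseProcess (I : Set (InclDep S)) (K : Set (KeyDep S)) :
    ChaseProcess S S.withEq Dom (EqChaseState S Dom) :=
  ⟨EqChaseState.init, EqChaseState.step I K, EqChaseState.toChaseState⟩

theorem seq_chaseProcess (D : Finset (RelAtom S (Const Dom))) :
    ∀ n, (chaseProcess I K).seq D n = chaseSeq I K D n
  | 0 => rfl
  | n + 1 => congrArg (Option.bind · (ChaseState.step I K)) (seq_chaseProcess D n)

theorem seq_eqChaseProcess (D : Finset (RelAtom S (Const Dom))) :
    ∀ n, (eqChaseProcess I K).seq D n = eqChaseSeq I K D n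
  | 0 => rfl
  | n + 1 => congrArg (Option.bind · (EqChaseState.step I K)) (seq_eqChaseProcess D n)

theorem upTo_chaseProcess (D : Finset (RelAtom S (Const Dom))) (ℓ : ℕ) :
    (chaseProcess I K).upTo D ℓ = chaseUpTo I K D ℓ := by
  simp only [ChaseProcess.upTo, seq_chaseProcess]
  rfl

theorem upTo_eqChaseProcess (D : Finset (RelAtom S (Const Dom))) (ℓ : ℕ) :
    (eqChaseProcess I K).upTo D ℓ = eqChaseUpTo I K D ℓ := by
  simp only [ChaseProcess.upTo, seq_eqChaseProcess]
  rfl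

theorem regular_chaseProcess [Finite S.Pred] (tame : TameDeps I K) :
    (chaseProcess I K : ChaseProcess S S Dom _).Regular ChaseState.Inv where
  inv_init := ChaseState.inv_init
  inv_step := ChaseState.Inv.step
  inv_view := id
  push _ := ChaseState.step_push tame
  labelled_init {_ _ D} h := (ChaseState.atoms_init D).symm ▸ h
  contains_init h h' := ChaseState.contains_init h h'
  imitable_step _ := ChaseState.exists_imitable_step tame

theorem regular_eqChaseProcess [Finite S.Pred] (tame : TameDeps I K) :
    (eqChaseProcess I K : ChaseProcess S S.withEq Dom _).Regular EqChaseState.Inv where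
  inv_init := EqChaseState.inv_init
  inv_step := EqChaseState.Inv.step
  inv_view h := h.toInv
  push hs h := ⟨id, IsMerge.id, EqChaseState.step_lev_le tame hs h⟩
  labelled_init := EqChaseState.labelled_init
  contains_init h h' := EqChaseState.contains_init h h'
  imitable_step _ := EqChaseState.exists_imitable_step tame

end Processes

/-! ### Databases up to isomorphism -/

theorem exists_strictMonoOn_fin {α : Type*} [LinearOrder α] {X : Set α} (hX : X.Finite) {N : ℕ}
    (h : X.ncard ≤ N) : ∃ r : α → Fin (N + 1), StrictMonoOn r X := by
  have hle (c : α) : (X ∩ Set.Iio c).ncard ≤ N :=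
    (Set.ncard_le_ncard Set.inter_subset_left hX).trans h
  refine ⟨fun c => ⟨(X ∩ Set.Iio c).ncard, Nat.lt_succ_of_le (hle c)⟩, fun a ha b _ hab => ?_⟩
  refine Set.ncard_lt_ncard ⟨?_, fun hsub => ?_⟩ (hX.subset Set.inter_subset_left)
  · exact Set.inter_subset_inter_right X (Set.Iio_subset_Iio hab.le)
  · exact lt_irrefl a (hsub ⟨ha, hab⟩).2

theorem ncard_constsOf_le {S : RelSchema} {K : Type*} (D : Finset (RelAtom S K)) {a : ℕ}
    (ha : ∀ p, S.arity p ≤ a) : (constsOf (D : Set (RelAtom S K))).ncard ≤ D.card * a := by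
  classical
  have hD : constsOf (D : Set (RelAtom S K)) = D.biUnion fun f => Finset.univ.image f.args := by
    ext
    simp [constsOf]
  rw [hD, Set.ncard_coe_finset]
  refine Finset.card_biUnion_le_card_mul _ _ _ fun f _ => Finset.card_image_le.trans ?_
  simpa using ha f.pred

instance {S : RelSchema} [Finite S.Pred] {K : Type*} [Finite K] : Finite (RelAtom S K) :=
  Finite.of_injective
    (fun f : RelAtom S K => (⟨f.pred, f.args⟩ : (p : S.Pred) × (Fin (S.arity p) → K)))
    fun ⟨_, _⟩ ⟨_, _⟩ h => by simpa using h

section Isomorphism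

variable {S : RelSchema} {Dom : Type*} {Q : Set Dom}

open Classical in
/-- What an embedding has to preserve of a single constant: `none` if it is fresh, and otherwise
which of the constants in `Q` it is, if any. -/
noncomputable def constKind (Q : Set Dom) (c : Const Dom) : Option (Option Q) :=
  if h : ∃ d, c = Const.dom d then some (if hd : h.choose ∈ Q then some ⟨_, hd⟩ else none)
  else none

theorem constKind_eq_none_iff {c : Const Dom} :
    constKind Q c = none ↔ ¬ ∃ d, c = Const.dom d := by
  unfold constKind
  split_ifs with h <;> simp [h]

theorem constKind_eq_some_iff {c : Const Dom} (d : Q) :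
    constKind Q c = some (some d) ↔ c = Const.dom d.1 := by
  unfold constKind
  constructor
  · intro h
    split_ifs at h with hc hd
    · cases h
      exact hc.choose_spec
    · cases h
  · rintro rfl
    have h : ∃ e, Const.dom d.1 = Const.dom e := ⟨d, rfl⟩
    have he : h.choose = d.1 := (Const.dom_injective h.choose_spec).symm
    simp [he]

variable [LinearOrder Dom]

theorem constEmb_of_constKind {W : Set (Const Dom)} {ρ : Const Dom → Const Dom}
    (hρ : StrictMonoOn ρ W) (h : ∀ c ∈ W, constKind Q (ρ c) = constKind Q c) :
    ConstEmb Q W ρ where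
  strictMonoOn := hρ
  isDom_iff c hc := not_iff_not.1 <| by rw [← constKind_eq_none_iff (Q := Q),
    ← constKind_eq_none_iff (Q := Q), h c hc]
  eq_dom_iff d hd c hc := by
    rw [← constKind_eq_some_iff ⟨d, hd⟩, ← constKind_eq_some_iff ⟨d, hd⟩, h c hc]

theorem exists_dbEmb_of_image_map_eq {ι : Type*} [LinearOrder ι]
    {D₁ D₂ : Finset (RelAtom S (Const Dom))} {r₁ r₂ : Const Dom → ι}
    (h₁ : StrictMonoOn r₁ (constsOf (D₁ : Set (RelAtom S (Const Dom)))))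
    (h₂ : StrictMonoOn r₂ (constsOf (D₂ : Set (RelAtom S (Const Dom)))))
    (h : RelAtom.map (fun c => (r₁ c, constKind Q c)) '' (D₁ : Set (RelAtom S (Const Dom))) =
      RelAtom.map (fun c => (r₂ c, constKind Q c)) '' (D₂ : Set (RelAtom S (Const Dom)))) :
    ∃ ρ, DbEmb Q ρ D₁ D₂ := by
  have hex : ∀ c ∈ constsOf (D₁ : Set (RelAtom S (Const Dom))),
      ∃ c' ∈ constsOf (D₂ : Set (RelAtom S (Const Dom))),
        (r₂ c', constKind Q c') = (r₁ c, constKind Q c) := by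
    intro c hc
    have himage := congrArg constsOf h
    rw [constsOf_image_map, constsOf_image_map] at himage
    exact himage.subset (Set.mem_image_of_mem _ hc)
  have : Nonempty (Const Dom) := ⟨Const.fresh 0⟩
  choose! ρ hρ hcode using hex
  have hr (c) (hc : c ∈ constsOf _) : r₂ (ρ c) = r₁ c := congrArg Prod.fst (hcode c hc)
  refine ⟨ρ, constEmb_of_constKind (fun a ha b hb hab => ?_) fun c hc =>
    congrArg Prod.snd (hcode c hc), ?_⟩
  · rw [← h₂.lt_iff_lt (hρ a ha) (hρ b hb), hr a ha, hr b hb]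
    exact h₁ ha hb hab
  have hinj : Set.InjOn (fun c => (r₂ c, constKind Q c))
      (constsOf (D₂ : Set (RelAtom S (Const Dom)))) :=
    fun a ha b hb hab => h₂.injOn ha hb (congrArg Prod.fst hab)
  refine ((map_injOn_atomsOver hinj).image_eq_image_iff ?_ (constsOf_subset_iff.1 subset_rfl)).1 ?_
  · rintro _ ⟨f, hf, rfl⟩
    exact map_mem_atomsOver hρ (args_mem_constsOf hf)
  · rw [← h, Set.image_image]
    refine Set.image_congr fun f hf => ?_
    exact RelAtom.map_congr (σ := (fun c => (r₂ c, constKind Q c)) ∘ ρ)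
      (τ := fun c => (r₁ c, constKind Q c)) fun i => hcode _ (args_mem_constsOf hf i)

theorem exists_finite_representatives [Finite S.Pred] (hQ : Q.Finite) (M : ℕ) :
    ∃ R : Set (Finset (RelAtom S (Const Dom))), R.Finite ∧
      ∀ D : Finset (RelAtom S (Const Dom)), D.card ≤ M → ∃ D' ∈ R, ∃ ρ, DbEmb Q ρ D' D := by
  obtain ⟨a, ha⟩ : ∃ a, ∀ p, S.arity p ≤ a := by
    obtain ⟨a, ha⟩ := (Set.finite_range S.arity).bddAbove
    exact ⟨a, fun p => ha ⟨p, rfl⟩⟩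
  have hnumber (D : Finset (RelAtom S (Const Dom))) (hD : D.card ≤ M) :
      ∃ r : Const Dom → Fin (M * a + 1),
        StrictMonoOn r (constsOf (D : Set (RelAtom S (Const Dom)))) :=
    exists_strictMonoOn_fin (finite_constsOf D.finite_toSet)
      ((ncard_constsOf_le D ha).trans (Nat.mul_le_mul_right a hD))
  choose! r hr using hnumber
  have : Finite Q := hQ
  obtain ⟨R, hR, hbij⟩ := Set.exists_subset_bijOn {D : Finset (RelAtom S (Const Dom)) | D.card ≤ M}
    (fun D => RelAtom.map (fun c => (r D c, constKind Q c)) '' (D : Set (RelAtom S (Const Dom))))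
  refine ⟨R, Set.Finite.of_finite_image (Set.toFinite _) hbij.injOn, fun D hD => ?_⟩
  obtain ⟨D', hD', h⟩ := hbij.surjOn ⟨D, hD, rfl⟩
  exact ⟨D', hD', exists_dbEmb_of_image_map_eq (hr D' (hR hD')) (hr D hD) h⟩

end Isomorphism

/-! ### Components of the join graph -/

section Components

variable {S : RelSchema} {K : Type*} {D : Finset (RelAtom S K)}

open Classical in
/-- The component of the join graph of `D` whose facts contain the constant `c`, if there is one. -/
noncomputable def componentLabel (D : Finset (RelAtom S K)) (c : K) :
    Option (joinGraph D).ConnectedComponent :=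
  if h : ∃ f : D, ∃ i, f.1.args i = c then some ((joinGraph D).connectedComponentMk h.choose)
  else none

theorem componentLabel_args {f : RelAtom S K} (hf : f ∈ D) (i : Fin (S.arity f.pred)) :
    componentLabel D (f.args i) = some ((joinGraph D).connectedComponentMk ⟨f, hf⟩) := by
  have h : ∃ g : D, ∃ j, g.1.args j = f.args i := ⟨⟨f, hf⟩, i, rfl⟩
  obtain ⟨j, hj⟩ := h.choose_spec
  rw [componentLabel, dif_pos h, Option.some_inj]
  by_cases he : h.choose = ⟨f, hf⟩
  · rw [he]
  · exact SimpleGraph.ConnectedComponent.connectedComponentMk_eq_of_adj ⟨he, j, i, hj⟩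

theorem labelled_componentLabel : Labelled (D : Set (RelAtom S K)) (componentLabel D) :=
  fun _ hf i j => (componentLabel_args hf i).trans (componentLabel_args hf j).symm

theorem card_filter_componentLabel_le [DecidableEq (Option (joinGraph D).ConnectedComponent)]
    (hS : ∀ p, 0 < S.arity p) (c : Option (joinGraph D).ConnectedComponent) :
    (D.filter fun f => componentLabel D (f.args ⟨0, hS _⟩) = c).card ≤ connSize D := by
  rw [← Set.ncard_coe_finset]
  rcases c with _ | c
  · have hempty : (D.filter fun f => componentLabel D (f.args ⟨0, hS _⟩) = none) = ∅ :=
      Finset.filter_eq_empty_iff.2 fun f hf h => by simp [componentLabel_args hf] at h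
    simp [hempty]
  · have hbdd : BddAbove (Set.range fun c : (joinGraph D).ConnectedComponent => c.supp.ncard) :=
      (Set.finite_range _).bddAbove
    refine le_trans ?_ (le_ciSup hbdd c)
    rw [← Set.ncard_image_of_injective _ Subtype.val_injective]
    refine Set.ncard_le_ncard (fun f hf => ?_) (Set.toFinite _)
    obtain ⟨hfD, h⟩ := Finset.mem_filter.1 (Finset.mem_coe.1 hf)
    rw [componentLabel_args hfD] at h
    exact ⟨⟨f, hfD⟩, Option.some.inj h, rfl⟩

theorem exists_finset_eq_components (hS : ∀ p, 0 < S.arity p)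
    (T : Finset (Option (joinGraph D).ConnectedComponent)) : ∃ D' : Finset (RelAtom S K),
      (D' : Set (RelAtom S K)) = ↑D ∩ atomsOver (componentLabel D ⁻¹' T) ∧
      D'.card ≤ connSize D * T.card := by
  classical
  refine ⟨D.filter (· ∈ atomsOver (componentLabel D ⁻¹' T)), by ext; simp,
    Finset.card_le_mul_card_image_of_maps_to
      (f := fun f => componentLabel D (f.args ⟨0, hS _⟩)) (fun f hf => ?_) _ fun c _ => ?_⟩
  · exact (Finset.mem_filter.1 hf).2 _
  · exact (Finset.card_le_card (Finset.filter_subset_filter _ (Finset.filter_subset _ _))).trans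
      (card_filter_componentLabel_le hS c)

end Components

/-! ### Answers to queries -/

section Answers

variable {S : RelSchema} {Dom V : Type*} {m : ℕ}

theorem QTerm.eval_comp {σ : Const Dom → Const Dom} {μ : V → Const Dom} {u : QTerm Dom V}
    (h : ∀ d, u = QTerm.const d → σ (Const.dom d) = Const.dom d) :
    u.eval (σ ∘ μ) = σ (u.eval μ) := by
  cases u with
  | var x => rfl
  | const d => exact (h d rfl).symm

theorem RelAtom.map_eval_comp {σ : Const Dom → Const Dom} {μ : V → Const Dom}
    {A : RelAtom S (QTerm Dom V)}
    (h : ∀ i d, A.args i = QTerm.const d → σ (Const.dom d) = Const.dom d) :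
    A.map (QTerm.eval (σ ∘ μ)) = (A.map (QTerm.eval μ)).map σ :=
  RelAtom.map_congr (σ := QTerm.eval (σ ∘ μ)) (τ := σ ∘ QTerm.eval μ) fun i =>
    QTerm.eval_comp (h i)

namespace ConjQuery

/-- The non-fresh constants that occur in a query. -/
def constants (q : ConjQuery S Dom V m) : Set Dom :=
  {d | ∃ A ∈ q.body, ∃ i, A.args i = QTerm.const d}

theorem finite_constants (q : ConjQuery S Dom V m) : q.constants.Finite := by
  have hterms : (⋃ A ∈ {A | A ∈ q.body}, Set.range A.args).Finite :=
    (List.finite_toSet q.body).biUnion fun A _ => Set.finite_range A.args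
  refine Set.Finite.of_finite_image (f := QTerm.const (V := V)) (hterms.subset ?_)
    fun d _ d' _ h => QTerm.const.inj h
  rintro _ ⟨d, ⟨A, hA, i, hi⟩, rfl⟩
  exact Set.mem_biUnion hA ⟨i, hi⟩

/-- The level `B` suffices for the fresh-free answers to `q` over the atoms of the state `s`. -/
def LevelBound (q : ConjQuery S Dom V m) (s : ChaseState S Dom) (B : ℕ) : Prop :=
  ∀ t : Fin m → Dom, (∃ μ, q.Sends μ s.atoms (Const.dom ∘ t)) →
    ∃ μ, q.Sends μ {f | s.lev f ≤ B} (Const.dom ∘ t)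

variable {q : ConjQuery S Dom V m} {s s' : ChaseState S Dom}

namespace Sends

variable {μ : V → Const Dom} {F F' : Set (RelAtom S (Const Dom))} {t : Fin m → Const Dom}

theorem mono (h : q.Sends μ F t) (hF : F ⊆ F') : q.Sends μ F' t :=
  ⟨fun A hA => hF (h.1 A hA), h.2⟩

theorem dom_mem_constsOf (h : q.Sends μ F t) {d : Dom} (hd : d ∈ q.constants) :
    Const.dom d ∈ constsOf F := by
  obtain ⟨A, hA, i, hi⟩ := hd
  exact ⟨_, h.1 A hA, i, congrArg (QTerm.eval μ) hi⟩

theorem head_mem_constsOf (h : q.Sends μ F t) (i : Fin m) : t i ∈ constsOf F := by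
  obtain ⟨A, hA, j, hj⟩ := q.range_restricted i
  exact ⟨_, h.1 A hA, j, (congrArg (QTerm.eval μ) hj).trans (h.2 i)⟩

theorem comp (h : q.Sends μ F t) {σ : Const Dom → Const Dom}
    (hσ : ∀ d ∈ q.constants, σ (Const.dom d) = Const.dom d) (hF : ∀ f ∈ F, f.map σ ∈ F') :
    q.Sends (σ ∘ μ) F' (σ ∘ t) := by
  refine ⟨fun A hA => ?_, fun i => congrArg σ (h.2 i)⟩
  rw [RelAtom.map_eval_comp fun i d hi => hσ d ⟨A, hA, i, hi⟩]
  exact hF _ (h.1 A hA)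

theorem comp_dom {t : Fin m → Dom} (h : q.Sends μ F (Const.dom ∘ t)) {σ : Const Dom → Const Dom}
    (hσ : ∀ d, σ (Const.dom d) = Const.dom d) (hF : ∀ f ∈ F, f.map σ ∈ F') :
    q.Sends (σ ∘ μ) F' (Const.dom ∘ t) := by
  have hcomp := h.comp (fun d _ => hσ d) hF
  rwa [show σ ∘ Const.dom ∘ t = Const.dom ∘ t from funext fun i => hσ (t i)] at hcomp

theorem exists_lev_le (h : q.Sends μ s.atoms t) :
    ∃ B : ℕ, q.Sends μ {f | s.lev f ≤ B} t := by
  obtain ⟨B, hB⟩ := ((List.finite_toSet q.body).image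
    fun A => (s.lev (A.map (QTerm.eval μ))).toNat).bddAbove
  refine ⟨B, fun A hA => ?_, h.2⟩
  change s.lev _ ≤ _
  rw [← ENat.natCast_toNat (h.1 A hA)]
  exact Nat.cast_le.2 (hB ⟨A, hA, rfl⟩)

theorem exists_labels (h : q.Sends μ F t) (arity_pos : ∀ p, 0 < S.arity p) {Λ : Type*}
    {lam : Const Dom → Λ} (hF : Labelled F lam) :
    ∃ T : Finset Λ, T.card ≤ q.body.length ∧ q.Sends μ (F ∩ atomsOver (lam ⁻¹' T)) t := by
  classical
  let label (A : RelAtom S (QTerm Dom V)) : Λ := lam ((A.args ⟨0, arity_pos _⟩).eval μ)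
  refine ⟨(q.body.map label).toFinset, (List.toFinset_card_le _).trans (List.length_map _).le,
    fun A hA => ⟨h.1 A hA, fun i => ?_⟩, h.2⟩
  have hi : lam ((A.args i).eval μ) = label A := hF _ (h.1 A hA) i ⟨0, arity_pos _⟩
  exact Set.mem_preimage.2
    (hi ▸ Finset.mem_coe.2 (List.mem_toFinset.2 (List.mem_map_of_mem hA)))

end Sends

end ConjQuery

namespace Sim

variable [LinearOrder Dom] {q : ConjQuery S Dom V m} {P W : Set (Const Dom)}
  {ρ : Const Dom → Const Dom} {s s' : ChaseState S Dom} {t : Fin m → Const Dom}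

theorem exists_sends_of_sends (h : Sim q.constants P W ρ s s') {μ : V → Const Dom}
    (hμ : q.Sends μ (s.atoms ∩ atomsOver P) t) :
    ∃ ν t', q.Sends ν s'.atoms t' ∧ (∀ i, t' i ∈ W) ∧ ρ ∘ t' = t := by
  have : Nonempty (Const Dom) := ⟨Const.fresh 0⟩
  have hinv : Set.LeftInvOn (Function.invFunOn ρ W) ρ W :=
    h.strictMonoOn.injOn.leftInvOn_invFunOn
  have hcover : constsOf (s.atoms ∩ atomsOver P) ⊆ ρ '' W :=
    constsOf_subset_iff.2 fun f hf => h.mem_atomsOver_image hf.1 hf.2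
  have hhead (i : Fin m) : t i ∈ ρ '' W := hcover (hμ.head_mem_constsOf i)
  refine ⟨_, _, hμ.comp (σ := Function.invFunOn ρ W) (fun d hd => ?_) (fun f hf => ?_),
    fun i => Function.invFunOn_mem (hhead i), funext fun i => Function.invFunOn_eq (hhead i)⟩
  · obtain ⟨c, hc, hcd⟩ := hcover (hμ.dom_mem_constsOf hd)
    rw [← hcd, hinv hc, hcd]
    exact (h.eq_dom_iff d hd c hc).1 hcd
  · obtain ⟨g, hg, rfl⟩ := exists_map_eq_of_mem_atomsOver (h.mem_atomsOver_image hf.1 hf.2)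
    have hg' : (g.map ρ).map (Function.invFunOn ρ W) = g :=
      RelAtom.map_congr (σ := Function.invFunOn ρ W ∘ ρ) (τ := id) fun i => hinv (hg i)
    rw [hg']
    exact (h.map_mem_atoms_iff hg).1 hf.1

theorem sends_of_sends (h : Sim q.constants P W ρ s s') {B : ℕ} {ν : V → Const Dom}
    (hν : q.Sends ν {f | s'.lev f ≤ B} t) : q.Sends (ρ ∘ ν) {f | s.lev f ≤ B} (ρ ∘ t) := by
  have hsub : {f | s'.lev f ≤ B} ⊆ s'.atoms :=
    fun f hf => ne_top_of_le_ne_top (ENat.natCast_ne_top B) hf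
  refine hν.comp (fun d hd => ?_) fun f hf => ?_
  · exact (h.eq_dom_iff d hd _
      (h.consts_subset ((hν.mono hsub).dom_mem_constsOf hd))).2 rfl
  · exact (h.lev_map f (h.atoms_subset (hsub hf))).trans_le hf

end Sim

theorem ConjQuery.LevelBound.exists_sends_of_contains [LinearOrder Dom] {q : ConjQuery S Dom V m}
    {P : Set (Const Dom)} {s s' : ChaseState S Dom} {B : ℕ} (hB : q.LevelBound s' B)
    (h : s.Contains q.constants P s') {μ : V → Const Dom} {t : Fin m → Dom}
    (hμ : q.Sends μ (s.atoms ∩ atomsOver P) (Const.dom ∘ t)) :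
    ∃ ν, q.Sends ν {f | s.lev f ≤ B} (Const.dom ∘ t) := by
  obtain ⟨W, ρ, hsim⟩ := h
  obtain ⟨ν, t', hν, ht'W, ht'⟩ := hsim.exists_sends_of_sends hμ
  have hdom (i : Fin m) : ∃ d, t' i = Const.dom d :=
    (hsim.isDom_iff _ (ht'W i)).1 ⟨t i, congrFun ht' i⟩
  choose u hu using hdom
  obtain rfl : t' = Const.dom ∘ u := funext hu
  obtain ⟨ν', hν'⟩ := hB u ⟨ν, hν⟩
  exact ⟨ρ ∘ ν', ht' ▸ hsim.sends_of_sends hν'⟩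

end Answers

/-! ### Limits of merges -/

section Limits

variable {S : RelSchema} {Dom : Type*} [LinearOrder Dom]

/-- The composition of the first `k` maps of a sequence. -/
def orbit {α : Type*} (σ : ℕ → α → α) : ℕ → α → α
  | 0 => id
  | k + 1 => σ k ∘ orbit σ k

variable {σ : ℕ → Const Dom → Const Dom}

theorem isMerge_orbit (hσ : ∀ k, IsMerge (σ k)) : ∀ k, IsMerge (orbit σ k)
  | 0 => IsMerge.id
  | k + 1 => (hσ k).comp (isMerge_orbit hσ k)

theorem exists_eventually_orbit_eq (hσ : ∀ k, IsMerge (σ k)) (c : Const Dom) :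
    ∃ c', ∀ᶠ k in Filter.atTop, orbit σ k c = c' := by
  by_cases h : ∃ k d, orbit σ k c = Const.dom d
  · obtain ⟨k, d, hkd⟩ := h
    refine ⟨Const.dom d, Filter.eventually_atTop.2 ⟨k, fun n hn => ?_⟩⟩
    induction n, hn using Nat.le_induction with
    | base => exact hkd
    | succ n _ ih => exact (congrArg (σ n) ih).trans ((hσ n).map_dom d)
  · have hfresh (k : ℕ) : ∃ j, orbit σ k c = Const.fresh j :=
      (orbit σ k c).eq_dom_or_eq_fresh.resolve_left fun ⟨d, hd⟩ => h ⟨k, d, hd⟩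
    choose j hj using hfresh
    have hanti : Antitone j := antitone_nat_of_succ_le fun k => not_lt.1 fun hlt =>
      ((hσ k).map_le (orbit σ k c)).not_gt <| calc
        orbit σ k c = Const.fresh (j k) := hj k
        _ < Const.fresh (j (k + 1)) := Const.fresh_lt_fresh.2 hlt
        _ = σ k (orbit σ k c) := (hj (k + 1)).symm
    obtain ⟨n, hn⟩ := WellFoundedLT.antitone_chain_condition hanti
    refine ⟨Const.fresh (j n), Filter.eventually_atTop.2 ⟨n, fun k hk => ?_⟩⟩
    rw [hj, ← show j n = j k from hn k hk]

theorem exists_limit (hσ : ∀ k, IsMerge (σ k)) {L : ℕ → RelAtom S (Const Dom) → ℕ∞}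
    (hL : ∀ k f, L (k + 1) (f.map (σ k)) ≤ L k f) :
    ∃ lim : Const Dom → Const Dom, (∀ d, lim (Const.dom d) = Const.dom d) ∧
      ∀ f (B : ℕ), L 0 f ≤ B →
        ∃ j : ℕ, j ≤ B ∧ ∀ᶠ k in Filter.atTop, L k (f.map lim) = j := by
  choose lim hlim using exists_eventually_orbit_eq hσ
  refine ⟨lim, fun d => ?_, fun f B hB => ?_⟩
  · obtain ⟨k, hk⟩ := (hlim (Const.dom d)).exists
    rw [← hk, (isMerge_orbit hσ k).map_dom]
  have hanti : Antitone fun k => L k (f.map (orbit σ k)) :=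
    antitone_nat_of_succ_le fun k => hL k (f.map (orbit σ k))
  obtain ⟨n, hn⟩ := WellFoundedLT.antitone_chain_condition hanti
  have hle : L n (f.map (orbit σ n)) ≤ B := (hanti (Nat.zero_le n)).trans hB
  obtain ⟨j, hj⟩ := ENat.ne_top_iff_exists.1 (ne_top_of_le_ne_top (ENat.natCast_ne_top B) hle)
  refine ⟨j, by rwa [← hj, Nat.cast_le] at hle, ?_⟩
  have hargs : ∀ᶠ k in Filter.atTop, ∀ i, orbit σ k (f.args i) = lim (f.args i) :=
    Filter.eventually_all.2 fun i => hlim _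
  filter_upwards [hargs, Filter.eventually_ge_atTop n] with k hk hnk
  rw [← RelAtom.map_congr hk, hj]
  exact (hn k hnk).symm

end Limits

/-! ### Bounds for the levels of answers -/

namespace ChaseProcess

namespace Regular

variable {S S' : RelSchema} {Dom : Type u} {St : Type*} [LinearOrder Dom]
  {P : ChaseProcess S S' Dom St} {J : Set (Const Dom) → St → Prop}
  {D : Finset (RelAtom S (Const Dom))} {V : Type*} {m : ℕ} {q : ConjQuery S' Dom V m}

theorem push_seq (hP : P.Regular J) {n n' : ℕ} (hn : n ≤ n') {s s' : St}
    (h : P.seq D n = some s) (h' : P.seq D n' = some s') :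
    ∃ σ, IsMerge σ ∧ ∀ f, (P.view s').lev (f.map σ) ≤ (P.view s).lev f := by
  induction n', hn using Nat.le_induction generalizing s' with
  | base =>
    obtain rfl := Option.some.inj (h.symm.trans h')
    exact ⟨id, IsMerge.id, fun f => le_rfl⟩
  | succ n' _ ih =>
    obtain ⟨s₀, h₀, hstep⟩ := Option.bind_eq_some_iff.1 h'
    obtain ⟨σ, hσ, hle⟩ := ih h₀
    obtain ⟨τ, hτ, hle'⟩ := hP.push (hP.inv_seq h₀) hstep
    exact ⟨τ ∘ σ, hτ.comp hσ, fun f => (hle' (f.map σ)).trans (hle f)⟩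

theorem exists_levelBound_tuple (hP : P.Regular J) (q : ConjQuery S' Dom V m)
    (D : Finset (RelAtom S (Const Dom))) (t : Fin m → Dom) :
    ∃ B : ℕ, ∀ n s, P.seq D n = some s → (∃ μ, q.Sends μ (P.view s).atoms (Const.dom ∘ t)) →
      ∃ μ, q.Sends μ {f | (P.view s).lev f ≤ B} (Const.dom ∘ t) := by
  classical
  by_cases h : ∃ n s, P.seq D n = some s ∧ ∃ μ, q.Sends μ (P.view s).atoms (Const.dom ∘ t)
  · obtain ⟨s₀, hs₀, μ₀, hμ₀⟩ := Nat.find_spec h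
    obtain ⟨B, hB⟩ := hμ₀.exists_lev_le
    refine ⟨B, fun n s hs hex => ?_⟩
    obtain ⟨σ, hσ, hle⟩ := hP.push_seq (Nat.find_min' h ⟨s, hs, hex⟩) hs₀ hs
    exact ⟨σ ∘ μ₀, hB.comp_dom hσ.map_dom fun f hf => (hle f).trans hf⟩
  · exact ⟨0, fun n s hs hex => absurd ⟨n, s, hs, hex⟩ h⟩

theorem exists_levelBound (hP : P.Regular J) (q : ConjQuery S' Dom V m)
    (D : Finset (RelAtom S (Const Dom))) :
    ∃ B, ∀ n s, P.seq D n = some s → q.LevelBound (P.view s) B := by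
  choose B hB using hP.exists_levelBound_tuple q D
  have hfin : {t : Fin m → Dom | ∀ i, t i ∈ Const.dom ⁻¹'
      constsOf (D : Set (RelAtom S (Const Dom)))}.Finite :=
    Set.Finite.pi' fun _ => (finite_constsOf D.finite_toSet).preimage Const.dom_injective.injOn
  refine ⟨hfin.toFinset.sup B, fun n s hs t hex => ?_⟩
  obtain ⟨μ, hμ⟩ := hB t n s hs hex
  obtain ⟨μ', hμ'⟩ := hex
  have ht : t ∈ hfin.toFinset := hfin.mem_toFinset.2 fun i =>
    (hP.inv_view (hP.inv_seq hs)).dom_mem _ (hμ'.head_mem_constsOf i)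
  exact ⟨μ, hμ.mono fun f hf => le_trans (α := ℕ∞) hf (Nat.cast_le.2 (Finset.le_sup ht))⟩

theorem exists_levelBound_representative [Finite S.Pred] (hP : P.Regular J)
    (q : ConjQuery S' Dom V m) (M : ℕ) :
    ∃ B, ∀ D : Finset (RelAtom S (Const Dom)), D.card ≤ M → ∃ D' ρ, DbEmb q.constants ρ D' D ∧
      ∀ n s, P.seq D' n = some s → q.LevelBound (P.view s) B := by
  choose B hB using hP.exists_levelBound q
  obtain ⟨R, hR, hrep⟩ := exists_finite_representatives (S := S) q.finite_constants M
  refine ⟨hR.toFinset.sup B, fun D hD => ?_⟩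
  obtain ⟨D', hD', ρ, hρ⟩ := hrep D hD
  refine ⟨D', ρ, hρ, fun n s hs t hex => ?_⟩
  obtain ⟨μ, hμ⟩ := hB D' n s hs t hex
  exact ⟨μ, hμ.mono fun f hf =>
    le_trans (α := ℕ∞) hf (Nat.cast_le.2 (Finset.le_sup (hR.mem_toFinset.2 hD')))⟩

theorem exists_levelBound_connSize [Finite S.Pred] (hP : P.Regular J)
    (hS : ∀ p, 0 < S.arity p) (hS' : ∀ p, 0 < S'.arity p) (q : ConjQuery S' Dom V m) (κ : ℕ) :
    ∃ B, ∀ D : Finset (RelAtom S (Const Dom)), connSize D = κ →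
      ∀ n s, P.seq D n = some s → q.LevelBound (P.view s) B := by
  obtain ⟨B, hB⟩ := hP.exists_levelBound_representative q (κ * q.body.length)
  refine ⟨B, ?_⟩
  rintro D rfl n s hs t ⟨μ, hμ⟩
  obtain ⟨lam, hlam, hcontains⟩ :=
    hP.exists_label_contains q.constants (labelled_componentLabel (D := D)) hs
  obtain ⟨T, hT, hμT⟩ := hμ.exists_labels hS' hlam
  obtain ⟨D₁, hD₁, hcard⟩ := exists_finset_eq_components hS T
  obtain ⟨D₂, ρ, hρ, hB₂⟩ := hB D₁ (hcard.trans (Nat.mul_le_mul_left _ hT))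
  obtain ⟨n', s', hs', hc⟩ := hcontains T D₂ ρ (hD₁ ▸ hρ)
  exact (hB₂ n' s' hs').exists_sends_of_contains hc hμT

theorem exists_sends_upTo (hP : P.Regular J) {n : ℕ} {s : ℕ → St}
    (hs : ∀ k, P.seq D (n + k) = some (s k)) {B : ℕ} {t : Fin m → Dom} {μ : V → Const Dom}
    (h : q.Sends μ {f | (P.view (s 0)).lev f ≤ B} (Const.dom ∘ t)) :
    ∃ μ', q.Sends μ' (P.upTo D B) (Const.dom ∘ t) := by
  have hpush (k : ℕ) := hP.push_seq (Nat.le_succ (n + k)) (hs k) (hs (k + 1))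
  choose σ hσ hle using hpush
  obtain ⟨lim, hlim, hlev⟩ := exists_limit hσ (L := fun k => (P.view (s k)).lev) hle
  refine ⟨lim ∘ μ, h.comp_dom hlim fun f hf => ?_⟩
  obtain ⟨j, hj, hev⟩ := hlev f B hf
  refine ⟨j, hj, ?_⟩
  filter_upwards [(Filter.tendsto_sub_atTop_nat n).eventually hev,
    Filter.eventually_ge_atTop n] with k hk hnk
  exact ⟨s (k - n), by rw [← hs, Nat.add_sub_cancel' hnk], hk⟩

end Regular

variable {S S' : RelSchema} {Dom : Type u} {St : Type*} {P : ChaseProcess S S' Dom St}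
  {D : Finset (RelAtom S (Const Dom))} {V : Type*} {m : ℕ} {q : ConjQuery S' Dom V m}

theorem upTo_mono {ℓ ℓ' : ℕ} (h : ℓ ≤ ℓ') : P.upTo D ℓ ⊆ P.upTo D ℓ' :=
  fun _ ⟨k, hk, hev⟩ => ⟨k, hk.trans h, hev⟩

theorem exists_seq_of_sends_iUnion_upTo (hbody : q.body ≠ []) {μ : V → Const Dom}
    {t : Fin m → Const Dom} (h : q.Sends μ (⋃ k, P.upTo D k) t) :
    ∃ n, ∃ s : ℕ → St, (∀ k, P.seq D (n + k) = some (s k)) ∧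
      q.Sends μ (P.view (s 0)).atoms t := by
  have hev : ∀ᶠ n in Filter.atTop, ∀ A ∈ {A | A ∈ q.body}, ∃ s, P.seq D n = some s ∧
      A.map (QTerm.eval μ) ∈ (P.view s).atoms := by
    refine ((List.finite_toSet q.body).eventually_all).2 fun A hA => ?_
    obtain ⟨k, j, -, hj⟩ := Set.mem_iUnion.1 (h.1 A hA)
    filter_upwards [hj] with n ⟨s, hs, hlev⟩
    exact ⟨s, hs, fun htop => ENat.natCast_ne_top j (hlev.symm.trans htop)⟩
  obtain ⟨n, hn⟩ := Filter.eventually_atTop.1 hev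
  obtain ⟨A₀, hA₀⟩ := List.exists_mem_of_ne_nil _ hbody
  choose s hs _ using fun k => hn (n + k) (Nat.le_add_right n k) A₀ hA₀
  refine ⟨n, s, hs, fun A hA => ?_, h.2⟩
  obtain ⟨s', hs', hmem⟩ := hn n le_rfl A hA
  obtain rfl : s 0 = s' := Option.some.inj ((hs 0).symm.trans hs')
  exact hmem

theorem Regular.exists_sends_upTo_connSize [LinearOrder Dom] [Finite S.Pred]
    {J : Set (Const Dom) → St → Prop} (hP : P.Regular J) (hS : ∀ p, 0 < S.arity p)
    (hS' : ∀ p, 0 < S'.arity p) (q : ConjQuery S' Dom V m) :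
    ∃ δ : ℕ → ℕ, ∀ (D : Finset (RelAtom S (Const Dom))) (ℓ : ℕ), δ (connSize D) ≤ ℓ →
      ∀ t ∈ q.freshFreeAnswers (⋃ k, P.upTo D k), ∃ μ, q.Sends μ (P.upTo D ℓ) t := by
  choose δ hδ using hP.exists_levelBound_connSize hS hS' q
  refine ⟨δ, ?_⟩
  rintro D ℓ hℓ t ⟨⟨μ, hμ⟩, hdom⟩
  choose u hu using hdom
  obtain rfl : t = Const.dom ∘ u := funext hu
  by_cases hbody : q.body = []
  · exact ⟨μ, by simp [hbody], hμ.2⟩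
  obtain ⟨n, s, hs, hμ₀⟩ := exists_seq_of_sends_iUnion_upTo hbody hμ
  obtain ⟨ν, hν⟩ := hδ _ D rfl n (s 0) (hs 0) u ⟨μ, hμ₀⟩
  obtain ⟨ν', hν'⟩ := hP.exists_sends_upTo hs hν
  exact ⟨ν', hν'.mono (upTo_mono hℓ)⟩

end ChaseProcess

namespace EERSchema

variable (C : EERSchema)

theorem baseArity_pos : ∀ x, 0 < C.baseArity x
  | Sum.inl _ => Nat.one_pos
  | Sum.inr R => Nat.two_pos.trans_le (C.two_le_relArity R)

theorem arity_pos : ∀ p, 0 < C.schema.arity p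
  | Sum.inl x => C.baseArity_pos x
  | Sum.inr _ => Nat.succ_pos _

theorem tameDeps : TameDeps C.inclDeps C.keyDeps where
  arity_pos := C.arity_pos
  width_pos := by
    rintro _ (A | ⟨R, i⟩ | ⟨A, h⟩ | ⟨E₁, E₂, h⟩ | ⟨R₁, R₂, j, h⟩ | ⟨E, R, c, h⟩)
    · exact C.arity_pos (C.ownerPred A)
    · exact Nat.one_pos
    · exact C.arity_pos (C.ownerPred A)
    · exact Nat.one_pos
    · exact C.arity_pos (C.rel R₁)
    · exact Nat.one_pos
  tgtPos_injective := by
    rintro _ (A | ⟨R, i⟩ | ⟨A, h⟩ | ⟨E₁, E₂, h⟩ | ⟨R₁, R₂, j, h⟩ | ⟨E, R, c, h⟩)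
    · exact Function.injective_id
    · exact Function.injective_of_subsingleton (α := Fin 1) _
    · exact Fin.castSucc_injective _
    · exact Function.injective_of_subsingleton (α := Fin 1) _
    · exact j.injective
    · exact Function.injective_of_subsingleton (α := Fin 1) _
  attrs_nonempty := by
    rintro _ (⟨A, h⟩ | ⟨E, R, c, h⟩)
    · exact ⟨_, Finset.mem_image_of_mem _ (Finset.mem_univ ⟨0, C.arity_pos _⟩)⟩
    · exact Finset.singleton_nonempty _

end EERSchema

theorem mainTheorem7_general {S : RelSchema} [Finite S.Pred] [LinearOrder S.Pred] {Dom : Type*}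
    [LinearOrder Dom] {I : Set (InclDep S)} {K : Set (KeyDep S)} (tame : TameDeps I K)
    {V : Type*} {n : ℕ} (q : ConjQuery S Dom V n) :
    ∃ δM : ℕ → ℕ, ∀ D : Finset (RelAtom S (Const Dom)), ChaseExists I K D →
      (∀ t ∈ q.freshFreeAnswers (chase I K D),
        ∃ μ, q.Sends μ (chaseUpTo I K D (δM (connSize D))) t) ∧
      (∀ t ∈ q.toEq.freshFreeAnswers (eqChase I K D),
        ∃ μ, q.toEq.Sends μ (eqChaseUpTo I K D (δM (connSize D))) t) ∧
      (∀ t ∈ q.maquillage.freshFreeAnswers (eqChase I K D),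
        ∃ μ, q.maquillage.Sends μ (eqChaseUpTo I K D (δM (connSize D))) t) := by
  have hS := tame.arity_pos
  have hS' := withEq_arity_pos hS
  have hchase := regular_chaseProcess (Dom := Dom) tame
  have heqChase := regular_eqChaseProcess (Dom := Dom) tame
  obtain ⟨δ₁, h₁⟩ := hchase.exists_sends_upTo_connSize hS hS q
  obtain ⟨δ₂, h₂⟩ := heqChase.exists_sends_upTo_connSize hS hS' q.toEq
  obtain ⟨δ₃, h₃⟩ := heqChase.exists_sends_upTo_connSize hS hS' q.maquillage
  refine ⟨fun k => max (δ₁ k) (max (δ₂ k) (δ₃ k)), fun D _ => ?_⟩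
  simp only [chase, eqChase, ← upTo_chaseProcess, ← upTo_eqChaseProcess]
  exact ⟨h₁ D _ (le_max_left _ _), h₂ D _ ((le_max_left _ _).trans (le_max_right _ _)),
    h₃ D _ ((le_max_right _ _).trans (le_max_right _ _))⟩

theorem mainTheorem7 {Dom : Type*} [Infinite Dom] [LinearOrder Dom]
    (C : EERSchema) [Finite C.Ent] [Finite C.Rel] [Finite C.Att] [LinearOrder C.schema.Pred]
    {V : Type*} {n : ℕ} (q : ConjQuery C.schema Dom V n) :
    ∃ δM : ℕ → ℕ, ∀ D : Finset (RelAtom C.schema (Const Dom)),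
      ChaseExists C.inclDeps C.keyDeps D →
        (∀ t ∈ q.freshFreeAnswers (chase C.inclDeps C.keyDeps D),
          ∃ μ, q.Sends μ (chaseUpTo C.inclDeps C.keyDeps D (δM (connSize D))) t) ∧
        (∀ t ∈ q.toEq.freshFreeAnswers (eqChase C.inclDeps C.keyDeps D),
          ∃ μ, q.toEq.Sends μ (eqChaseUpTo C.inclDeps C.keyDeps D (δM (connSize D))) t) ∧
        (∀ t ∈ q.maquillage.freshFreeAnswers (eqChase C.inclDeps C.keyDeps D),
          ∃ μ, q.maquillage.Sends μ
            (eqChaseUpTo C.inclDeps C.keyDeps D (δM (connSize D))) t) := by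
  have : Finite C.schema.Pred := inferInstanceAs (Finite ((C.Ent ⊕ C.Rel) ⊕ C.Att))
  exact mainTheorem7_general C.tameDeps q
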